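/- Let $n\ge 1$. For a finite subgroup $G$ of the unitary group $U(n)$ that acts freely on the unit sphere $S^{2n-1}\subset\mathbb{C}^n$, equip $G\backslash S^{2n-1}$ with the CR structure and the Riemannian metric induced from $\mathbb{C}^n$, let $\Box_b=\bar\partial_b^*\bar\partial_b$ be the Kohn Laplacian on functions, regarded as the closed operator on $L^2(G\backslash S^{2n-1})$ obtained by closing it from the smooth functions, and let $N_{G\backslash S^{2n-1}}(\lambda)$ be the number of positive eigenvalues of $\Box_b$, counted with multiplicity, that are less than or equal to $\lambda$. Then there is a constant $C$, depending only on $n$, such that for every finite subgroup $G$ of $U(n)$ acting freely on $S^{2n-1}$ the number $N_{G\backslash S^{2n-1}}(\lambda)$ is finite for every $\lambda$ and \[ \lim_{\lambda\to\infty}\frac{N_{G\backslash S^{2n-1}}(\lambda)}{\lambda^n} = C\,\frac{\mathrm{Vol}(S^{2n-1})}{|G|} = C\,\mathrm{Vol}(G\backslash S^{2n-1}). \] -/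

import Mathlib

open scoped ENNReal ComplexConjugate ContDiff

noncomputable section

namespace KohnWeyl

/-- `ℂⁿ` with its Hermitian norm. -/
abbrev Cn (n : ℕ) : Type := EuclideanSpace ℂ (Fin n)

/-- The unit sphere `S^{2n-1} ⊂ ℂⁿ`. -/
abbrev Sph (n : ℕ) : Type := Metric.sphere (0 : Cn n) 1

/-- The unitary group `U(n)`. -/
abbrev Un (n : ℕ) : Type := Matrix.unitaryGroup (Fin n) ℂ

theorem norm_toEuclideanLin_unitary {n : ℕ} (g : Un n) (z : Cn n) :
    ‖Matrix.toEuclideanLin (g : Matrix (Fin n) (Fin n) ℂ) z‖ = ‖z‖ := by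
  have h := Matrix.UnitaryGroup.star_mul_self g
  have key : inner ℂ (Matrix.toEuclideanLin (g : Matrix (Fin n) (Fin n) ℂ) z)
      (Matrix.toEuclideanLin (g : Matrix (Fin n) (Fin n) ℂ) z) = inner ℂ z z := by
    rw [← LinearMap.adjoint_inner_right, ← Matrix.toEuclideanLin_conjTranspose_eq_adjoint]
    congr 1
    ext i
    have h' : (g : Matrix (Fin n) (Fin n) ℂ).conjTranspose * (g : Matrix (Fin n) (Fin n) ℂ) = 1 := h
    simp [Matrix.toLpLin_apply, Matrix.mulVec_mulVec, h']
  rw [norm_eq_sqrt_re_inner (𝕜 := ℂ), key, ← norm_eq_sqrt_re_inner (𝕜 := ℂ)]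

/-- The action of `U(n)` on the sphere by left multiplication. -/
instance sphAction (n : ℕ) : MulAction (Un n) (Sph n) where
  smul g x := ⟨Matrix.toEuclideanLin (g : Matrix (Fin n) (Fin n) ℂ) x.1, by
    rw [mem_sphere_zero_iff_norm, norm_toEuclideanLin_unitary]
    exact mem_sphere_zero_iff_norm.1 x.2⟩
  one_smul x := Subtype.ext (by
    change Matrix.toEuclideanLin ((1 : Un n) : Matrix (Fin n) (Fin n) ℂ) x.1 = x.1
    ext i
    simp)
  mul_smul g h x := Subtype.ext (by
    change Matrix.toEuclideanLin ((g * h : Un n) : Matrix (Fin n) (Fin n) ℂ) x.1 =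
      Matrix.toEuclideanLin (g : Matrix (Fin n) (Fin n) ℂ)
        (Matrix.toEuclideanLin (h : Matrix (Fin n) (Fin n) ℂ) x.1)
    ext i
    simp [Matrix.toLpLin_apply, Matrix.mulVec_mulVec])

/-- `G` acts freely on the sphere. -/
def ActsFreely {n : ℕ} (G : Subgroup (Un n)) : Prop :=
  ∀ g ∈ G, ∀ x : Sph n, g • x = x → g = 1

/-- The orbit space `G \ S^{2n-1}`. -/
abbrev SphQuot {n : ℕ} (G : Subgroup (Un n)) : Type := Quotient (MulAction.orbitRel G (Sph n))

/-- The quotient map `S^{2n-1} → G \ S^{2n-1}`. -/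
def proj {n : ℕ} (G : Subgroup (Un n)) (x : Sph n) : SphQuot G := Quotient.mk _ x

/-- The surface measure of the unit sphere of `ℂⁿ ≅ ℝ²ⁿ`. -/
def sphMeasure (n : ℕ) : MeasureTheory.Measure (Sph n) :=
  (MeasureTheory.volume : MeasureTheory.Measure (Cn n)).toSphere

/-- The Riemannian volume measure of `G \ S^{2n-1}` for the metric that makes the quotient map a
local isometry. On every measurable sheet `U` (a set on which the quotient map is injective) the
volume of the sphere is carried over to the image of `U`; the supremum glues these measures. -/
def quotMeasure {n : ℕ} (G : Subgroup (Un n)) : MeasureTheory.Measure (SphQuot G) :=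
  ⨆ U ∈ {U : Set (Sph n) | MeasurableSet U ∧ Set.InjOn (proj G) U},
    ((sphMeasure n).restrict U).map (proj G)

/-- The extension of a function on the sphere to `ℂⁿ ∖ {0}` that is constant along rays
(with value `0` at the origin). -/
def radialExt {n : ℕ} (u : Sph n → ℂ) (z : Cn n) : ℂ :=
  if h : z = 0 then 0
  else u ⟨(‖z‖⁻¹ : ℝ) • z, by
    rw [mem_sphere_zero_iff_norm, norm_smul, norm_inv, norm_norm,
      inv_mul_cancel₀ (norm_ne_zero_iff.2 h)]⟩

/-- Smooth complex functions on the sphere. -/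
def SmoothSph {n : ℕ} (u : Sph n → ℂ) : Prop :=
  ContDiffOn ℝ ∞ (radialExt u) {0}ᶜ

/-- Smooth complex functions on `G \ S^{2n-1}`: those whose pullback to the sphere is smooth. -/
def SmoothQuot {n : ℕ} (G : Subgroup (Un n)) (f : SphQuot G → ℂ) : Prop :=
  SmoothSph (fun x => f (proj G x))

/-- The conjugate-linear part `(∂̄F)_z(v) = (dF_z(v) + i dF_z(iv)) / 2` of the real differential
of `F`; thus `(∂̄F)_z(e_j) = ∂F/∂z̄_j`. -/
def dbar {n : ℕ} (F : Cn n → ℂ) (z v : Cn n) : ℂ :=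
  (fderiv ℝ F z v + Complex.I * fderiv ℝ F z (Complex.I • v)) / 2

/-- The orthogonal projection of `e_j` to the complex tangent space `{v | ⟨x, v⟩ = 0}` of the
sphere at `x`. -/
def tangentFrame {n : ℕ} (x : Sph n) (j : Fin n) : Cn n :=
  EuclideanSpace.single j (1 : ℂ) - (conj (x.1 j) : ℂ) • x.1

/-- The tangential Cauchy-Riemann operator on functions. The component `j` of `∂̄_b u` at `x` is
the coefficient of `dz̄_j` in the tangential part of the `(0,1)`-form `∂̄u`. -/
def dbarb {n : ℕ} (u : Sph n → ℂ) (x : Sph n) (j : Fin n) : ℂ :=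
  dbar (radialExt u) x.1 (tangentFrame x j)

/-- The pointwise Hermitian product `⟨∂̄_b u, ∂̄_b w⟩_x` of `(0,1)`-forms on the sphere with the
metric induced from `ℂⁿ`, for which `⟨dz̄_j, dz̄_k⟩ = 2 δ_{jk}` on `ℂⁿ`. -/
def formInner {n : ℕ} (u w : Sph n → ℂ) (x : Sph n) : ℂ :=
  2 * ∑ j, dbarb u x j * conj (dbarb w x j)

/-- The product `∫ ⟨∂̄_b f, ∂̄_b h⟩` over `G \ S^{2n-1}`. The integrand at an orbit is evaluated at a
point of that orbit; since `G` acts by CR isometries, it does not matter which. -/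
def dbarbInner {n : ℕ} (G : Subgroup (Un n)) (f h : SphQuot G → ℂ) : ℂ :=
  ∫ p, formInner (fun x => f (proj G x)) (fun x => h (proj G x)) p.out ∂(quotMeasure G)

/-- For smooth functions `f` and `g` on `G \ S^{2n-1}`: `g = □_b f = ∂̄_b^* ∂̄_b f`, where `∂̄_b^*` is
the formal adjoint of `∂̄_b`. -/
def IsKohnLaplacian {n : ℕ} (G : Subgroup (Un n)) (f g : SphQuot G → ℂ) : Prop :=
  SmoothQuot G f ∧ SmoothQuot G g ∧
    ∀ h, SmoothQuot G h → dbarbInner G f h = ∫ p, g p * conj (h p) ∂(quotMeasure G)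

/-- `L²(G \ S^{2n-1})`. -/
abbrev L2Quot {n : ℕ} (G : Subgroup (Un n)) : Type := MeasureTheory.Lp ℂ 2 (quotMeasure G)

/-- The graph of the Kohn Laplacian `□_b` as an operator on `L²(G \ S^{2n-1})`: the closure of the
graph of `□_b` on smooth functions. (The latter is a linear subspace, so that taking the span adds
nothing to it.) -/
def kohnGraph {n : ℕ} (G : Subgroup (Un n)) : Submodule ℂ (L2Quot G × L2Quot G) :=
  (Submodule.span ℂ {w : L2Quot G × L2Quot G | ∃ f g : SphQuot G → ℂ, IsKohnLaplacian G f g ∧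
    w.1 =ᵐ[quotMeasure G] f ∧ w.2 =ᵐ[quotMeasure G] g}).topologicalClosure

/-- The eigenspace of `□_b` on `L²(G \ S^{2n-1})`: all `u` in the domain with `□_b u = μ u`. -/
def kohnEigenspace {n : ℕ} (G : Subgroup (Un n)) (μ : ℝ) : Submodule ℂ (L2Quot G) :=
  (kohnGraph G).comap (LinearMap.prod LinearMap.id ((μ : ℂ) • LinearMap.id))

/-- The multiplicity of `μ` as an eigenvalue of `□_b` (`0` if it is none, `⊤` if infinite). -/
def kohnMultiplicity {n : ℕ} (G : Subgroup (Un n)) (μ : ℝ) : ℕ∞ :=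
  Cardinal.toENat (Module.rank ℂ (kohnEigenspace G μ))

/-- The number `N(Λ)` of positive eigenvalues of `□_b` on `L²(G \ S^{2n-1})` that are at most `Λ`,
counted with multiplicity. -/
def kohnCount {n : ℕ} (G : Subgroup (Un n)) (Λ : ℝ) : ℝ≥0∞ :=
  ∑' μ : Set.Ioc 0 Λ, (kohnMultiplicity G μ : ℝ≥0∞)

/-- `Vol(S^{2n-1})`. -/
def sphVol (n : ℕ) : ℝ := (sphMeasure n).real Set.univ

/-- `Vol(G \ S^{2n-1})`. -/
def quotVol {n : ℕ} (G : Subgroup (Un n)) : ℝ := (quotMeasure G).real Set.univ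

end KohnWeyl

end

/-! On the sphere, a harmonic polynomial in z and z̄ of bidegree (p, q) is an eigenfunction of □_b
with eigenvalue 2q(p + n − 1) (`integral_formInner_ev`). The G-invariant ones descend to the
quotient and span a dense subspace of L² (`eq_zero_of_orthogonal_harmL2`), and the closed operator
is symmetric when tested against them (`inner_toL2_of_mem_kohnGraph`). So the eigenspace of ν > 0 is
exactly the orthogonal sum of the spaces with 2q(p + n − 1) = ν (`kohnEigenspace_eq`). For n ≥ 2,
N(Λ) is therefore the sum of dim `HarmBi G p q` over the region q ≥ 1, 2q(p + n − 1) ≤ Λ under a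
hyperbola.

The Laplacian maps invariants of bidegree (p + 1, q + 1) onto those of bidegree (p, q), so the
harmonic dimensions are differences of dimensions of `InvBi` (`finrank_HarmBi_add`). The latter are
averages over g ∈ G of h_p(d) h_q(d̄), where d lists the eigenvalues of g and h_p is the complete
homogeneous symmetric polynomial, with generating function ∏ 1/(1 − d_i t). For g = 1 the sum of h_p
over p < K grows like Kⁿ/n!. If g ≠ 1, freeness says that no d_i is 1, the generating function has
no pole at t = 1, and the sum is O(Kⁿ⁻¹). Hence only the identity contributes to the limits of row
and column sums, and these are 1/|G| times the limits for the trivial group.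

To pass to the sum under the hyperbola, cut the region along the diagonal into rows with q ≤ p and
columns with p < q. The bound dim ≤ (p + 1)ⁿ⁻² (q + 1)ⁿ⁻² (p + q + 2) dominates the slices divided
by Λⁿ by multiples of 1/q² and 1/(p + 1)², so dominated convergence for series applies
(`tendsto_hyperbolaSum`). The limit is `weylLimit` / |G|, and C is `weylLimit` divided by the volume
of the sphere. For n = 1 there are no positive eigenvalues, and for n = 0 the sphere is empty; then
C = 0 serves. -/

noncomputable section
namespace KohnWeyl

open Filter Topology Finset

/-! ### Asymptotics of sums under a hyperbola -/

theorem tendsto_sum_range_ite {f : ℕ → ℝ} {a : ℝ} {n : ℕ} (hn : n ≠ 0) (k₀ : ℕ)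
    (h : Tendsto (fun K : ℕ => (∑ k ∈ range K, f k) / (K : ℝ) ^ n) atTop (𝓝 a)) :
    Tendsto (fun K : ℕ => (∑ k ∈ range K, if k₀ ≤ k then f k else 0) / (K : ℝ) ^ n) atTop
      (𝓝 a) := by
  have hc : Tendsto (fun K : ℕ => (∑ k ∈ range k₀, f k) / (K : ℝ) ^ n) atTop (𝓝 0) :=
    Tendsto.div_atTop tendsto_const_nhds
      ((tendsto_pow_atTop hn).comp tendsto_natCast_atTop_atTop)
  have := h.sub hc
  rw [sub_zero] at this
  refine this.congr' ?_
  filter_upwards [eventually_ge_atTop k₀] with K hK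
  rw [← sub_div]
  congr 1
  rw [← Finset.sum_range_add_sum_Ico f hK, add_sub_cancel_left, ← Finset.sum_filter]
  refine Finset.sum_congr ?_ fun _ _ => rfl
  ext k
  simp only [Finset.mem_Ico, Finset.mem_filter, Finset.mem_range]
  omega

theorem tendsto_sum_range_comp {f : ℕ → ℝ} {a b : ℝ} {n : ℕ} (hb : 0 < b) {P : ℝ → ℕ}
    (hP : Tendsto (fun Λ : ℝ => (P Λ : ℝ) / Λ) atTop (𝓝 b))
    (h : Tendsto (fun K : ℕ => (∑ k ∈ range K, f k) / (K : ℝ) ^ n) atTop (𝓝 a)) :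
    Tendsto (fun Λ : ℝ => (∑ k ∈ range (P Λ), f k) / Λ ^ n) atTop (𝓝 (a * b ^ n)) := by
  have hPr : Tendsto (fun Λ : ℝ => (P Λ : ℝ)) atTop atTop := by
    refine (hP.pos_mul_atTop hb tendsto_id).congr' ?_
    filter_upwards [eventually_gt_atTop 0] with Λ hΛ
    simp [hΛ.ne']
  have hPn : Tendsto P atTop atTop := tendsto_natCast_atTop_iff.1 hPr
  refine ((h.comp hPn).mul (hP.pow n)).congr' ?_
  filter_upwards [eventually_gt_atTop 0, hPr.eventually_gt_atTop 0] with Λ hΛ hPΛ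
  simp only [Function.comp, div_pow]
  field_simp

theorem tendsto_natFloor_div_sub (c : ℝ) (hc : 0 < c) (s : ℕ) :
    Tendsto (fun Λ : ℝ => ((⌊Λ / c⌋₊ - s : ℕ) : ℝ) / Λ) atTop (𝓝 c⁻¹) := by
  have h1 : Tendsto (fun Λ : ℝ => (⌊c⁻¹ * Λ⌋₊ : ℝ) / Λ) atTop (𝓝 c⁻¹) :=
    tendsto_nat_floor_mul_div_atTop (inv_pos.2 hc).le
  have h2 : Tendsto (fun Λ : ℝ => (s : ℝ) / Λ) atTop (𝓝 0) :=
    Tendsto.div_atTop tendsto_const_nhds tendsto_id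
  have h3 := h1.sub h2
  rw [sub_zero] at h3
  refine h3.congr' ?_
  have h4 : Tendsto (fun Λ : ℝ => ⌊c⁻¹ * Λ⌋₊) atTop atTop :=
    tendsto_nat_floor_atTop.comp (tendsto_id.const_mul_atTop (inv_pos.2 hc))
  filter_upwards [h4.eventually_ge_atTop s] with Λ hΛ
  rw [div_eq_inv_mul Λ c, Nat.cast_sub hΛ, sub_div]

theorem tendsto_natFloor_div_add_one (c : ℝ) (hc : 0 < c) :
    Tendsto (fun Λ : ℝ => ((⌊Λ / c⌋₊ + 1 : ℕ) : ℝ) / Λ) atTop (𝓝 c⁻¹) := by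
  have h2 : Tendsto (fun Λ : ℝ => (1 : ℝ) / Λ) atTop (𝓝 0) :=
    Tendsto.div_atTop tendsto_const_nhds tendsto_id
  have h3 := (tendsto_natFloor_div_sub c hc 0).add h2
  rw [add_zero] at h3
  refine h3.congr fun Λ => ?_
  simp [add_div]

/-- The part `q ≤ p` of a slice of the sum under the hyperbola. -/
def lowerSlice (m : ℕ) (F : ℕ → ℕ → ℝ) (Λ : ℝ) (q : ℕ) : ℝ :=
  if q = 0 then 0 else ∑ p ∈ range (⌊Λ / (2 * q)⌋₊ - m), if q ≤ p then F p q else 0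

/-- The part `p < q` of a slice of the sum under the hyperbola. -/
def upperSlice (m : ℕ) (F : ℕ → ℕ → ℝ) (Λ : ℝ) (p : ℕ) : ℝ :=
  ∑ q ∈ range (⌊Λ / (2 * (p + m + 1))⌋₊ + 1), if p + 1 ≤ q then F p q else 0

theorem tendsto_lowerSlice {m : ℕ} {F : ℕ → ℕ → ℝ} {α : ℕ → ℝ} {q : ℕ}
    (h : Tendsto (fun K : ℕ => (∑ p ∈ range K, F p q) / (K : ℝ) ^ (m + 2)) atTop (𝓝 (α q))) :
    Tendsto (fun Λ : ℝ => lowerSlice m F Λ q / Λ ^ (m + 2)) atTop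
      (𝓝 (if q = 0 then 0 else α q * (2 * (q : ℝ))⁻¹ ^ (m + 2))) := by
  by_cases hq : q = 0
  · simp [lowerSlice, hq]
  · have hc : (0 : ℝ) < 2 * q := by positivity
    simp only [lowerSlice, hq, if_false]
    exact tendsto_sum_range_comp (inv_pos.2 hc) (tendsto_natFloor_div_sub _ hc m)
      (tendsto_sum_range_ite (by omega) q h)

theorem tendsto_upperSlice {m : ℕ} {F : ℕ → ℕ → ℝ} {β : ℕ → ℝ} {p : ℕ}
    (h : Tendsto (fun K : ℕ => (∑ q ∈ range K, F p q) / (K : ℝ) ^ (m + 2)) atTop (𝓝 (β p))) :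
    Tendsto (fun Λ : ℝ => upperSlice m F Λ p / Λ ^ (m + 2)) atTop
      (𝓝 (β p * (2 * ((p : ℝ) + m + 1))⁻¹ ^ (m + 2))) := by
  have hc : (0 : ℝ) < 2 * ((p : ℝ) + m + 1) := by positivity
  exact tendsto_sum_range_comp (inv_pos.2 hc) (tendsto_natFloor_div_add_one _ hc)
      (tendsto_sum_range_ite (by omega) _ h)

/-- The row q has about Λ/(2q) terms, each of size q^m (Λ/q)^(m+1), which gives Λ^(m+2)/q².
Restricting to q ≤ p is what makes the factor p + q + 2 comparable to p alone. -/
theorem norm_lowerSlice_div_le {m : ℕ} {F : ℕ → ℕ → ℝ} (h0 : ∀ p q, 0 ≤ F p q)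
    (hF : ∀ p q, F p q ≤ ((p : ℝ) + 1) ^ m * ((q : ℝ) + 1) ^ m * (p + q + 2))
    {Λ : ℝ} (hΛ : 0 < Λ) (q : ℕ) :
    ‖lowerSlice m F Λ q / Λ ^ (m + 2)‖ ≤ 2 * (1 / (q : ℝ) ^ 2) := by
  by_cases hq : q = 0
  · simp [lowerSlice, hq]
  have hq1 : (1 : ℝ) ≤ q := by exact_mod_cast Nat.one_le_iff_ne_zero.2 hq
  have hc : (0 : ℝ) < 2 * q := by positivity
  simp only [lowerSlice, hq, if_false]
  have hs0 : 0 ≤ ∑ p ∈ range (⌊Λ / (2 * q)⌋₊ - m), if q ≤ p then F p q else 0 :=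
    Finset.sum_nonneg fun p _ => by split_ifs <;> simp [h0]
  rw [Real.norm_of_nonneg (by positivity), div_le_iff₀ (by positivity)]
  set x : ℝ := Λ / (2 * q) with hx
  have hx0 : 0 < x := by positivity
  have hfl : (⌊x⌋₊ : ℝ) ≤ x := Nat.floor_le hx0.le
  -- Here p + 1 ≤ x, while q ≤ p gives p + q + 2 ≤ 2x and q ≥ 1 gives q + 1 ≤ 2q.
  have hterm : ∀ p ∈ range (⌊x⌋₊ - m), (if q ≤ p then F p q else 0) ≤
      2 * x ^ (m + 1) * (2 * (q : ℝ)) ^ m := by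
    intro p hp
    have hp' : ((p + 1 : ℕ) : ℝ) ≤ x :=
      le_trans (by exact_mod_cast (by have := Finset.mem_range.1 hp; omega)) hfl
    push_cast at hp'
    split_ifs with hqp
    · have hqp' : (q : ℝ) ≤ p := by exact_mod_cast hqp
      calc F p q ≤ ((p : ℝ) + 1) ^ m * ((q : ℝ) + 1) ^ m * (p + q + 2) := hF p q
        _ ≤ x ^ m * (2 * q) ^ m * (2 * x) := by
            gcongr
            · linarith
            · linarith
        _ = _ := by ring
    · positivity
  calc _ ≤ ∑ _p ∈ range (⌊x⌋₊ - m), 2 * x ^ (m + 1) * (2 * (q : ℝ)) ^ m :=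
        Finset.sum_le_sum hterm
    _ = ((⌊x⌋₊ - m : ℕ) : ℝ) * (2 * x ^ (m + 1) * (2 * (q : ℝ)) ^ m) := by simp
    _ ≤ x * (2 * x ^ (m + 1) * (2 * (q : ℝ)) ^ m) := by
        gcongr
        exact le_trans (by exact_mod_cast Nat.sub_le _ _) hfl
    _ = 2 * Λ ^ (m + 2) / (2 * q) ^ 2 := by
        rw [hx, div_pow]; field_simp; ring
    _ ≤ _ := by
        rw [div_le_iff₀ (by positivity)]
        have : 2 * (1 / (q : ℝ) ^ 2) * Λ ^ (m + 2) * (2 * q) ^ 2 = 4 * (2 * Λ ^ (m + 2)) := by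
          field_simp; ring
        rw [this]
        nlinarith [pow_pos hΛ (m + 2)]

theorem norm_upperSlice_div_le {m : ℕ} {F : ℕ → ℕ → ℝ} (h0 : ∀ p q, 0 ≤ F p q)
    (hF : ∀ p q, F p q ≤ ((p : ℝ) + 1) ^ m * ((q : ℝ) + 1) ^ m * (p + q + 2))
    {Λ : ℝ} (hΛ : 0 < Λ) (p : ℕ) :
    ‖upperSlice m F Λ p / Λ ^ (m + 2)‖ ≤ 2 ^ (m + 3) * (1 / ((p : ℝ) + 1) ^ 2) := by
  have hs0 : 0 ≤ upperSlice m F Λ p :=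
    Finset.sum_nonneg fun p _ => by split_ifs <;> simp [h0]
  rw [Real.norm_of_nonneg (by positivity), div_le_iff₀ (by positivity)]
  set x : ℝ := Λ / (2 * (p + m + 1)) with hx
  have hx0 : 0 < x := by positivity
  have hfl : (⌊x⌋₊ : ℝ) ≤ x := Nat.floor_le hx0.le
  -- Weakening p + 1 ≤ q to 1 ≤ q leaves exactly ⌊x⌋ nonzero terms. The count is then at most x; a
  -- bound by x + 1 would be useless for x < 1.
  have hterm : ∀ q ∈ range (⌊x⌋₊ + 1), (if p + 1 ≤ q then F p q else 0) ≤
      if 1 ≤ q then 2 * (2 * x) ^ (m + 1) * ((p : ℝ) + 1) ^ m else 0 := by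
    intro q hq
    have hq' : (q : ℝ) ≤ x :=
      le_trans (by exact_mod_cast (by have := Finset.mem_range.1 hq; omega)) hfl
    split_ifs with hqp h1 h1
    · have hqp' : (p : ℝ) + 1 ≤ q := by exact_mod_cast hqp
      have hp0 : (0 : ℝ) ≤ p := by positivity
      calc F p q ≤ ((p : ℝ) + 1) ^ m * ((q : ℝ) + 1) ^ m * (p + q + 2) := hF p q
        _ ≤ ((p : ℝ) + 1) ^ m * (2 * x) ^ m * (2 * (2 * x)) := by
            gcongr
            · linarith
            · linarith
        _ = _ := by ring
    · omega
    · positivity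
    · rfl
  calc upperSlice m F Λ p ≤ ∑ q ∈ range (⌊x⌋₊ + 1),
        if 1 ≤ q then 2 * (2 * x) ^ (m + 1) * ((p : ℝ) + 1) ^ m else 0 :=
        Finset.sum_le_sum hterm
    _ = (⌊x⌋₊ : ℝ) * (2 * (2 * x) ^ (m + 1) * ((p : ℝ) + 1) ^ m) := by
        rw [Finset.sum_range_succ']; simp
    _ ≤ x * (2 * (2 * x) ^ (m + 1) * ((p : ℝ) + 1) ^ m) := by gcongr
    _ = (2 * x) ^ (m + 2) * ((p : ℝ) + 1) ^ m := by ring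
    _ ≤ (2 * (Λ / (p + 1))) ^ (m + 2) * ((p : ℝ) + 1) ^ m := by
        gcongr
        rw [hx]
        gcongr
        have hm0 : (0 : ℝ) ≤ m := by positivity
        have hp0 : (0 : ℝ) ≤ p := by positivity
        linarith
    _ = 2 ^ (m + 2) * (1 / ((p : ℝ) + 1) ^ 2) * Λ ^ (m + 2) := by
        rw [mul_pow, div_pow]; field_simp; ring
    _ ≤ _ := by
        gcongr
        · norm_num
        · omega

/-- The sum of `F` over the pairs with `q ≥ 1` and `2 q (p + m + 1) ≤ Λ`. -/
def hyperbolaSum (m : ℕ) (F : ℕ → ℕ → ℝ) (Λ : ℝ) : ℝ :=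
  ∑' x : ℕ × ℕ, if 1 ≤ x.2 ∧ 2 * (x.2 : ℝ) * (x.1 + m + 1) ≤ Λ then F x.1 x.2 else 0

theorem hyperbolaSum_eq (m : ℕ) (F : ℕ → ℕ → ℝ) (Λ : ℝ) :
    hyperbolaSum m F Λ = ∑' q, lowerSlice m F Λ q + ∑' p, upperSlice m F Λ p := by
  set D : ℕ × ℕ → Prop := fun x => 1 ≤ x.2 ∧ 2 * (x.2 : ℝ) * (x.1 + m + 1) ≤ Λ
  -- The region lies in a finite box, so every series below is a finite sum and the order of
  -- summation is free.
  have hD : ∀ x, D x → x ∈ range (⌊Λ⌋₊ + 1) ×ˢ range (⌊Λ⌋₊ + 1) := by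
    rintro ⟨p, q⟩ ⟨h1, h2⟩
    simp only at h1 h2
    have h1' : (1 : ℝ) ≤ q := by exact_mod_cast h1
    have hm0 : (0 : ℝ) ≤ m := by positivity
    have hp0 : (0 : ℝ) ≤ p := by positivity
    simp only [Finset.mem_product, Finset.mem_range, Nat.lt_succ_iff]
    constructor <;> apply Nat.le_floor <;> nlinarith
  set g₁ : ℕ × ℕ → ℝ := fun x => if D x ∧ x.2 ≤ x.1 then F x.1 x.2 else 0
  set g₂ : ℕ × ℕ → ℝ := fun x => if D x ∧ x.1 + 1 ≤ x.2 then F x.1 x.2 else 0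
  have hs₁ : Summable g₁ := summable_of_ne_finset_zero
    (s := range (⌊Λ⌋₊ + 1) ×ˢ range (⌊Λ⌋₊ + 1)) fun x hx => if_neg fun h => hx (hD x h.1)
  have hs₂ : Summable g₂ := summable_of_ne_finset_zero
    (s := range (⌊Λ⌋₊ + 1) ×ˢ range (⌊Λ⌋₊ + 1)) fun x hx => if_neg fun h => hx (hD x h.1)
  have hsum : hyperbolaSum m F Λ = ∑' x, (g₁ x + g₂ x) := by
    refine tsum_congr fun x => ?_
    by_cases h : D x
    · by_cases h' : x.2 ≤ x.1
      · simp [g₁, g₂, h, h', show (1 ≤ x.2 ∧ 2 * (x.2 : ℝ) * (x.1 + m + 1) ≤ Λ) from h]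
      · simp [g₁, g₂, h, h', show (1 ≤ x.2 ∧ 2 * (x.2 : ℝ) * (x.1 + m + 1) ≤ Λ) from h]
    · rw [if_neg h]; simp [g₁, g₂, h]
  rw [hsum, hs₁.tsum_add hs₂]
  congr 1
  · have hc : ∑' p, ∑' q, g₁ (p, q) = ∑' q, ∑' p, g₁ (p, q) :=
      (Summable.tsum_comm (f := fun p q => g₁ (p, q)) hs₁).symm
    rw [hs₁.tsum_prod, hc]
    refine tsum_congr fun q => ?_
    by_cases hq : q = 0
    · simp [lowerSlice, g₁, D, hq]
    have hc : (0 : ℝ) < 2 * q := by positivity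
    -- The truncated subtraction is harmless: p < ⌊·⌋ − m means p + m + 1 ≤ ⌊·⌋, also when ⌊·⌋ < m.
    have key : ∀ p : ℕ, D (p, q) ↔ p ∈ range (⌊Λ / (2 * q)⌋₊ - m) := by
      intro p
      have : p ∈ range (⌊Λ / (2 * q)⌋₊ - m) ↔ p + m + 1 ≤ ⌊Λ / (2 * q)⌋₊ := by
        rw [Finset.mem_range]; omega
      rw [this, Nat.le_floor_iff' (by omega), le_div_iff₀ hc]
      simp only [D, Nat.one_le_iff_ne_zero, ne_eq, hq, not_false_eq_true, true_and]
      push_cast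
      rw [mul_comm]
    rw [tsum_eq_sum (s := range (⌊Λ / (2 * q)⌋₊ - m))]
    · simp only [lowerSlice, hq, if_false]
      refine Finset.sum_congr rfl fun p hp => ?_
      simp [g₁, (key p).2 hp]
    · intro p hp
      simp [g₁, mt (key p).1 hp]
  · rw [Summable.tsum_prod hs₂]
    refine tsum_congr fun p => ?_
    have hc : (0 : ℝ) < 2 * (p + m + 1) := by positivity
    have key : ∀ q : ℕ, D (p, q) ↔ 1 ≤ q ∧ q ∈ range (⌊Λ / (2 * (p + m + 1))⌋₊ + 1) := by
      intro q
      refine and_congr_right fun hq => ?_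
      rw [Finset.mem_range, Nat.lt_succ_iff, Nat.le_floor_iff' (by omega), le_div_iff₀ hc]
      simp only
      rw [show 2 * (q : ℝ) * (p + m + 1) = q * (2 * (p + m + 1)) by ring]
    rw [tsum_eq_sum (s := range (⌊Λ / (2 * (p + m + 1))⌋₊ + 1))]
    · refine Finset.sum_congr rfl fun q hq => ?_
      by_cases h : p + 1 ≤ q
      · rw [if_pos h]
        exact if_pos ⟨(key q).2 ⟨by omega, hq⟩, h⟩
      · rw [if_neg h]
        exact if_neg fun h' => h h'.2
    · intro q hq
      simp [g₂, mt (fun h => ((key q).1 h).2) hq]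

/-- Asymptotics of the sum of `F` under a hyperbola, from the asymptotics of its slices. -/
theorem tendsto_hyperbolaSum {m : ℕ} {F : ℕ → ℕ → ℝ} (h0 : ∀ p q, 0 ≤ F p q)
    (hF : ∀ p q, F p q ≤ ((p : ℝ) + 1) ^ m * ((q : ℝ) + 1) ^ m * (p + q + 2))
    {α β : ℕ → ℝ}
    (hα : ∀ q, Tendsto (fun K : ℕ => (∑ p ∈ range K, F p q) / (K : ℝ) ^ (m + 2)) atTop (𝓝 (α q)))
    (hβ : ∀ p, Tendsto (fun K : ℕ => (∑ q ∈ range K, F p q) / (K : ℝ) ^ (m + 2)) atTop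
      (𝓝 (β p))) :
    Tendsto (fun Λ : ℝ => hyperbolaSum m F Λ / Λ ^ (m + 2)) atTop
      (𝓝 (∑' q : ℕ, (if q = 0 then 0 else α q * (2 * (q : ℝ))⁻¹ ^ (m + 2)) +
        ∑' p : ℕ, β p * (2 * ((p : ℝ) + m + 1))⁻¹ ^ (m + 2))) := by
  have hs : Summable fun q : ℕ => (1 : ℝ) / (q : ℝ) ^ 2 :=
    Real.summable_one_div_nat_pow.2 (by norm_num)
  have hs' : Summable fun p : ℕ => (1 : ℝ) / ((p : ℝ) + 1) ^ 2 := by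
    simpa using (summable_nat_add_iff 1).2 hs
  have h1 := tendsto_tsum_of_dominated_convergence (hs.mul_left 2)
    (fun q => tendsto_lowerSlice (m := m) (hα q))
    ((eventually_gt_atTop 0).mono fun Λ hΛ q => norm_lowerSlice_div_le h0 hF hΛ q)
  have h2 := tendsto_tsum_of_dominated_convergence (hs'.mul_left (2 ^ (m + 3)))
    (fun p => tendsto_upperSlice (m := m) (hβ p))
    ((eventually_gt_atTop 0).mono fun Λ hΛ p => norm_upperSlice_div_le h0 hF hΛ p)
  refine (h1.add h2).congr fun Λ => ?_
  rw [hyperbolaSum_eq, tsum_div_const, tsum_div_const, add_div]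

end KohnWeyl
end

/-! ### Bihomogeneous polynomials, the Laplacian and the unitary action -/

noncomputable section
namespace KohnWeyl

open MvPolynomial

/-- Polynomials in `z₁, …, zₙ` (the variables `inl j`) and `z̄₁, …, z̄ₙ` (the variables `inr j`). -/
abbrev Pol (n : ℕ) : Type := MvPolynomial (Fin n ⊕ Fin n) ℂ

/-- The bidegree of the variables. -/
def biWeight (n : ℕ) : Fin n ⊕ Fin n → ℕ × ℕ := Sum.elim (fun _ => (1, 0)) (fun _ => (0, 1))

/-- The polynomials that are homogeneous of degree `p` in `z` and of degree `q` in `z̄`. -/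
def Bi (n p q : ℕ) : Submodule ℂ (Pol n) := weightedHomogeneousSubmodule ℂ (biWeight n) (p, q)

variable {n : ℕ}

/-- The Laplacian `∑ ∂²/∂z_j∂z̄_j`. -/
def lap (n : ℕ) : Pol n →ₗ[ℂ] Pol n :=
  ∑ j, (pderiv (Sum.inl j)).toLinearMap ∘ₗ (pderiv (Sum.inr j)).toLinearMap

theorem lap_apply (f : Pol n) : lap n f = ∑ j, pderiv (Sum.inl j) (pderiv (Sum.inr j) f) := by
  simp [lap]

/-- The polynomial `|z|²`. -/
def rad (n : ℕ) : Pol n := ∑ j, X (Sum.inl j) * X (Sum.inr j)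

theorem monomial_mem_Bi (d : Fin n ⊕ Fin n →₀ ℕ) (c : ℂ) :
    monomial d c ∈ Bi n (Finsupp.weight (biWeight n) d).1 (Finsupp.weight (biWeight n) d).2 :=
  isWeightedHomogeneous_monomial _ _ _ rfl

/-- Projecting the weight in ℕ × ℕ to either factor gives the degree in z alone or in z̄ alone, to
which the weighted Euler identity applies. -/
theorem isWeightedHomogeneous_comp {σ R M N : Type*} [CommSemiring R] [AddCommMonoid M]
    [AddCommMonoid N] (w : σ → M) (φ : M →+ N) {f : MvPolynomial σ R} {m : M}
    (h : IsWeightedHomogeneous w f m) : IsWeightedHomogeneous (φ ∘ w) f (φ m) := by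
  intro d hd
  rw [← h hd, Finsupp.weight_apply, Finsupp.weight_apply, Finsupp.sum, Finsupp.sum, map_sum]
  simp

theorem euler_left {p q : ℕ} {f : Pol n} (h : f ∈ Bi n p q) :
    ∑ j, X (Sum.inl j) * pderiv (Sum.inl j) f = (p : ℂ) • f := by
  have := (isWeightedHomogeneous_comp _ (AddMonoidHom.fst ℕ ℕ) h).sum_weight_X_mul_pderiv
  simpa [biWeight, Nat.cast_smul_eq_nsmul] using this

theorem euler_right {p q : ℕ} {f : Pol n} (h : f ∈ Bi n p q) :
    ∑ j, X (Sum.inr j) * pderiv (Sum.inr j) f = (q : ℂ) • f := by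
  have := (isWeightedHomogeneous_comp _ (AddMonoidHom.snd ℕ ℕ) h).sum_weight_X_mul_pderiv
  simpa [biWeight, Nat.cast_smul_eq_nsmul] using this

theorem pderiv_inl_mem {p q : ℕ} {f : Pol n} (h : f ∈ Bi n (p + 1) q) (j : Fin n) :
    pderiv (Sum.inl j) f ∈ Bi n p q :=
  IsWeightedHomogeneous.pderiv h (by simp [biWeight])

theorem pderiv_inr_mem {p q : ℕ} {f : Pol n} (h : f ∈ Bi n p (q + 1)) (j : Fin n) :
    pderiv (Sum.inr j) f ∈ Bi n p q :=
  IsWeightedHomogeneous.pderiv h (by simp [biWeight])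

theorem pderiv_eq_zero_of_degrees {σ R : Type*} [CommSemiring R] {f : MvPolynomial σ R} {i : σ}
    (h : ∀ d ∈ f.support, d i = 0) : pderiv i f = 0 := by
  rw [f.as_sum, map_sum]
  refine Finset.sum_eq_zero fun d hd => ?_
  rw [pderiv_monomial, h d hd]
  simp

theorem weight_biWeight (d : Fin n ⊕ Fin n →₀ ℕ) :
    Finsupp.weight (biWeight n) d = (∑ j, d (Sum.inl j), ∑ j, d (Sum.inr j)) := by
  rw [Finsupp.weight_apply, Finsupp.sum_fintype _ _ (by simp)]
  simp [biWeight, Prod.ext_iff, Prod.fst_sum, Prod.snd_sum]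

theorem pderiv_inl_eq_zero {q : ℕ} {f : Pol n} (h : f ∈ Bi n 0 q) (j : Fin n) :
    pderiv (Sum.inl j) f = 0 := by
  refine pderiv_eq_zero_of_degrees fun d hd => ?_
  have := h (mem_support_iff.1 hd)
  rw [weight_biWeight, Prod.ext_iff] at this
  exact (Finset.sum_eq_zero_iff.1 (show ∑ j, d (Sum.inl j) = 0 from this.1)) j
    (Finset.mem_univ j)

theorem pderiv_inr_eq_zero {p : ℕ} {f : Pol n} (h : f ∈ Bi n p 0) (j : Fin n) :
    pderiv (Sum.inr j) f = 0 := by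
  refine pderiv_eq_zero_of_degrees fun d hd => ?_
  have := h (mem_support_iff.1 hd)
  rw [weight_biWeight, Prod.ext_iff] at this
  exact (Finset.sum_eq_zero_iff.1 (show ∑ j, d (Sum.inr j) = 0 from this.2)) j
    (Finset.mem_univ j)

theorem lap_mem {p q : ℕ} {f : Pol n} (h : f ∈ Bi n (p + 1) (q + 1)) : lap n f ∈ Bi n p q := by
  rw [lap_apply]
  exact Submodule.sum_mem _ fun j _ => pderiv_inl_mem (pderiv_inr_mem h j) j

theorem lap_eq_zero_left {q : ℕ} {f : Pol n} (h : f ∈ Bi n 0 q) : lap n f = 0 := by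
  rw [lap_apply]
  refine Finset.sum_eq_zero fun j _ => ?_
  cases q with
  | zero => rw [pderiv_inr_eq_zero h, map_zero]
  | succ q => exact pderiv_inl_eq_zero (pderiv_inr_mem h j) j

theorem lap_eq_zero_right {p : ℕ} {f : Pol n} (h : f ∈ Bi n p 0) : lap n f = 0 := by
  rw [lap_apply]
  exact Finset.sum_eq_zero fun j _ => by rw [pderiv_inr_eq_zero h, map_zero]

theorem rad_mem : rad n ∈ Bi n 1 1 :=
  Submodule.sum_mem _ fun j _ => by
    have := (isWeightedHomogeneous_X ℂ (biWeight n) (Sum.inl j)).mul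
      (isWeightedHomogeneous_X ℂ (biWeight n) (Sum.inr j))
    exact this

theorem rad_mul_mem {p q : ℕ} {f : Pol n} (h : f ∈ Bi n p q) :
    rad n * f ∈ Bi n (p + 1) (q + 1) := by
  have := IsWeightedHomogeneous.mul rad_mem h
  rwa [Prod.mk_add_mk, add_comm 1, add_comm 1] at this

theorem pderiv_inl_rad (j : Fin n) : pderiv (Sum.inl j) (rad n) = X (Sum.inr j) := by
  classical
  simp [rad, Pi.single_apply, pderiv_X]

theorem pderiv_inr_rad (j : Fin n) : pderiv (Sum.inr j) (rad n) = X (Sum.inl j) := by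
  classical
  simp [rad, Pi.single_apply, pderiv_X]

/-- The commutator of the Laplacian with multiplication by |z|²: the product rule leaves two Euler
operators, contributing p and q, and the constant n. -/
theorem lap_rad_mul {p q : ℕ} {f : Pol n} (h : f ∈ Bi n p q) :
    lap n (rad n * f) = rad n * lap n f + ((n + p + q : ℕ) : ℂ) • f := by
  have h1 := euler_left h
  have h2 := euler_right h
  have h3 : ∀ j : Fin n, pderiv (Sum.inl j) (pderiv (Sum.inr j) (rad n * f)) =
      rad n * pderiv (Sum.inl j) (pderiv (Sum.inr j) f) + X (Sum.inr j) * pderiv (Sum.inr j) f +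
        X (Sum.inl j) * pderiv (Sum.inl j) f + f := by
    intro j
    simp only [pderiv_mul, map_add, pderiv_inl_rad, pderiv_inr_rad, pderiv_X_self]
    ring
  rw [lap_apply, lap_apply, Finset.sum_congr rfl fun j _ => h3 j, Finset.sum_add_distrib,
    Finset.sum_add_distrib, Finset.sum_add_distrib, h1, h2, ← Finset.mul_sum]
  simp only [Finset.sum_const, Finset.card_univ, Fintype.card_fin, ← Nat.cast_smul_eq_nsmul ℂ]
  push_cast
  module

/-- An algebraic substitute for the nonnegativity of |z|²Δ. By the commutation relation, if f is an
eigenvector with eigenvalue ν < 0, then Δf satisfies the eigenvector equation in lower bidegree with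
the still more negative value ν − (n + p + q). The descent ends where Δ vanishes. -/
theorem eq_zero_of_rad_mul_lap {p q : ℕ} {f : Pol n} (h : f ∈ Bi n p q) {ν : ℝ} (hν : ν < 0)
    (hf : rad n * lap n f = (ν : ℂ) • f) : f = 0 := by
  have hν_ne : (ν : ℂ) ≠ 0 := by exact_mod_cast hν.ne
  induction p generalizing q f ν with
  | zero =>
    rw [lap_eq_zero_left h, mul_zero] at hf
    exact (smul_eq_zero.1 hf.symm).resolve_left hν_ne
  | succ p ih =>
    cases q with
    | zero =>
      rw [lap_eq_zero_right h, mul_zero] at hf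
      exact (smul_eq_zero.1 hf.symm).resolve_left hν_ne
    | succ q =>
      have hg := lap_mem h
      have h1 := lap_rad_mul hg
      rw [hf, map_smul] at h1
      have hneg : ν - (n + p + q : ℕ) < 0 := by
        have : (0 : ℝ) ≤ (n + p + q : ℕ) := Nat.cast_nonneg _
        linarith
      have h2 : lap n f = 0 := by
        refine ih hg hneg ?_ (by exact_mod_cast hneg.ne)
        push_cast at h1 ⊢
        rw [sub_smul, h1]
        module
      rw [h2, mul_zero] at hf
      exact (smul_eq_zero.1 hf.symm).resolve_left hν_ne

/-- The linear substitution `z ↦ A z`, `z̄ ↦ B z̄`. -/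
def linSubst (A B : Matrix (Fin n) (Fin n) ℂ) : Pol n →ₐ[ℂ] Pol n :=
  aeval (Sum.elim (fun j => ∑ k, A j k • X (Sum.inl k)) (fun j => ∑ k, B j k • X (Sum.inr k)))

theorem linSubst_X_inl (A B : Matrix (Fin n) (Fin n) ℂ) (j : Fin n) :
    linSubst A B (X (Sum.inl j)) = ∑ k, A j k • X (Sum.inl k) := by simp [linSubst]

theorem linSubst_X_inr (A B : Matrix (Fin n) (Fin n) ℂ) (j : Fin n) :
    linSubst A B (X (Sum.inr j)) = ∑ k, B j k • X (Sum.inr k) := by simp [linSubst]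

theorem linSubst_comp (A B A' B' : Matrix (Fin n) (Fin n) ℂ) :
    (linSubst A B).comp (linSubst A' B') = linSubst (A' * A) (B' * B) := by
  refine MvPolynomial.algHom_ext fun i => ?_
  cases i with
  | inl j =>
    simp only [AlgHom.comp_apply, linSubst_X_inl, map_sum, map_smul, Matrix.mul_apply,
      Finset.smul_sum, Finset.sum_smul, smul_smul]
    exact Finset.sum_comm
  | inr j =>
    simp only [AlgHom.comp_apply, linSubst_X_inr, map_sum, map_smul, Matrix.mul_apply,
      Finset.smul_sum, Finset.sum_smul, smul_smul]
    exact Finset.sum_comm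

theorem linSubst_one : linSubst (1 : Matrix (Fin n) (Fin n) ℂ) 1 = AlgHom.id ℂ (Pol n) := by
  refine MvPolynomial.algHom_ext fun i => ?_
  cases i with
  | inl j => simp [linSubst_X_inl, Matrix.one_apply]
  | inr j => simp [linSubst_X_inr, Matrix.one_apply]

theorem linSubst_mem (A B : Matrix (Fin n) (Fin n) ℂ) {p q : ℕ} {f : Pol n} (h : f ∈ Bi n p q) :
    linSubst A B f ∈ Bi n p q := by
  rw [f.as_sum, map_sum]
  refine Submodule.sum_mem _ fun d hd => ?_
  rw [linSubst, aeval_monomial]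
  refine IsWeightedHomogeneous.C_mul ?_ _
  have hw := h (mem_support_iff.1 hd)
  rw [← hw, Finsupp.weight_apply]
  refine IsWeightedHomogeneous.prod _ _ _ fun i _ => IsWeightedHomogeneous.pow ?_ _
  cases i with
  | inl j =>
    refine Submodule.sum_mem (weightedHomogeneousSubmodule ℂ (biWeight n) _) fun k _ =>
      Submodule.smul_mem _ _ ?_
    exact isWeightedHomogeneous_X ℂ (biWeight n) (Sum.inl k)
  | inr j =>
    refine Submodule.sum_mem (weightedHomogeneousSubmodule ℂ (biWeight n) _) fun k _ =>
      Submodule.smul_mem _ _ ?_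
    exact isWeightedHomogeneous_X ℂ (biWeight n) (Sum.inr k)

/-- The chain rule for substitutions. -/
theorem pderiv_aeval {σ τ R : Type*} [Fintype σ] [CommRing R]
    (f : σ → MvPolynomial τ R) (i : τ) (Q : MvPolynomial σ R) :
    pderiv i (aeval f Q) = ∑ j, aeval f (pderiv j Q) * pderiv i (f j) := by
  classical
  induction Q using MvPolynomial.induction_on with
  | C a => simp
  | add a b ha hb => simp only [map_add, ha, hb, add_mul, Finset.sum_add_distrib]
  | mul_X a k ha =>
    simp only [map_mul, pderiv_mul, ha, aeval_X, map_add, pderiv_X, add_mul,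
      Finset.sum_add_distrib, Finset.sum_mul]
    congr 1
    · exact Finset.sum_congr rfl fun j _ => by ring
    · rw [Finset.sum_eq_single k]
      · simp
      · intro j _ hj
        simp [hj.symm]
      · simp

theorem pderiv_inl_linSubst (A B : Matrix (Fin n) (Fin n) ℂ) (k : Fin n) (f : Pol n) :
    pderiv (Sum.inl k) (linSubst A B f) = ∑ j, A j k • linSubst A B (pderiv (Sum.inl j) f) := by
  classical
  rw [linSubst, pderiv_aeval, Fintype.sum_sum_type]
  simp [pderiv_X, Pi.single_apply, mul_comm, smul_eq_C_mul]

theorem pderiv_inr_linSubst (A B : Matrix (Fin n) (Fin n) ℂ) (k : Fin n) (f : Pol n) :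
    pderiv (Sum.inr k) (linSubst A B f) = ∑ j, B j k • linSubst A B (pderiv (Sum.inr j) f) := by
  classical
  rw [linSubst, pderiv_aeval, Fintype.sum_sum_type]
  simp [pderiv_X, Pi.single_apply, mul_comm, smul_eq_C_mul]

/-- As z and z̄ are independent variables, invariance of ∑ ∂²/∂z_j∂z̄_j only needs A and B to be
dual to each other; for B = Ā this is unitarity. -/
theorem lap_linSubst {A B : Matrix (Fin n) (Fin n) ℂ} (h : A * B.transpose = 1) (f : Pol n) :
    lap n (linSubst A B f) = linSubst A B (lap n f) := by
  have h1 : ∀ i j, ∑ k, A i k * B j k = if i = j then 1 else 0 := fun i j => by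
    have := congrFun (congrFun h i) j
    simpa [Matrix.mul_apply, Matrix.one_apply] using this
  simp only [lap_apply, pderiv_inr_linSubst, map_sum, Derivation.map_smul, pderiv_inl_linSubst,
    Finset.smul_sum, smul_smul]
  rw [Finset.sum_comm]
  have h2 : ∀ j : Fin n, ∑ k, ∑ i, (B j k * A i k) •
      linSubst A B (pderiv (Sum.inl i) (pderiv (Sum.inr j) f)) =
      linSubst A B (pderiv (Sum.inl j) (pderiv (Sum.inr j) f)) := by
    intro j
    rw [Finset.sum_comm]
    simp only [← Finset.sum_smul, mul_comm (B _ _), h1]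
    simp
  exact Finset.sum_congr rfl fun j _ => h2 j

theorem linSubst_rad {A B : Matrix (Fin n) (Fin n) ℂ} (h : A.transpose * B = 1) :
    linSubst A B (rad n) = rad n := by
  have h1 : ∀ i j, ∑ k, A k i * B k j = if i = j then 1 else 0 := fun i j => by
    have := congrFun (congrFun h i) j
    simpa [Matrix.mul_apply, Matrix.one_apply] using this
  simp only [rad, map_sum, map_mul, linSubst_X_inl, linSubst_X_inr, Finset.sum_mul_sum,
    smul_mul_smul_comm]
  rw [Finset.sum_comm]
  refine Finset.sum_congr rfl fun i _ => ?_
  rw [Finset.sum_comm]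
  simp only [← Finset.sum_smul, h1]
  simp

/-- The action of a unitary matrix on polynomials: `(act g f)(z) = f(g z)`. -/
def act (g : Un n) : Pol n →ₐ[ℂ] Pol n :=
  linSubst (g : Matrix (Fin n) (Fin n) ℂ) ((g : Matrix (Fin n) (Fin n) ℂ).map conj)

theorem act_one : act (1 : Un n) = AlgHom.id ℂ (Pol n) := by
  rw [act, ← linSubst_one]
  congr 1
  ext i j
  simp [Matrix.one_apply, apply_ite]

theorem act_comp (g h : Un n) : (act g).comp (act h) = act (h * g) := by
  rw [act, act, linSubst_comp, act]
  congr 1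
  simp [Matrix.map_mul]

theorem lap_act (g : Un n) (f : Pol n) : lap n (act g f) = act g (lap n f) := by
  refine lap_linSubst ?_ f
  have := Matrix.mem_unitaryGroup_iff.1 g.2
  rwa [Matrix.star_eq_conjTranspose] at this

theorem act_rad (g : Un n) : act g (rad n) = rad n := by
  refine linSubst_rad ?_
  have := Matrix.mem_unitaryGroup_iff'.1 g.2
  rw [Matrix.star_eq_conjTranspose] at this
  have h2 := congrArg (fun M => M.map (starRingEnd ℂ)) this
  simp only [Matrix.map_mul] at h2
  convert h2 using 1
  · congr 1
    ext i j
    simp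
  · ext i j
    simp [Matrix.one_apply, apply_ite]

/-- The `G`-invariant polynomials of bidegree `(p, q)`. -/
def InvBi (G : Subgroup (Un n)) (p q : ℕ) : Submodule ℂ (Pol n) :=
  Bi n p q ⊓ ⨅ g : G, LinearMap.eqLocus (act g.1).toLinearMap LinearMap.id

/-- The `G`-invariant harmonic polynomials of bidegree `(p, q)`. -/
def HarmBi (G : Subgroup (Un n)) (p q : ℕ) : Submodule ℂ (Pol n) :=
  InvBi G p q ⊓ LinearMap.ker (lap n)

variable {G : Subgroup (Un n)}

theorem mem_InvBi {p q : ℕ} {f : Pol n} :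
    f ∈ InvBi G p q ↔ f ∈ Bi n p q ∧ ∀ g ∈ G, act g f = f := by
  simp [InvBi, Submodule.mem_iInf]

theorem mem_HarmBi {p q : ℕ} {f : Pol n} : f ∈ HarmBi G p q ↔ f ∈ InvBi G p q ∧ lap n f = 0 := by
  simp [HarmBi]

theorem lap_mem_InvBi {p q : ℕ} {f : Pol n} (h : f ∈ InvBi G (p + 1) (q + 1)) :
    lap n f ∈ InvBi G p q := by
  rw [mem_InvBi] at h ⊢
  exact ⟨lap_mem h.1, fun g hg => by rw [← lap_act, h.2 g hg]⟩

theorem rad_mul_mem_InvBi {p q : ℕ} {f : Pol n} (h : f ∈ InvBi G p q) :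
    rad n * f ∈ InvBi G (p + 1) (q + 1) := by
  rw [mem_InvBi] at h ⊢
  exact ⟨rad_mul_mem h.1, fun g hg => by rw [map_mul, act_rad, h.2 g hg]⟩

theorem HarmBi_zero_left (q : ℕ) : HarmBi G 0 q = InvBi G 0 q :=
  inf_eq_left.2 fun _ h => lap_eq_zero_left (mem_InvBi.1 h).1

theorem HarmBi_zero_right (p : ℕ) : HarmBi G p 0 = InvBi G p 0 :=
  inf_eq_left.2 fun _ h => lap_eq_zero_right (mem_InvBi.1 h).1

end KohnWeyl
end

/-! ### Dimensions: harmonic decomposition, traces and invariants -/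

noncomputable section
namespace KohnWeyl

open MvPolynomial

variable {n : ℕ}

/-- The exponents of degree `p` in `n` variables. -/
abbrev Expo (n p : ℕ) : Type := {α : Fin n →₀ ℕ // α ∈ Finset.finsuppAntidiag Finset.univ p}

theorem sum_expo {p : ℕ} (α : Expo n p) : ∑ i, α.1 i = p :=
  (Finset.mem_finsuppAntidiag.1 α.2).1

/-- The monomials of bidegree `(p, q)`. -/
def biMonomial (p q : ℕ) (x : Expo n p × Expo n q) : Bi n p q :=
  ⟨monomial (Finsupp.sumFinsuppEquivProdFinsupp.symm (x.1.1, x.2.1)) 1,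
    isWeightedHomogeneous_monomial _ _ _ (by
      rw [weight_biWeight]
      simp only [Finsupp.sumFinsuppEquivProdFinsupp_symm_inl,
        Finsupp.sumFinsuppEquivProdFinsupp_symm_inr]
      rw [sum_expo, sum_expo])⟩

theorem linearIndependent_biMonomial (p q : ℕ) : LinearIndependent ℂ (biMonomial (n := n) p q) := by
  refine LinearIndependent.of_comp (Bi n p q).subtype ?_
  have h := (basisMonomials (Fin n ⊕ Fin n) ℂ).linearIndependent.comp
    (fun x : Expo n p × Expo n q => Finsupp.sumFinsuppEquivProdFinsupp.symm (x.1.1, x.2.1)) (by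
      intro x y hxy
      have := Finsupp.sumFinsuppEquivProdFinsupp.symm.injective hxy
      rw [Prod.ext_iff] at this
      exact Prod.ext (Subtype.ext this.1) (Subtype.ext this.2))
  have e : (Bi n p q).subtype ∘ biMonomial p q = basisMonomials (Fin n ⊕ Fin n) ℂ ∘
      fun x : Expo n p × Expo n q => Finsupp.sumFinsuppEquivProdFinsupp.symm (x.1.1, x.2.1) := by
    ext1 x
    simp [biMonomial]
  rw [e]
  exact h

theorem span_biMonomial (p q : ℕ) : ⊤ ≤ Submodule.span ℂ (Set.range (biMonomial (n := n) p q)) := by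
  have key : Bi n p q ≤ (Submodule.span ℂ (Set.range (biMonomial (n := n) p q))).map
      (Bi n p q).subtype := by
    intro f hf
    rw [f.as_sum]
    refine Submodule.sum_mem _ fun d hd => ?_
    have hw := hf (mem_support_iff.1 hd)
    rw [weight_biWeight, Prod.mk.injEq] at hw
    obtain ⟨⟨a, b⟩, rfl⟩ := Finsupp.sumFinsuppEquivProdFinsupp.symm.surjective d
    have h1 : monomial (Finsupp.sumFinsuppEquivProdFinsupp.symm (a, b)) (coeff
        (Finsupp.sumFinsuppEquivProdFinsupp.symm (a, b)) f) =
        coeff (Finsupp.sumFinsuppEquivProdFinsupp.symm (a, b)) f •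
          monomial (Finsupp.sumFinsuppEquivProdFinsupp.symm (a, b)) (1 : ℂ) := by
      rw [smul_monomial, smul_eq_mul, mul_one]
    rw [h1]
    refine Submodule.smul_mem _ _ ⟨biMonomial p q
      (⟨a, Finset.mem_finsuppAntidiag.2 ⟨hw.1, Finset.subset_univ _⟩⟩,
        ⟨b, Finset.mem_finsuppAntidiag.2 ⟨hw.2, Finset.subset_univ _⟩⟩),
      Submodule.subset_span ⟨_, rfl⟩, rfl⟩
  rintro ⟨f, hf⟩ -
  obtain ⟨g, hg, hgf⟩ := key hf
  have : g = ⟨f, hf⟩ := Subtype.ext hgf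
  exact this ▸ hg

/-- The basis of monomials. -/
def biBasis (n p q : ℕ) : Module.Basis (Expo n p × Expo n q) ℂ (Bi n p q) :=
  Module.Basis.mk (linearIndependent_biMonomial p q) (span_biMonomial p q)

instance (p q : ℕ) : FiniteDimensional ℂ (Bi n p q) := .of_basis (biBasis n p q)

instance (G : Subgroup (Un n)) (p q : ℕ) : FiniteDimensional ℂ (InvBi G p q) :=
  Submodule.finiteDimensional_of_le (S₂ := Bi n p q) inf_le_left

instance (G : Subgroup (Un n)) (p q : ℕ) : FiniteDimensional ℂ (HarmBi G p q) :=
  Submodule.finiteDimensional_of_le (S₂ := InvBi G p q) inf_le_left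

section harmonic

variable {G : Subgroup (Un n)}

/-- On this finite-dimensional space g ↦ Δ(|z|²g) is injective, hence surjective: on its kernel
|z|²Δ acts by −(n + p + q), which is negative as n > 0, so `eq_zero_of_rad_mul_lap` applies. -/
theorem exists_lap_rad_mul_eq (hn : n ≠ 0) {p q : ℕ} {f : Pol n} (hf : f ∈ InvBi G p q) :
    ∃ g ∈ InvBi G p q, lap n (rad n * g) = f := by
  let T : InvBi G p q →ₗ[ℂ] InvBi G p q :=
    (lap n ∘ₗ LinearMap.mulLeft ℂ (rad n)).restrict fun _ hg =>
      lap_mem_InvBi (rad_mul_mem_InvBi hg)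
  have hT : Function.Injective T := by
    rw [injective_iff_map_eq_zero]
    rintro ⟨g, hg⟩ h
    have h1 : lap n (rad n * g) = 0 := congrArg Subtype.val h
    have hgB := (mem_InvBi.1 hg).1
    rw [lap_rad_mul hgB] at h1
    refine Subtype.ext (eq_zero_of_rad_mul_lap hgB (ν := -((n + p + q : ℕ) : ℝ)) ?_ ?_)
    · have : (0 : ℝ) < (n + p + q : ℕ) := by exact_mod_cast (by omega)
      linarith
    · rw [eq_neg_of_add_eq_zero_left h1]
      push_cast
      module
  obtain ⟨g, hg⟩ := LinearMap.injective_iff_surjective.1 hT ⟨f, hf⟩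
  exact ⟨g.1, g.2, congrArg Subtype.val hg⟩

/-- The decomposition of a polynomial into a harmonic polynomial and a multiple of `|z|²`. -/
theorem exists_harmonic_add (hn : n ≠ 0) {p q : ℕ} {f : Pol n}
    (hf : f ∈ InvBi G (p + 1) (q + 1)) :
    ∃ h ∈ HarmBi G (p + 1) (q + 1), ∃ g ∈ InvBi G p q, f = h + rad n * g := by
  obtain ⟨g, hg, hgf⟩ := exists_lap_rad_mul_eq hn (lap_mem_InvBi hf)
  refine ⟨f - rad n * g, mem_HarmBi.2 ⟨Submodule.sub_mem _ hf (rad_mul_mem_InvBi hg), ?_⟩, g, hg,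
    by ring⟩
  rw [map_sub, hgf, sub_self]

/-- Rank–nullity for the surjective Laplacian between spaces of invariants. -/
theorem finrank_HarmBi_add (hn : n ≠ 0) (p q : ℕ) :
    Module.finrank ℂ (HarmBi G (p + 1) (q + 1)) + Module.finrank ℂ (InvBi G p q) =
      Module.finrank ℂ (InvBi G (p + 1) (q + 1)) := by
  let T : InvBi G (p + 1) (q + 1) →ₗ[ℂ] InvBi G p q :=
    (lap n).restrict fun _ hf => lap_mem_InvBi hf
  have hT : LinearMap.range T = ⊤ := by
    rw [LinearMap.range_eq_top]
    rintro ⟨f, hf⟩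
    obtain ⟨g, hg, hgf⟩ := exists_lap_rad_mul_eq hn hf
    exact ⟨⟨_, rad_mul_mem_InvBi hg⟩, Subtype.ext hgf⟩
  have h1 := LinearMap.finrank_range_add_finrank_ker T
  rw [hT, finrank_top] at h1
  have h2 : HarmBi G (p + 1) (q + 1) = (LinearMap.ker T).map (InvBi G (p + 1) (q + 1)).subtype := by
    ext f
    rw [mem_HarmBi]
    constructor
    · rintro ⟨h, h'⟩
      exact ⟨⟨f, h⟩, Subtype.ext h', rfl⟩
    · rintro ⟨f, h, rfl⟩
      exact ⟨f.2, congrArg Subtype.val h⟩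
  rw [h2, Submodule.finrank_map_subtype_eq, add_comm, h1]

end harmonic

/-- The restriction of a linear substitution to the polynomials of bidegree `(p, q)`. -/
def linSubstBi (p q : ℕ) (A B : Matrix (Fin n) (Fin n) ℂ) : Bi n p q →ₗ[ℂ] Bi n p q :=
  (linSubst A B).toLinearMap.restrict fun _ h => linSubst_mem A B h

theorem linSubstBi_mul (p q : ℕ) (A B A' B' : Matrix (Fin n) (Fin n) ℂ) :
    linSubstBi p q A B * linSubstBi p q A' B' = linSubstBi p q (A' * A) (B' * B) := by
  ext1 f
  exact Subtype.ext (congrArg (fun φ => φ f.1) (linSubst_comp A B A' B'))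

theorem linSubstBi_one (p q : ℕ) :
    linSubstBi p q (1 : Matrix (Fin n) (Fin n) ℂ) 1 = 1 := by
  ext1 f
  exact Subtype.ext (congrArg (fun φ => φ f.1) linSubst_one)

/-- The complete homogeneous symmetric polynomial of degree `p` of `d₁, …, dₙ`. -/
def hcoeff (d : Fin n → ℂ) (p : ℕ) : ℂ :=
  PowerSeries.coeff p (∏ i, PowerSeries.mk fun k => d i ^ k)

theorem hcoeff_eq_sum (d : Fin n → ℂ) (p : ℕ) :
    hcoeff d p = ∑ α : Expo n p, ∏ i, d i ^ α.1 i := by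
  rw [hcoeff, PowerSeries.coeff_prod]
  simp only [PowerSeries.coeff_mk]
  exact (Finset.sum_coe_sort (Finset.finsuppAntidiag Finset.univ p)
    fun α => ∏ i, d i ^ α i).symm

theorem trace_linSubstBi_diagonal (p q : ℕ) (d e : Fin n → ℂ) :
    LinearMap.trace ℂ _ (linSubstBi p q (Matrix.diagonal d) (Matrix.diagonal e)) =
      hcoeff d p * hcoeff e q := by
  classical
  rw [LinearMap.trace_eq_matrix_trace ℂ (biBasis n p q), Matrix.trace, hcoeff_eq_sum,
    hcoeff_eq_sum, Finset.sum_mul_sum, ← Finset.univ_product_univ, Finset.sum_product]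
  refine Finset.sum_congr rfl fun α _ => Finset.sum_congr rfl fun β _ => ?_
  rw [Matrix.diag_apply, LinearMap.toMatrix_apply]
  have h1 : linSubstBi p q (Matrix.diagonal d) (Matrix.diagonal e) (biBasis n p q (α, β)) =
      ((∏ i, d i ^ α.1 i) * ∏ i, e i ^ β.1 i) • biBasis n p q (α, β) := by
    refine Subtype.ext ?_
    simp only [biBasis, Module.Basis.mk_apply]
    change linSubst _ _ (monomial _ 1) = _ • monomial _ (1 : ℂ)
    have h2 : ∀ j, (∑ k, Matrix.diagonal d j k • X (Sum.inl k) : Pol n) = C (d j) * X (Sum.inl j) :=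
      fun j => by
        rw [Finset.sum_eq_single j] <;> simp +contextual [smul_eq_C_mul, eq_comm]
    have h3 : ∀ j, (∑ k, Matrix.diagonal e j k • X (Sum.inr k) : Pol n) = C (e j) * X (Sum.inr j) :=
      fun j => by
        rw [Finset.sum_eq_single j] <;> simp +contextual [smul_eq_C_mul, eq_comm]
    rw [linSubst, aeval_monomial, Finsupp.prod_fintype _ _ (by simp), Fintype.prod_sum_type,
      monomial_eq, Finsupp.prod_fintype _ _ (by simp), Fintype.prod_sum_type, smul_eq_C_mul]
    simp only [Sum.elim_inl, Sum.elim_inr, h2, h3, mul_pow, Finset.prod_mul_distrib, map_mul,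
      map_prod, map_pow, map_one, one_mul, Finsupp.sumFinsuppEquivProdFinsupp_symm_inl,
      Finsupp.sumFinsuppEquivProdFinsupp_symm_inr]
    ring
  rw [h1, map_smul]
  simp

/-- A matrix of finite order is diagonalizable. -/
theorem exists_diagonal_of_pow_eq_one (A : Matrix (Fin n) (Fin n) ℂ) {k : ℕ} (hk : k ≠ 0)
    (hA : A ^ k = 1) :
    ∃ (Q Q' : Matrix (Fin n) (Fin n) ℂ) (d : Fin n → ℂ), Q' * A * Q = Matrix.diagonal d ∧
      Q' * Q = 1 ∧ ∀ i, d i ^ k = 1 ∧ ∃ v : Fin n → ℂ, v ≠ 0 ∧ A.mulVec v = d i • v := by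
  classical
  set f : Module.End ℂ (Fin n → ℂ) := Matrix.toLin' A with hf
  have hfk : f ^ k = 1 := by
    rw [hf, ← Matrix.toLin'_pow, hA, Matrix.toLin'_one]; rfl
  -- X^k − 1 is separable in characteristic zero and annihilates `f`, so the eigenvectors span and a
  -- basis can be chosen among them.
  have hss : f.IsSemisimple := by
    refine Module.End.isSemisimple_of_squarefree_aeval_eq_zero (p := Polynomial.X ^ k - 1) ?_ ?_
    · refine Polynomial.Separable.squarefree ?_
      rw [Polynomial.X_pow_sub_one_separable_iff]
      exact_mod_cast hk
    · simp [hfk]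
  have htop := hss.iSup_eigenspace_eq_top
  set S : Set (Fin n → ℂ) := {v | ∃ μ : ℂ, f v = μ • v}
  have hS : ⊤ ≤ Submodule.span ℂ S := by
    rw [← htop, iSup_le_iff]
    intro μ v hv
    exact Submodule.subset_span ⟨μ, Module.End.mem_eigenspace_iff.1 hv⟩
  let b₀ := Module.Basis.ofSpan hS
  have hb₀ : ∀ i, b₀ i ∈ S := fun i =>
    Module.Basis.ofSpan_subset hS ⟨i, rfl⟩
  have : Fintype ((linearIndepOn_empty ℂ id).extend (Set.empty_subset S)) :=
    FiniteDimensional.fintypeBasisIndex b₀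
  have hcard : Fintype.card ((linearIndepOn_empty ℂ id).extend (Set.empty_subset S)) = n := by
    rw [← Module.finrank_eq_card_basis b₀]; simp
  let b := b₀.reindex (Fintype.equivFinOfCardEq hcard)
  have hb : ∀ i, b i ∈ S := fun i => by
    rw [Module.Basis.reindex_apply]; exact hb₀ _
  choose d hd using hb
  refine ⟨(Pi.basisFun ℂ (Fin n)).toMatrix b, b.toMatrix (Pi.basisFun ℂ (Fin n)), d, ?_,
    Module.Basis.toMatrix_mul_toMatrix_flip _ _, fun i => ⟨?_, b i, b.ne_zero i, ?_⟩⟩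
  · have h1 : A * (Pi.basisFun ℂ (Fin n)).toMatrix b =
        (Pi.basisFun ℂ (Fin n)).toMatrix b * Matrix.diagonal d := by
      ext i j
      have := congrFun (hd j) i
      rw [hf, Matrix.toLin'_apply] at this
      rw [Matrix.mul_diagonal, Matrix.mul_apply]
      simp only [Module.Basis.toMatrix_apply, Pi.basisFun_repr]
      simpa [Matrix.mulVec, dotProduct, mul_comm] using this
    rw [Matrix.mul_assoc, h1, ← Matrix.mul_assoc, Module.Basis.toMatrix_mul_toMatrix_flip,
      Matrix.one_mul]
  · have h1 : ∀ m : ℕ, (f ^ m) (b i) = d i ^ m • b i := by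
      intro m
      induction m with
      | zero => simp
      | succ m ih => rw [pow_succ', Module.End.mul_apply, ih, map_smul, hd, smul_smul, pow_succ]
    have h2 := h1 k
    rw [hfk, Module.End.one_apply] at h2
    have h3 : (d i ^ k - 1) • b i = 0 := by rw [sub_smul, ← h2, one_smul, sub_self]
    exact sub_eq_zero.1 ((smul_eq_zero.1 h3).resolve_right (b.ne_zero i))
  · simpa [hf] using hd i

/-- The diagonalizing matrix Q need not be unitary: Q on z together with its conjugate on z̄
conjugates the whole substitution into a diagonal one, and the trace does not change. -/
theorem trace_linSubstBi_of_diagonal (p q : ℕ) {A Q Q' : Matrix (Fin n) (Fin n) ℂ} {d : Fin n → ℂ}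
    (h1 : Q' * A * Q = Matrix.diagonal d) (h2 : Q' * Q = 1) :
    LinearMap.trace ℂ _ (linSubstBi p q A (A.map conj)) =
      hcoeff d p * hcoeff (fun i => conj (d i)) q := by
  have h1' : Q'.map conj * A.map conj * Q.map conj = Matrix.diagonal fun i => conj (d i) := by
    rw [← Matrix.map_mul, ← Matrix.map_mul, h1, Matrix.diagonal_map (map_zero _)]
  have h2' : Q'.map conj * Q.map conj = (1 : Matrix (Fin n) (Fin n) ℂ) := by
    rw [← Matrix.map_mul, h2, Matrix.map_one _ (map_zero _) (map_one _)]
  have h3 : Q * Q' = 1 := mul_eq_one_comm.1 h2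
  have h3' : Q.map conj * Q'.map conj = (1 : Matrix (Fin n) (Fin n) ℂ) := mul_eq_one_comm.1 h2'
  rw [← trace_linSubstBi_diagonal, ← h1, ← h1', Matrix.mul_assoc, Matrix.mul_assoc,
    ← linSubstBi_mul, LinearMap.trace_mul_comm, linSubstBi_mul, Matrix.mul_assoc,
    Matrix.mul_assoc, h3, h3', Matrix.mul_one, Matrix.mul_one]

/-- The representation of `G` on the polynomials of bidegree `(p, q)`. -/
def biRep (G : Subgroup (Un n)) (p q : ℕ) : Representation ℂ G (Bi n p q) where
  -- Substitution reverses products, so the inverse is needed for a homomorphism. It disappears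
  -- again when characters are summed over the group.
  toFun g := linSubstBi p q ((g⁻¹ : G) : Un n).1 (((g⁻¹ : G) : Un n).1.map conj)
  map_one' := by
    rw [inv_one, ← linSubstBi_one]
    congr 1
    ext i j
    simp [Matrix.one_apply, apply_ite]
  map_mul' g h := by
    rw [linSubstBi_mul, mul_inv_rev]
    congr 1
    simp [Matrix.map_mul]

theorem InvBi_eq_map_invariants (G : Subgroup (Un n)) (p q : ℕ) :
    InvBi G p q = (biRep G p q).invariants.map (Bi n p q).subtype := by
  have h (g : G) (f : Bi n p q) : (biRep G p q g f).1 = act (g⁻¹ : G).1 f.1 := rfl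
  ext f
  rw [mem_InvBi]
  constructor
  · rintro ⟨hf, hf'⟩
    refine ⟨⟨f, hf⟩, fun g => Subtype.ext ?_, rfl⟩
    rw [h]
    exact hf' _ (g⁻¹).2
  · rintro ⟨f, hf, rfl⟩
    refine ⟨f.2, fun g hg => ?_⟩
    have := congrArg Subtype.val (hf (⟨g, hg⟩ : G)⁻¹)
    rw [h, inv_inv] at this
    exact this

theorem character_biRep (G : Subgroup (Un n)) (p q : ℕ) (g : G) :
    (biRep G p q).character g = LinearMap.trace ℂ _
      (linSubstBi p q ((g⁻¹ : G) : Un n).1 (((g⁻¹ : G) : Un n).1.map conj)) := rfl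

/-- The dimension of the invariants is the average of the character. -/
theorem finrank_InvBi (G : Subgroup (Un n)) [Fintype G] (p q : ℕ) :
    (Module.finrank ℂ (InvBi G p q) : ℂ) = (Nat.card G : ℂ)⁻¹ *
      ∑ g : G, LinearMap.trace ℂ _ (linSubstBi p q (g : Un n).1 ((g : Un n).1.map conj)) := by
  have hne : (Nat.card G : ℂ) ≠ 0 := by exact_mod_cast Nat.card_pos.ne'
  have := invertibleOfNonzero hne
  have h := (biRep G p q).card_inv_mul_sum_char_eq_finrank
  have h2 : Module.finrank ℂ (InvBi G p q) = Module.finrank ℂ (biRep G p q).invariants := by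
    rw [InvBi_eq_map_invariants, Submodule.finrank_map_subtype_eq]
  have h3 : ∑ g : G, (biRep G p q).character g =
      ∑ g : G, LinearMap.trace ℂ _ (linSubstBi p q (g : Un n).1 ((g : Un n).1.map conj)) := by
    refine Eq.trans (Finset.sum_congr rfl fun g _ => character_biRep G p q g) ?_
    exact Equiv.sum_comp (Equiv.inv G) fun g : G =>
      LinearMap.trace ℂ _ (linSubstBi p q (g : Un n).1 ((g : Un n).1.map conj))
  rw [h2, ← h, h3]

end KohnWeyl
end

/-! ### Growth of the dimensions of invariant and harmonic polynomials -/

noncomputable section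
namespace KohnWeyl

open Filter Topology Finset

/-- Each factor 1/(1 − dt) with |d| ≤ 1 raises the degree of polynomial growth of the coefficients
by at most one. -/
theorem norm_coeff_mul_geom_le {f : PowerSeries ℂ} {c : ℝ} {a : ℕ} (hc : 0 ≤ c)
    (hf : ∀ k, ‖PowerSeries.coeff k f‖ ≤ c * ((k : ℝ) + 1) ^ a) {d : ℂ} (hd : ‖d‖ ≤ 1) (k : ℕ) :
    ‖PowerSeries.coeff k (f * PowerSeries.mk fun j => d ^ j)‖ ≤ c * ((k : ℝ) + 1) ^ (a + 1) := by
  rw [PowerSeries.coeff_mul]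
  calc _ ≤ ∑ x ∈ antidiagonal k, ‖PowerSeries.coeff x.1 f *
        PowerSeries.coeff x.2 (PowerSeries.mk fun j => d ^ j)‖ := norm_sum_le _ _
    _ ≤ ∑ x ∈ antidiagonal k, c * ((k : ℝ) + 1) ^ a := by
        refine Finset.sum_le_sum fun x hx => ?_
        rw [norm_mul, PowerSeries.coeff_mk, norm_pow]
        have hx1 : (x.1 : ℝ) ≤ k := by
          exact_mod_cast (Finset.HasAntidiagonal.mem_antidiagonal.1 hx) ▸ Nat.le_add_right _ _
        calc _ ≤ c * ((x.1 : ℝ) + 1) ^ a * 1 := by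
              gcongr
              · exact hf _
              · exact pow_le_one₀ (norm_nonneg _) hd
          _ ≤ _ := by rw [mul_one]; gcongr
    _ = _ := by
        rw [Finset.sum_const, Finset.Nat.card_antidiagonal, nsmul_eq_mul]; push_cast; ring

theorem norm_coeff_mul_prod_geom_le {ι : Type*} {f : PowerSeries ℂ} {c : ℝ} (hc : 0 ≤ c)
    (hf : ∀ k, ‖PowerSeries.coeff k f‖ ≤ c) {d : ι → ℂ} (hd : ∀ i, ‖d i‖ ≤ 1) (s : Finset ι)
    (k : ℕ) :
    ‖PowerSeries.coeff k (f * ∏ i ∈ s, PowerSeries.mk fun j => d i ^ j)‖ ≤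
      c * ((k : ℝ) + 1) ^ #s := by
  classical
  induction s using Finset.induction_on generalizing k with
  | empty => simpa using hf k
  | insert i s hi ih =>
    rw [Finset.prod_insert hi, Finset.card_insert_of_notMem hi, mul_comm (PowerSeries.mk _),
      ← mul_assoc]
    exact norm_coeff_mul_geom_le hc ih (hd i) k

theorem sum_range_coeff (f : PowerSeries ℂ) (k : ℕ) :
    ∑ p ∈ range (k + 1), PowerSeries.coeff p f = PowerSeries.coeff k (PowerSeries.mk 1 * f) := by
  rw [mul_comm, PowerSeries.coeff_mul, Finset.Nat.sum_antidiagonal_eq_sum_range_succ_mk]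
  simp

/-- The coefficients of 1/((1 − t)(1 − at)) are geometric sums, which stay bounded for a ≠ 1. This
saves one power of K over the case a = 1. -/
theorem norm_coeff_geom_mul_geom_le {a : ℂ} (ha : ‖a‖ ≤ 1) (ha1 : a ≠ 1) (k : ℕ) :
    ‖PowerSeries.coeff k (PowerSeries.mk 1 * PowerSeries.mk fun j => a ^ j)‖ ≤ 2 / ‖a - 1‖ := by
  rw [← sum_range_coeff]
  simp only [PowerSeries.coeff_mk]
  rw [geom_sum_eq ha1, norm_div]
  gcongr
  calc ‖a ^ (k + 1) - 1‖ ≤ ‖a ^ (k + 1)‖ + ‖(1 : ℂ)‖ := norm_sub_le _ _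
    _ ≤ 1 + 1 := by
        rw [norm_pow, norm_one]
        gcongr
        exact pow_le_one₀ (norm_nonneg _) ha
    _ = 2 := by norm_num

variable {n : ℕ}

theorem tendsto_sum_hcoeff_of_ne_one {d : Fin n → ℂ} (hd : ∀ i, ‖d i‖ ≤ 1) {i₀ : Fin n}
    (hi : d i₀ ≠ 1) :
    Tendsto (fun K : ℕ => (∑ p ∈ range K, hcoeff d p) / (K : ℂ) ^ n) atTop (𝓝 0) := by
  have hb : ∀ K : ℕ, ‖∑ p ∈ range (K + 1), hcoeff d p‖ ≤
      2 / ‖d i₀ - 1‖ * ((K : ℝ) + 1) ^ (n - 1) := by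
    intro K
    -- Partial summation is multiplication by 1/(1 − t). Paired with the factor of d i₀ it has
    -- bounded coefficients, and the other n − 1 factors contribute the power n − 1.
    have h1 : ∑ p ∈ range (K + 1), hcoeff d p = PowerSeries.coeff K
        ((PowerSeries.mk 1 * PowerSeries.mk fun j => d i₀ ^ j) *
          ∏ i ∈ univ.erase i₀, PowerSeries.mk fun j => d i ^ j) := by
      simp only [hcoeff]
      rw [sum_range_coeff, mul_assoc, Finset.mul_prod_erase univ
        (fun i => PowerSeries.mk fun j => d i ^ j) (Finset.mem_univ i₀)]
    have h2 := norm_coeff_mul_prod_geom_le (by positivity)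
      (norm_coeff_geom_mul_geom_le (hd i₀) hi) hd (univ.erase i₀) K
    rw [Finset.card_erase_of_mem (Finset.mem_univ _), Finset.card_univ, Fintype.card_fin] at h2
    rwa [h1]
  rw [← tendsto_add_atTop_iff_nat 1]
  refine squeeze_zero_norm (a := fun K : ℕ => 2 / ‖d i₀ - 1‖ * (1 / ((K : ℝ) + 1))) (fun K => ?_) ?_
  · have hn : n = n - 1 + 1 := by have := i₀.pos; omega
    have hK : ‖((K + 1 : ℕ) : ℂ)‖ = (K : ℝ) + 1 := by
      rw [Complex.norm_natCast]; push_cast; ring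
    rw [norm_div, norm_pow, hK, div_le_iff₀ (by positivity)]
    refine (hb K).trans (le_of_eq ?_)
    conv_rhs => rw [hn, pow_succ]
    field_simp
  · have := (tendsto_one_div_add_atTop_nhds_zero_nat (𝕜 := ℝ)).const_mul (2 / ‖d i₀ - 1‖)
    rwa [mul_zero] at this

theorem hcoeff_one (m p : ℕ) : hcoeff (fun _ : Fin (m + 1) => (1 : ℂ)) p = (m + p).choose m := by
  have h : (PowerSeries.mk fun k => (1 : ℂ) ^ k) = PowerSeries.mk 1 := by
    ext k; simp
  rw [hcoeff, h, Finset.prod_const, Finset.card_univ, Fintype.card_fin,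
    PowerSeries.mk_one_pow_eq_mk_choose_add, PowerSeries.coeff_mk]

theorem tendsto_sum_choose (m : ℕ) :
    Tendsto (fun K : ℕ => (∑ p ∈ range K, ((m + p).choose m : ℝ)) / (K : ℝ) ^ (m + 1)) atTop
      (𝓝 (1 / (m + 1).factorial)) := by
  have h1 : Tendsto (fun N : ℕ => (N : ℝ) * ((N : ℝ) - m)⁻¹) atTop (𝓝 1) := by
    rw [← tendsto_add_atTop_iff_nat m]
    have h2 : Tendsto (fun N : ℕ => 1 + (m : ℝ) / N) atTop (𝓝 (1 + 0)) :=
      tendsto_const_nhds.add (tendsto_const_div_atTop_nhds_zero_nat _)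
    rw [add_zero] at h2
    refine h2.congr' ?_
    filter_upwards [eventually_gt_atTop 0] with N hN
    have : (N : ℝ) ≠ 0 := by positivity
    push_cast
    field_simp
    rw [add_sub_cancel_right, div_self this]
  -- With the sequence 1/(N − m) and N = K + m this gives C(K + m, m + 1)/K^(m+1) → 1/(m + 1)!. By
  -- the hockey-stick identity this binomial coefficient is the sum in question.
  have h2 := (ProbabilityTheory.tendsto_choose_mul_pow_atTop (m + 1) h1).comp
    (tendsto_add_atTop_nat m)
  rw [one_pow] at h2
  refine h2.congr' ?_
  filter_upwards [eventually_gt_atTop 0] with K hK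
  obtain ⟨K, rfl⟩ := Nat.exists_eq_succ_of_ne_zero hK.ne'
  have h3 := Nat.sum_range_add_choose K m
  have h4 : ∑ p ∈ range (K + 1), ((m + p).choose m : ℝ) = ((K + m + 1).choose (m + 1) : ℕ) := by
    rw [← h3]; push_cast
    exact Finset.sum_congr rfl fun p _ => by rw [add_comm]
  simp only [Function.comp, Nat.succ_eq_add_one]
  rw [h4, div_eq_mul_inv, show K + 1 + m = K + m + 1 by ring, ← inv_pow]
  congr 3
  push_cast
  ring

theorem trace_linSubstBi_one (m p q : ℕ) :
    LinearMap.trace ℂ _ (linSubstBi p q (1 : Matrix (Fin (m + 1)) (Fin (m + 1)) ℂ)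
      ((1 : Matrix (Fin (m + 1)) (Fin (m + 1)) ℂ).map conj)) =
      (m + p).choose m * (m + q).choose m := by
  rw [trace_linSubstBi_of_diagonal p q (Q := 1) (Q' := 1) (d := fun _ => 1)]
  · simp [hcoeff_one]
  · simp [Matrix.diagonal_one]
  · simp

/-- The action of `g` on polynomials, in terms of the eigenvalues of `g`. -/
theorem exists_eigenvalues {G : Subgroup (Un n)} [Finite G] (hG : ActsFreely G) {g : Un n}
    (hg : g ∈ G) (hg1 : g ≠ 1) :
    ∃ d : Fin n → ℂ, (∀ i, ‖d i‖ = 1) ∧ (∀ i, d i ≠ 1) ∧ ∀ p q,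
      LinearMap.trace ℂ _ (linSubstBi p q g.1 (g.1.map conj)) =
        hcoeff d p * hcoeff (fun i => conj (d i)) q := by
  have ho : 0 < orderOf (⟨g, hg⟩ : G) := orderOf_pos _
  have hpow : g.1 ^ orderOf (⟨g, hg⟩ : G) = 1 :=
    congrArg (fun x : G => (x : Un n).1) (pow_orderOf_eq_one (⟨g, hg⟩ : G))
  obtain ⟨Q, Q', d, h1, h2, h3⟩ := exists_diagonal_of_pow_eq_one g.1 ho.ne' hpow
  refine ⟨d, fun i => Complex.norm_eq_one_of_pow_eq_one (h3 i).1 ho.ne', fun i hi => hg1 ?_,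
    fun p q => trace_linSubstBi_of_diagonal p q h1 h2⟩
  -- An eigenvector for the eigenvalue 1, normalized, would be a point of the sphere fixed by g,
  -- against freeness.
  obtain ⟨v, hv, hgv⟩ := (h3 i).2
  rw [hi, one_smul] at hgv
  have hv' : (WithLp.toLp 2 v : Cn n) ≠ 0 := by simpa using hv
  set w : Cn n := WithLp.toLp 2 v
  have hw : ‖w‖ ≠ 0 := norm_ne_zero_iff.2 hv'
  refine hG g hg ⟨((‖w‖⁻¹ : ℝ) : ℂ) • w, ?_⟩ ?_
  · rw [mem_sphere_zero_iff_norm, norm_smul, Complex.norm_real, norm_inv, norm_norm,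
      inv_mul_cancel₀ hw]
  · refine Subtype.ext ?_
    change Matrix.toEuclideanLin g.1 (((‖w‖⁻¹ : ℝ) : ℂ) • w) = ((‖w‖⁻¹ : ℝ) : ℂ) • w
    rw [map_smul]
    congr 1
    simp [w, Matrix.toLpLin_apply, hgv]

section slices

variable {m : ℕ} {G : Subgroup (Un (m + 1))}

/-- The trace is a product of a function of p and a function of q, so with q fixed only the growth
in p matters; it has full order only for g = 1. -/
theorem tendsto_sum_trace_left [Finite G] (hG : ActsFreely G) {g : Un (m + 1)} (hg : g ∈ G)
    (q : ℕ) [Decidable (g = 1)] :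
    Tendsto (fun K : ℕ => (∑ p ∈ range K,
      LinearMap.trace ℂ _ (linSubstBi p q g.1 (g.1.map conj))) / (K : ℂ) ^ (m + 1)) atTop
      (𝓝 (if g = 1 then (((m + q).choose m : ℝ) / (m + 1).factorial : ℝ) else 0)) := by
  split_ifs with h
  · subst h
    have := ((Complex.continuous_ofReal.tendsto _).comp (tendsto_sum_choose m)).mul_const
      (((m + q).choose m : ℝ) : ℂ)
    convert! this using 1
    · ext K
      simp only [Matrix.UnitaryGroup.one_val, trace_linSubstBi_one, ← Finset.sum_mul]
      simp
      ring
    · congr 1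
      push_cast
      ring
  · obtain ⟨d, hd, hd1, htr⟩ := exists_eigenvalues hG hg h
    simp only [htr, ← Finset.sum_mul]
    have := (tendsto_sum_hcoeff_of_ne_one (fun i => (hd i).le) (hd1 0)).mul_const
      (hcoeff (fun i => conj (d i)) q)
    rw [zero_mul] at this
    exact this.congr fun K => by ring

theorem tendsto_sum_trace_right [Finite G] (hG : ActsFreely G) {g : Un (m + 1)} (hg : g ∈ G)
    (p : ℕ) [Decidable (g = 1)] :
    Tendsto (fun K : ℕ => (∑ q ∈ range K,
      LinearMap.trace ℂ _ (linSubstBi p q g.1 (g.1.map conj))) / (K : ℂ) ^ (m + 1)) atTop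
      (𝓝 (if g = 1 then (((m + p).choose m : ℝ) / (m + 1).factorial : ℝ) else 0)) := by
  split_ifs with h
  · subst h
    have := ((Complex.continuous_ofReal.tendsto _).comp (tendsto_sum_choose m)).const_mul
      (((m + p).choose m : ℝ) : ℂ)
    convert! this using 1
    · ext K
      simp only [Matrix.UnitaryGroup.one_val, trace_linSubstBi_one, ← Finset.mul_sum]
      simp
      ring
    · congr 1
      push_cast
      ring
  · obtain ⟨d, hd, hd1, htr⟩ := exists_eigenvalues hG hg h
    simp only [htr, ← Finset.mul_sum]
    have := (tendsto_sum_hcoeff_of_ne_one (d := fun i => conj (d i)) (i₀ := 0)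
      (fun i => by simp [hd i]) (by
        intro h0
        exact hd1 0 (by simpa using congrArg conj h0))).const_mul (hcoeff d p)
    rw [mul_zero] at this
    exact this.congr fun K => by ring

theorem tendsto_sum_finrank_InvBi_left [Finite G] (hG : ActsFreely G) (q : ℕ) :
    Tendsto (fun K : ℕ => (∑ p ∈ range K, (Module.finrank ℂ (InvBi G p q) : ℝ)) /
      (K : ℝ) ^ (m + 1)) atTop
      (𝓝 (((m + q).choose m : ℝ) / (m + 1).factorial / Nat.card G)) := by
  classical
  have := Fintype.ofFinite G
  have h := (tendsto_finsetSum univ fun g (_ : g ∈ (univ : Finset G)) =>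
    tendsto_sum_trace_left hG g.2 q).const_mul (Nat.card G : ℂ)⁻¹
  have hlim : ∑ g : G, (if (g : Un (m + 1)) = 1 then
      ((((m + q).choose m : ℝ) / (m + 1).factorial : ℝ) : ℂ) else 0) =
      ((((m + q).choose m : ℝ) / (m + 1).factorial : ℝ) : ℂ) := by
    rw [Finset.sum_eq_single (1 : G)] <;> simp +contextual
  rw [hlim] at h
  have h2 := (Complex.continuous_re.tendsto _).comp h
  convert! h2 using 1
  · ext K
    simp only [Function.comp]
    rw [← Complex.ofReal_re ((∑ p ∈ range K, (Module.finrank ℂ (InvBi G p q) : ℝ)) /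
      (K : ℝ) ^ (m + 1))]
    congr 1
    push_cast
    rw [← Finset.sum_div, Finset.sum_comm, ← mul_div_assoc, Finset.mul_sum]
    congr 1
    exact Finset.sum_congr rfl fun p _ => finrank_InvBi G p q
  · congr 1
    rw [← Complex.ofReal_natCast (Nat.card G), ← Complex.ofReal_inv, ← Complex.ofReal_mul,
      Complex.ofReal_re]
    ring

theorem tendsto_sum_finrank_InvBi_right [Finite G] (hG : ActsFreely G) (p : ℕ) :
    Tendsto (fun K : ℕ => (∑ q ∈ range K, (Module.finrank ℂ (InvBi G p q) : ℝ)) /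
      (K : ℝ) ^ (m + 1)) atTop
      (𝓝 (((m + p).choose m : ℝ) / (m + 1).factorial / Nat.card G)) := by
  classical
  have := Fintype.ofFinite G
  have h := (tendsto_finsetSum univ fun g (_ : g ∈ (univ : Finset G)) =>
    tendsto_sum_trace_right hG g.2 p).const_mul (Nat.card G : ℂ)⁻¹
  have hlim : ∑ g : G, (if (g : Un (m + 1)) = 1 then
      ((((m + p).choose m : ℝ) / (m + 1).factorial : ℝ) : ℂ) else 0) =
      ((((m + p).choose m : ℝ) / (m + 1).factorial : ℝ) : ℂ) := by
    rw [Finset.sum_eq_single (1 : G)] <;> simp +contextual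
  rw [hlim] at h
  have h2 := (Complex.continuous_re.tendsto _).comp h
  convert! h2 using 1
  · ext K
    simp only [Function.comp]
    rw [← Complex.ofReal_re ((∑ q ∈ range K, (Module.finrank ℂ (InvBi G p q) : ℝ)) /
      (K : ℝ) ^ (m + 1))]
    congr 1
    push_cast
    rw [← Finset.sum_div, Finset.sum_comm, ← mul_div_assoc, Finset.mul_sum]
    congr 1
    exact Finset.sum_congr rfl fun q _ => finrank_InvBi G p q
  · congr 1
    rw [← Complex.ofReal_natCast (Nat.card G), ← Complex.ofReal_inv, ← Complex.ofReal_mul,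
      Complex.ofReal_re]
    ring

/-- For differences F(p + 1) = I(p + 1) − J(p) the shift of index in J does not affect the limit,
since (K/(K + 1))^k → 1. -/
theorem tendsto_sum_range_of_add_eq {F I J : ℕ → ℝ} {a b : ℝ} {k : ℕ} (h0 : F 0 = I 0)
    (h : ∀ p, F (p + 1) + J p = I (p + 1))
    (hI : Tendsto (fun K : ℕ => (∑ p ∈ range K, I p) / (K : ℝ) ^ k) atTop (𝓝 a))
    (hJ : Tendsto (fun K : ℕ => (∑ p ∈ range K, J p) / (K : ℝ) ^ k) atTop (𝓝 b)) :
    Tendsto (fun K : ℕ => (∑ p ∈ range K, F p) / (K : ℝ) ^ k) atTop (𝓝 (a - b)) := by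
  rw [← tendsto_add_atTop_iff_nat 1] at hI ⊢
  have h1 : Tendsto (fun K : ℕ => (K : ℝ) / ((K : ℝ) + 1)) atTop (𝓝 1) :=
    tendsto_natCast_div_add_atTop 1
  have h2 := hJ.mul (h1.pow k)
  rw [one_pow, mul_one] at h2
  refine (hI.sub h2).congr' ?_
  filter_upwards [eventually_gt_atTop 0] with K hK
  have hK' : (K : ℝ) ≠ 0 := by positivity
  have h3 : (K : ℝ) + 1 ≠ 0 := by positivity
  have h4 : ∀ p, F (p + 1) = I (p + 1) - J p := fun p => by linarith [h p]
  rw [Finset.sum_range_succ' F, Finset.sum_range_succ' I, h0]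
  simp only [h4, Finset.sum_sub_distrib]
  rw [div_pow]
  push_cast
  field_simp
  ring

/-- The differences of the dimensions of the spaces of homogeneous polynomials. -/
def choosePred (m : ℕ) : ℕ → ℝ
  | 0 => 1
  | q + 1 => (m + (q + 1)).choose m - (m + q).choose m

theorem tendsto_sum_finrank_HarmBi_left [Finite G] (hG : ActsFreely G) (q : ℕ) :
    Tendsto (fun K : ℕ => (∑ p ∈ range K, (Module.finrank ℂ (HarmBi G p q) : ℝ)) /
      (K : ℝ) ^ (m + 1)) atTop
      (𝓝 (choosePred m q / (m + 1).factorial / Nat.card G)) := by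
  cases q with
  | zero =>
    have := tendsto_sum_finrank_InvBi_left hG 0
    have e : ∀ p, Module.finrank ℂ (HarmBi G p 0) = Module.finrank ℂ (InvBi G p 0) := fun p => by
      rw [HarmBi_zero_right]
    simpa [e, choosePred] using this
  | succ q =>
    have := tendsto_sum_range_of_add_eq (F := fun p => (Module.finrank ℂ (HarmBi G p (q + 1)) : ℝ))
      (by rw [HarmBi_zero_left])
      (fun p => by exact_mod_cast finrank_HarmBi_add (Nat.succ_ne_zero m) (G := G) p q)
      (tendsto_sum_finrank_InvBi_left hG (q + 1)) (tendsto_sum_finrank_InvBi_left hG q)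
    rwa [← sub_div, ← sub_div] at this

theorem tendsto_sum_finrank_HarmBi_right [Finite G] (hG : ActsFreely G) (p : ℕ) :
    Tendsto (fun K : ℕ => (∑ q ∈ range K, (Module.finrank ℂ (HarmBi G p q) : ℝ)) /
      (K : ℝ) ^ (m + 1)) atTop
      (𝓝 (choosePred m p / (m + 1).factorial / Nat.card G)) := by
  cases p with
  | zero =>
    have := tendsto_sum_finrank_InvBi_right hG 0
    have e : ∀ q, Module.finrank ℂ (HarmBi G 0 q) = Module.finrank ℂ (InvBi G 0 q) := fun q => by
      rw [HarmBi_zero_left]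
    simpa [e, choosePred] using this
  | succ p =>
    have := tendsto_sum_range_of_add_eq (F := fun q => (Module.finrank ℂ (HarmBi G (p + 1) q) : ℝ))
      (by rw [HarmBi_zero_right])
      (fun q => by exact_mod_cast finrank_HarmBi_add (Nat.succ_ne_zero m) (G := G) p q)
      (tendsto_sum_finrank_InvBi_right hG (p + 1)) (tendsto_sum_finrank_InvBi_right hG p)
    rwa [← sub_div, ← sub_div] at this

end slices

theorem finrank_Bi (m p q : ℕ) :
    Module.finrank ℂ (Bi (m + 1) p q) = (m + p).choose m * (m + q).choose m := by
  have h := trace_linSubstBi_one m p q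
  have h1 : (1 : Matrix (Fin (m + 1)) (Fin (m + 1)) ℂ).map conj = 1 := by
    rw [Matrix.map_one _ (map_zero _) (map_one _)]
  rw [h1, linSubstBi_one, LinearMap.trace_one] at h
  exact_mod_cast h

theorem InvBi_bot (p q : ℕ) : InvBi (⊥ : Subgroup (Un n)) p q = Bi n p q := by
  ext f
  rw [mem_InvBi]
  refine ⟨fun h => h.1, fun h => ⟨h, fun g hg => ?_⟩⟩
  rw [Subgroup.mem_bot.1 hg, act_one]
  rfl

theorem HarmBi_le_bot (G : Subgroup (Un n)) (p q : ℕ) : HarmBi G p q ≤ HarmBi ⊥ p q := by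
  intro f hf
  rw [mem_HarmBi] at hf ⊢
  rw [InvBi_bot]
  exact ⟨(mem_InvBi.1 hf.1).1, hf.2⟩

theorem choose_add_le_pow (m p : ℕ) : (m + p).choose m ≤ (p + 1) ^ m := by
  induction m with
  | zero => simp
  | succ m ih =>
    have h := Nat.add_one_mul_choose_eq (m + p) m
    have h2 : (m + p + 1) * (m + p).choose m ≤ (m + 1) * (p + 1) * (p + 1) ^ m :=
      Nat.mul_le_mul (by nlinarith) ih
    rw [h] at h2
    rw [show m + 1 + p = m + p + 1 by ring]
    refine Nat.le_of_mul_le_mul_right (c := m + 1) ?_ (Nat.succ_pos m)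
    calc _ ≤ _ := h2
      _ = _ := by ring

/-- Bounding by all polynomials of the bidegree would give (p + 1)^(m+1) (q + 1)^(m+1), one degree
too much for the domination of the slices. The gain comes from the cancellation in
`finrank_HarmBi_add` for the trivial group. -/
theorem finrank_HarmBi_le (m : ℕ) (G : Subgroup (Un (m + 2))) (p q : ℕ) :
    (Module.finrank ℂ (HarmBi G p q) : ℝ) ≤
      ((p : ℝ) + 1) ^ m * ((q : ℝ) + 1) ^ m * (p + q + 2) := by
  have h1 : Module.finrank ℂ (HarmBi G p q) ≤
      Module.finrank ℂ (HarmBi (⊥ : Subgroup (Un (m + 2))) p q) :=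
    Submodule.finrank_mono (HarmBi_le_bot G p q)
  have h2 : Module.finrank ℂ (HarmBi (⊥ : Subgroup (Un (m + 2))) p q) ≤
      (p + 1) ^ m * (q + 1) ^ m * (p + q + 2) := by
    have e := fun p => choose_add_le_pow m p
    have e1 := fun p => choose_add_le_pow (m + 1) p
    cases p with
    | zero =>
      rw [HarmBi_zero_left, InvBi_bot, finrank_Bi]
      have := e1 q
      simp only [add_zero, Nat.choose_self, one_mul, zero_add, one_pow]
      calc _ ≤ _ := this
        _ = (q + 1) ^ m * (q + 1) := by ring
        _ ≤ _ := by gcongr; omega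
    | succ p =>
      cases q with
      | zero =>
        rw [HarmBi_zero_right, InvBi_bot, finrank_Bi]
        have := e1 (p + 1)
        simp only [add_zero, Nat.choose_self, mul_one, zero_add, one_pow]
        calc _ ≤ _ := this
          _ = (p + 1 + 1) ^ m * (p + 1 + 1) := by ring
          _ ≤ _ := by gcongr; omega
      | succ q =>
        have h := finrank_HarmBi_add (n := m + 2) (Nat.succ_ne_zero _)
          (G := (⊥ : Subgroup (Un (m + 2)))) p q
        rw [InvBi_bot, InvBi_bot, finrank_Bi, finrank_Bi] at h
        have pas : ∀ p, (m + 1 + (p + 1)).choose (m + 1) =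
            (m + (p + 1)).choose m + (m + 1 + p).choose (m + 1) := fun p => by
          rw [show m + 1 + (p + 1) = (m + (p + 1)) + 1 by ring, Nat.choose_succ_succ,
            show m + 1 + p = m + (p + 1) by ring]
        have hp := pas p
        have hq := pas q
        -- The identity ab − a′b′ = (a − a′)b + a′(b − b′), with the differences given by Pascal's
        -- rule.
        have key : Module.finrank ℂ (HarmBi (⊥ : Subgroup (Un (m + 2))) (p + 1) (q + 1)) =
            (m + (p + 1)).choose m * (m + 1 + (q + 1)).choose (m + 1) +
              (m + 1 + p).choose (m + 1) * (m + (q + 1)).choose m := by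
          rw [hp] at h
          rw [hq] at h ⊢
          linarith
        rw [key]
        calc _ ≤ (p + 1 + 1) ^ m * (q + 1 + 1) ^ (m + 1) +
              (p + 1 + 1) ^ (m + 1) * (q + 1 + 1) ^ m := by
                gcongr
                · exact e _
                · exact e1 _
                · exact (e1 p).trans (Nat.pow_le_pow_left (by omega) _)
                · exact e _
          _ = _ := by ring
  calc (Module.finrank ℂ (HarmBi G p q) : ℝ) ≤ ((p + 1) ^ m * (q + 1) ^ m * (p + q + 2) : ℕ) := by
        exact_mod_cast h1.trans h2
    _ = _ := by push_cast; ring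

/-- The limit for the trivial group. -/
def weylLimit (m : ℕ) : ℝ :=
  ∑' q : ℕ, (if q = 0 then 0 else
    choosePred (m + 1) q / (m + 2).factorial * (2 * (q : ℝ))⁻¹ ^ (m + 2)) +
  ∑' p : ℕ, choosePred (m + 1) p / (m + 2).factorial * (2 * ((p : ℝ) + m + 1))⁻¹ ^ (m + 2)

theorem tendsto_hyperbolaSum_finrank {m : ℕ} {G : Subgroup (Un (m + 2))} [Finite G]
    (hG : ActsFreely G) :
    Tendsto (fun Λ : ℝ => hyperbolaSum m (fun p q => (Module.finrank ℂ (HarmBi G p q) : ℝ)) Λ /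
      Λ ^ (m + 2)) atTop (𝓝 (weylLimit m / Nat.card G)) := by
  have h := tendsto_hyperbolaSum (m := m)
    (F := fun p q => (Module.finrank ℂ (HarmBi G p q) : ℝ))
    (α := fun q => choosePred (m + 1) q / (m + 2).factorial / Nat.card G)
    (β := fun p => choosePred (m + 1) p / (m + 2).factorial / Nat.card G)
    (fun p q => Nat.cast_nonneg _) (finrank_HarmBi_le m G)
    (fun q => tendsto_sum_finrank_HarmBi_left (m := m + 1) hG q)
    (fun p => tendsto_sum_finrank_HarmBi_right (m := m + 1) hG p)
  convert! h using 2
  rw [weylLimit, add_div, ← tsum_div_const, ← tsum_div_const]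
  congr 1
  · refine tsum_congr fun q => ?_
    split_ifs <;> ring
  · exact tsum_congr fun q => by ring

/-- In dimension one there are no harmonic polynomials of positive bidegree. -/
theorem finrank_HarmBi_dim_one (G : Subgroup (Un 1)) (p q : ℕ) :
    Module.finrank ℂ (HarmBi G (p + 1) (q + 1)) = 0 := by
  have h1 : Module.finrank ℂ (HarmBi G (p + 1) (q + 1)) ≤
      Module.finrank ℂ (HarmBi (⊥ : Subgroup (Un 1)) (p + 1) (q + 1)) :=
    Submodule.finrank_mono (HarmBi_le_bot G _ _)
  have h := finrank_HarmBi_add (n := 1) one_ne_zero (G := (⊥ : Subgroup (Un 1))) p q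
  have e : ∀ p q, Module.finrank ℂ (Bi 1 p q) = 1 := fun p q =>
    (finrank_Bi 0 p q).trans (by simp)
  rw [InvBi_bot, InvBi_bot, e, e] at h
  omega

end KohnWeyl
end

/-! ### Integration on the sphere and on its quotient -/

noncomputable section
namespace KohnWeyl

open MeasureTheory Set Filter Topology
open scoped Pointwise

variable {n : ℕ}

instance : IsFiniteMeasure (sphMeasure n) := by unfold sphMeasure; infer_instance

instance : (sphMeasure n).IsOpenPosMeasure := by unfold sphMeasure; infer_instance

/-- The map of the sphere induced by a real linear isometry of `ℂⁿ`. -/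
def sphMap (e : Cn n ≃ₗᵢ[ℝ] Cn n) (x : Sph n) : Sph n :=
  ⟨e x.1, by rw [mem_sphere_zero_iff_norm, e.norm_map]; exact mem_sphere_zero_iff_norm.1 x.2⟩

theorem continuous_sphMap (e : Cn n ≃ₗᵢ[ℝ] Cn n) : Continuous (sphMap e) :=
  Continuous.subtype_mk (e.continuous.comp continuous_subtype_val) _

/-- The surface measure of a set is defined through the volume of the cone over it, and an isometry
carries cones to cones. -/
theorem measurePreserving_sphMap (e : Cn n ≃ₗᵢ[ℝ] Cn n) :
    MeasurePreserving (sphMap e) (sphMeasure n) (sphMeasure n) := by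
  refine ⟨(continuous_sphMap e).measurable, Measure.ext fun s hs => ?_⟩
  rw [Measure.map_apply (continuous_sphMap e).measurable hs, sphMeasure,
    Measure.toSphere_apply' _ hs,
    Measure.toSphere_apply' _ ((continuous_sphMap e).measurable hs)]
  congr 1
  have h : Ioo (0 : ℝ) 1 • ((↑) '' (sphMap e ⁻¹' s) : Set (Cn n)) =
      e ⁻¹' (Ioo (0 : ℝ) 1 • ((↑) '' s : Set (Cn n))) := by
    ext z
    simp only [Set.mem_smul, mem_preimage, mem_image]
    constructor
    · rintro ⟨r, hr, _, ⟨x, hx, rfl⟩, rfl⟩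
      exact ⟨r, hr, _, ⟨_, hx, rfl⟩, by simp [sphMap]⟩
    · rintro ⟨r, hr, _, ⟨x, hx, rfl⟩, hz⟩
      have hx' : sphMap e (sphMap e.symm x) = x := Subtype.ext (by simp [sphMap])
      refine ⟨r, hr, _, ⟨sphMap e.symm x, by simpa [hx'] using hx, rfl⟩, e.injective ?_⟩
      rw [← hz, map_smul]
      simp [sphMap]
  rw [h]
  exact e.measurePreserving.measure_preimage_equiv (f := e.toHomeomorph.toMeasurableEquiv) _

theorem integral_sphMap (e : Cn n ≃ₗᵢ[ℝ] Cn n) (f : Sph n → ℂ) :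
    ∫ x, f (sphMap e x) ∂(sphMeasure n) = ∫ x, f x ∂(sphMeasure n) := by
  have he : MeasurableEmbedding (sphMap e) := by
    let h : Sph n ≃ₜ Sph n :=
      { toFun := sphMap e
        invFun := sphMap e.symm
        left_inv := fun x => Subtype.ext (by simp [sphMap])
        right_inv := fun x => Subtype.ext (by simp [sphMap])
        continuous_toFun := continuous_sphMap e
        continuous_invFun := continuous_sphMap e.symm }
    exact h.measurableEmbedding
  exact (measurePreserving_sphMap e).integral_comp he f

/-- The derivative of |exp(sA)x|² is twice the inner product of exp(sA)x with A exp(sA)x, which is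
zero. -/
theorem norm_exp_smul_of_skew {A : Cn n →L[ℝ] Cn n} (hA : ∀ x, inner ℝ x (A x) = 0) (t : ℝ)
    (x : Cn n) : ‖NormedSpace.exp (t • A) x‖ = ‖x‖ := by
  have hd : ∀ s : ℝ, HasDerivAt (fun s : ℝ => NormedSpace.exp (s • A) x)
      (A (NormedSpace.exp (s • A) x)) s := fun s =>
    (hasDerivAt_exp_smul_const' A s).clm_apply (hasDerivAt_const s x) |>.congr_deriv (by simp)
  have hd2 : ∀ s : ℝ, HasDerivAt (fun s : ℝ => ‖NormedSpace.exp (s • A) x‖ ^ 2) 0 s := fun s => by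
    have := (hd s).norm_sq
    rwa [hA, mul_zero] at this
  have hc := is_const_of_deriv_eq_zero (fun s => (hd2 s).differentiableAt)
    (fun s => (hd2 s).deriv) t 0
  have h0 : NormedSpace.exp ((0 : ℝ) • A) x = x := by
    rw [show (0 : ℝ) • A = 0 from zero_smul ℝ A, NormedSpace.exp_zero, one_apply_eq_self]
  rw [h0] at hc
  exact (pow_left_inj₀ (norm_nonneg _) (norm_nonneg _) two_ne_zero).1 hc

/-- The flow of a skew-symmetric linear vector field. -/
def skewFlow {A : Cn n →L[ℝ] Cn n} (hA : ∀ x, inner ℝ x (A x) = 0) (t : ℝ) :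
    Cn n ≃ₗᵢ[ℝ] Cn n :=
  LinearIsometry.toLinearIsometryEquiv
    { toLinearMap := (NormedSpace.exp (t • A) : Cn n →L[ℝ] Cn n).toLinearMap
      norm_map' := norm_exp_smul_of_skew hA t } rfl

theorem sph_ne_zero (x : Sph n) : x.1 ≠ 0 := fun h => by
  have := mem_sphere_zero_iff_norm.1 x.2
  rw [h, norm_zero] at this
  exact zero_ne_one this

theorem sph_mem_compl (x : Sph n) : x.1 ∈ ({0}ᶜ : Set (Cn n)) := sph_ne_zero x

theorem continuous_fderiv_sph {W : Cn n → ℂ} (hW : ContDiffOn ℝ 1 W {0}ᶜ) :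
    Continuous fun x : Sph n => fderiv ℝ W x.1 := by
  have h : ContinuousOn (fderiv ℝ W) {0}ᶜ :=
    hW.continuousOn_fderiv_of_isOpen isOpen_compl_singleton le_rfl
  exact h.comp_continuous continuous_subtype_val sph_mem_compl

theorem hasFDerivAt_sph {W : Cn n → ℂ} (hW : ContDiffOn ℝ 1 W {0}ᶜ) (x : Sph n) :
    HasFDerivAt W (fderiv ℝ W x.1) x.1 :=
  ((hW.contDiffAt (isOpen_compl_singleton.mem_nhds (sph_mem_compl x))).differentiableAt
    one_ne_zero).hasFDerivAt

theorem integrable_sph {f : Sph n → ℂ} (hf : Continuous f) : Integrable f (sphMeasure n) :=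
  hf.integrable_of_hasCompactSupport (HasCompactSupport.of_compactSpace f)

/-- The integral over the sphere of the derivative along a skew-symmetric vector field is `0`. -/
theorem integral_fderiv_skew {W : Cn n → ℂ} (hW : ContDiffOn ℝ 1 W {0}ᶜ) {A : Cn n →L[ℝ] Cn n}
    (hA : ∀ x, inner ℝ x (A x) = 0) :
    ∫ x : Sph n, fderiv ℝ W x.1 (A x.1) ∂(sphMeasure n) = 0 := by
  set H : Sph n → ℂ := fun x => fderiv ℝ W x.1 (A x.1) with hH
  have hHc : Continuous H :=
    (continuous_fderiv_sph hW).clm_apply (A.continuous.comp continuous_subtype_val)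
  have hWc : Continuous fun x : Sph n => W x.1 :=
    hW.continuousOn.comp_continuous continuous_subtype_val sph_mem_compl
  obtain ⟨M, hM⟩ := isCompact_univ.exists_bound_of_continuousOn hHc.continuousOn
  -- The flow consists of isometries, so the integral of W along the flow is constant in t;
  -- differentiating under the integral at t = 0 gives the claim.
  have key := hasDerivAt_integral_of_dominated_loc_of_deriv_le (μ := sphMeasure n) (x₀ := (0 : ℝ))
    (s := univ) (bound := fun _ => M) (F := fun t x => W (sphMap (skewFlow hA t) x).1)
    (F' := fun t x => H (sphMap (skewFlow hA t) x)) univ_mem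
    (Eventually.of_forall fun t =>
      (hWc.comp (continuous_sphMap (skewFlow hA t))).aestronglyMeasurable)
    (integrable_sph (hWc.comp (continuous_sphMap (skewFlow hA 0))))
    (hHc.comp (continuous_sphMap (skewFlow hA 0))).aestronglyMeasurable
    (Eventually.of_forall fun x t _ => hM _ (mem_univ _))
    (integrable_const M)
    (Eventually.of_forall fun x t _ => by
      have hd : HasDerivAt (fun s : ℝ => NormedSpace.exp (s • A) x.1)
          (A (NormedSpace.exp (t • A) x.1)) t :=
        (hasDerivAt_exp_smul_const' A t).clm_apply (hasDerivAt_const t x.1)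
          |>.congr_deriv (by simp)
      exact (hasFDerivAt_sph hW (sphMap (skewFlow hA t) x)).comp_hasDerivAt t hd)
  have h1 := key.2
  simp only [integral_sphMap _ H] at h1
  have h2 : (fun t : ℝ => ∫ x, W (sphMap (skewFlow hA t) x).1 ∂(sphMeasure n)) =
      fun _ => ∫ x : Sph n, W x.1 ∂(sphMeasure n) := by
    ext t
    exact integral_sphMap _ fun x : Sph n => W x.1
  rw [h2] at h1
  exact h1.unique (hasDerivAt_const _ _)

/-- A unitary matrix as a real linear isometry of `ℂⁿ`. -/
def unIso (g : Un n) : Cn n ≃ₗᵢ[ℝ] Cn n :=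
  LinearIsometry.toLinearIsometryEquiv
    { toLinearMap := (Matrix.toEuclideanLin (g : Matrix (Fin n) (Fin n) ℂ)).restrictScalars ℝ
      norm_map' := norm_toEuclideanLin_unitary g } rfl

theorem unIso_apply (g : Un n) (z : Cn n) :
    unIso g z = Matrix.toEuclideanLin (g : Matrix (Fin n) (Fin n) ℂ) z := rfl

theorem smul_eq_sphMap (g : Un n) (x : Sph n) : g • x = sphMap (unIso g) x := rfl

section quotient

variable {G : Subgroup (Un n)}

theorem proj_eq_iff {x y : Sph n} : proj G x = proj G y ↔ ∃ g ∈ G, g • y = x := by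
  rw [proj, proj, Quotient.eq, MulAction.orbitRel_apply, MulAction.mem_orbit_iff]
  constructor
  · rintro ⟨g, hg⟩
    exact ⟨g.1, g.2, hg⟩
  · rintro ⟨g, hg, h⟩
    exact ⟨⟨g, hg⟩, h⟩

theorem proj_smul {g : Un n} (hg : g ∈ G) (x : Sph n) : proj G (g • x) = proj G x :=
  proj_eq_iff.2 ⟨g, hg, rfl⟩

theorem measurable_proj : Measurable (proj G) := measurable_quotient_mk''

theorem measurable_of_comp_proj {F : SphQuot G → ℂ} (hF : Measurable fun x => F (proj G x)) :
    Measurable F := measurable_from_quotient.2 hF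

/-- The translates of a sheet by the elements of G are disjoint, because the projection is injective
on the sheet and the action is free. They all have the same measure. -/
theorem measure_iUnion_sheet [Fintype G] (hG : ActsFreely G) {U : Set (Sph n)}
    (hU : MeasurableSet U) (hinj : InjOn (proj G) U) {s : Set (SphQuot G)} (hs : MeasurableSet s) :
    sphMeasure n (⋃ g : G, sphMap (unIso g.1) ⁻¹' (U ∩ proj G ⁻¹' s)) =
      Nat.card G * sphMeasure n (U ∩ proj G ⁻¹' s) := by
  have hm : MeasurableSet (U ∩ proj G ⁻¹' s) := hU.inter (measurable_proj hs)
  rw [measure_iUnion]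
  · have : ∀ g : G, sphMeasure n (sphMap (unIso g.1) ⁻¹' (U ∩ proj G ⁻¹' s)) =
        sphMeasure n (U ∩ proj G ⁻¹' s) := fun g =>
      (measurePreserving_sphMap _).measure_preimage hm.nullMeasurableSet
    rw [tsum_congr this]
    simp [tsum_fintype]
  · intro g h hgh
    refine Set.disjoint_left.2 fun x hx hx' => hgh ?_
    have h1 : g.1 • x = h.1 • x :=
      hinj hx.1 hx'.1 ((proj_smul g.2 x).trans (proj_smul h.2 x).symm)
    have h2 : (h.1⁻¹ * g.1) • x = x := by rw [mul_smul, h1, inv_smul_smul]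
    have h3 := hG _ (G.mul_mem (G.inv_mem h.2) g.2) x h2
    exact Subtype.ext (inv_mul_eq_one.1 h3).symm
  · exact fun g => (continuous_sphMap _).measurable hm

theorem card_mul_measure_sheet_le [Fintype G] (hG : ActsFreely G) {U : Set (Sph n)}
    (hU : MeasurableSet U) (hinj : InjOn (proj G) U) {s : Set (SphQuot G)} (hs : MeasurableSet s) :
    Nat.card G * sphMeasure n (U ∩ proj G ⁻¹' s) ≤ sphMeasure n (proj G ⁻¹' s) := by
  rw [← measure_iUnion_sheet hG hU hinj hs]
  refine measure_mono (iUnion_subset fun g x hx => ?_)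
  have : proj G (g.1 • x) ∈ s := hx.2
  rwa [proj_smul g.2] at this

theorem card_mul_measure_sheet_eq [Fintype G] (hG : ActsFreely G) {U : Set (Sph n)}
    (hU : MeasurableSet U) (hinj : InjOn (proj G) U) {s : Set (SphQuot G)} (hs : MeasurableSet s)
    (hsurj : ∀ x, ∃ g ∈ G, g • x ∈ U) :
    Nat.card G * sphMeasure n (U ∩ proj G ⁻¹' s) = sphMeasure n (proj G ⁻¹' s) := by
  refine le_antisymm (card_mul_measure_sheet_le hG hU hinj hs) ?_
  rw [← measure_iUnion_sheet hG hU hinj hs]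
  refine measure_mono fun x hx => ?_
  obtain ⟨g, hg, hgx⟩ := hsurj x
  refine mem_iUnion.2 ⟨⟨g, hg⟩, hgx, ?_⟩
  change proj G (g • x) ∈ s
  rwa [proj_smul hg]

/-- A finite group has a measurable set of representatives of its orbits. -/
theorem exists_transversal (G : Subgroup (Un n)) [Finite G] :
    ∃ U : Set (Sph n), MeasurableSet U ∧ InjOn (proj G) U ∧ ∀ x, ∃ g ∈ G, g • x ∈ U := by
  have he := measurableEmbedding_embeddingReal (Sph n)
  set f := embeddingReal (Sph n)
  -- An injective measurable real function `f` singles out one point in each finite orbit, namely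
  -- its minimizer.
  refine ⟨⋂ g : G, {x | f x ≤ f (sphMap (unIso g.1) x)}, MeasurableSet.iInter fun g => ?_, ?_, ?_⟩
  · exact measurableSet_le he.measurable
      (he.measurable.comp (continuous_sphMap (unIso g.1)).measurable)
  · intro x hx y hy hxy
    obtain ⟨g, hg, rfl⟩ := proj_eq_iff.1 hxy
    have h1 := mem_iInter.1 hy ⟨g, hg⟩
    have h2 := mem_iInter.1 hx ⟨g⁻¹, G.inv_mem hg⟩
    change f (g • y) ≤ f (g⁻¹ • g • y) at h2
    rw [inv_smul_smul] at h2
    exact he.injective (le_antisymm h2 h1)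
  · intro x
    obtain ⟨g, hg⟩ := Finite.exists_min fun g : G => f (g.1 • x)
    refine ⟨g.1, g.2, mem_iInter.2 fun h => ?_⟩
    have := hg (h * g)
    rwa [Subgroup.coe_mul, mul_smul] at this

/-- A sheet carries at most 1/|G| of the volume over any measurable set, and a transversal carries
exactly that much. Hence the supremum of measures is attained. -/
theorem quotMeasure_eq [Finite G] (hG : ActsFreely G) :
    quotMeasure G = (Nat.card G : ℝ≥0∞)⁻¹ • (sphMeasure n).map (proj G) := by
  have := Fintype.ofFinite G
  have hc0 : (Nat.card G : ℝ≥0∞) ≠ 0 := by exact_mod_cast Nat.card_pos.ne'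
  have hct : (Nat.card G : ℝ≥0∞) ≠ ⊤ := ENNReal.natCast_ne_top _
  have hap : ∀ {U : Set (Sph n)}, MeasurableSet U → ∀ {s : Set (SphQuot G)}, MeasurableSet s →
      ((sphMeasure n).restrict U).map (proj G) s = sphMeasure n (U ∩ proj G ⁻¹' s) := by
    intro U hU s hs
    rw [Measure.map_apply measurable_proj hs, Measure.restrict_apply (measurable_proj hs),
      inter_comm]
  refine le_antisymm (iSup₂_le fun U hU => Measure.le_iff.2 fun s hs => ?_) ?_
  · rw [hap hU.1 hs, Measure.smul_apply, Measure.map_apply measurable_proj hs, smul_eq_mul,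
      mul_comm, ← div_eq_mul_inv, ENNReal.le_div_iff_mul_le (Or.inl hc0) (Or.inl hct), mul_comm]
    exact card_mul_measure_sheet_le hG hU.1 hU.2 hs
  · obtain ⟨U, hU, hinj, hsurj⟩ := exists_transversal G
    refine le_trans (Measure.le_iff.2 fun s hs => ?_)
      (le_iSup₂ (f := fun U (_ : U ∈ {U : Set (Sph n) | MeasurableSet U ∧ InjOn (proj G) U}) =>
        ((sphMeasure n).restrict U).map (proj G)) U ⟨hU, hinj⟩)
    rw [hap hU hs, Measure.smul_apply, Measure.map_apply measurable_proj hs, smul_eq_mul,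
      ← card_mul_measure_sheet_eq hG hU hinj hs hsurj, ← mul_assoc,
      ENNReal.inv_mul_cancel hc0 hct, one_mul]

theorem integral_quot [Finite G] (hG : ActsFreely G) {F : SphQuot G → ℂ}
    (hF : Measurable fun x => F (proj G x)) :
    ∫ p, F p ∂(quotMeasure G) = (Nat.card G : ℂ)⁻¹ * ∫ x, F (proj G x) ∂(sphMeasure n) := by
  rw [quotMeasure_eq hG, integral_smul_measure,
    integral_map measurable_proj.aemeasurable (measurable_of_comp_proj hF).aestronglyMeasurable]
  simp

theorem quotVol_eq [Finite G] (hG : ActsFreely G) : quotVol G = sphVol n / Nat.card G := by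
  rw [quotVol, quotMeasure_eq hG, sphVol, measureReal_def, Measure.smul_apply,
    Measure.map_apply measurable_proj MeasurableSet.univ, preimage_univ, smul_eq_mul,
    ENNReal.toReal_mul, ENNReal.toReal_inv, ENNReal.toReal_natCast, measureReal_def]
  ring

theorem isFiniteMeasure_quotMeasure [Finite G] (hG : ActsFreely G) :
    IsFiniteMeasure (quotMeasure G) := by
  rw [quotMeasure_eq hG]
  have hc0 : (Nat.card G : ℝ≥0∞) ≠ 0 := by exact_mod_cast Nat.card_pos.ne'
  exact Measure.smul_finite _ (ENNReal.inv_ne_top.2 hc0)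

end quotient

end KohnWeyl
end

/-! ### Wirtinger calculus and the tangential Cauchy–Riemann form -/

noncomputable section
namespace KohnWeyl

open MeasureTheory MvPolynomial

variable {n : ℕ}

/-- The value of a polynomial in `z` and `z̄` at a point of `ℂⁿ`. -/
def ev (Q : Pol n) (z : Cn n) : ℂ := eval (Sum.elim (fun j => z j) (fun j => starRingEnd ℂ (z j))) Q

theorem ev_add (P Q : Pol n) (z : Cn n) : ev (P + Q) z = ev P z + ev Q z := by simp [ev]
theorem ev_sub (P Q : Pol n) (z : Cn n) : ev (P - Q) z = ev P z - ev Q z := by simp [ev]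
theorem ev_mul (P Q : Pol n) (z : Cn n) : ev (P * Q) z = ev P z * ev Q z := by simp [ev]
theorem ev_smul (c : ℂ) (Q : Pol n) (z : Cn n) : ev (c • Q) z = c * ev Q z := by simp [ev]
theorem ev_C_fun (c : ℂ) : ev (C c : Pol n) = fun _ => c := by
  funext z
  simp [ev]
theorem ev_add_fun (P Q : Pol n) : ev (P + Q) = fun z => ev P z + ev Q z := by
  funext z
  simp [ev]
theorem ev_mul_fun (P Q : Pol n) : ev (P * Q) = fun z => ev P z * ev Q z := by
  funext z
  simp [ev]
theorem ev_zero (z : Cn n) : ev 0 z = 0 := by simp [ev]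
theorem ev_X_inl (j : Fin n) (z : Cn n) : ev (X (Sum.inl j)) z = z j := by simp [ev]
theorem ev_X_inr (j : Fin n) (z : Cn n) : ev (X (Sum.inr j)) z = starRingEnd ℂ (z j) := by simp [ev]
theorem ev_X_inl_fun (j : Fin n) : ev (X (Sum.inl j)) = fun z : Cn n => z j := by
  funext z
  simp [ev]
theorem ev_X_inr_fun (j : Fin n) : ev (X (Sum.inr j)) = fun z : Cn n => starRingEnd ℂ (z j) := by
  funext z
  simp [ev]
theorem ev_sum {ι : Type*} (s : Finset ι) (P : ι → Pol n) (z : Cn n) :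
    ev (∑ i ∈ s, P i) z = ∑ i ∈ s, ev (P i) z := by simp [ev]

theorem contDiff_coord (j : Fin n) {k : WithTop ℕ∞} : ContDiff ℝ k fun z : Cn n => z j := by
  fun_prop

theorem contDiff_conj_coord (j : Fin n) {k : WithTop ℕ∞} :
    ContDiff ℝ k fun z : Cn n => starRingEnd ℂ (z j) :=
  Complex.conjCLE.contDiff.comp (contDiff_coord j)

theorem contDiff_ev (Q : Pol n) {k : WithTop ℕ∞} : ContDiff ℝ k (ev Q) := by
  induction Q using MvPolynomial.induction_on with
  | C a =>
    rw [ev_C_fun]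
    exact contDiff_const
  | add P Q hP hQ =>
    rw [ev_add_fun]
    exact ContDiff.add hP hQ
  | mul_X P i hP =>
    rw [ev_mul_fun]
    refine ContDiff.mul hP ?_
    cases i with
    | inl j =>
      rw [ev_X_inl_fun]
      exact contDiff_coord j
    | inr j =>
      rw [ev_X_inr_fun]
      exact contDiff_conj_coord j

theorem differentiableAt_ev (Q : Pol n) (z : Cn n) : DifferentiableAt ℝ (ev Q) z :=
  ((contDiff_ev Q (k := 1)).differentiable one_ne_zero) z

theorem fderiv_coord (j : Fin n) (z v : Cn n) : fderiv ℝ (fun z : Cn n => z j) z v = v j := by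
  have : HasFDerivAt (fun z : Cn n => z j) (PiLp.proj 2 (fun _ : Fin n => ℂ) j : Cn n →L[ℝ] ℂ)
      z := (PiLp.proj 2 (fun _ : Fin n => ℂ) j : Cn n →L[ℝ] ℂ).hasFDerivAt
  rw [this.fderiv]
  rfl

theorem fderiv_conj {F : Cn n → ℂ} {z : Cn n} (hF : DifferentiableAt ℝ F z) (v : Cn n) :
    fderiv ℝ (fun z => conj (F z)) z v = conj (fderiv ℝ F z v) := by
  have : HasFDerivAt (fun z => conj (F z)) (Complex.conjCLE.toContinuousLinearMap.comp
    (fderiv ℝ F z)) z := Complex.conjCLE.hasFDerivAt.comp z hF.hasFDerivAt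
  rw [this.fderiv]
  rfl

/-- The directional derivative of a polynomial in `z` and `z̄`. -/
def evDeriv (Q : Pol n) (z v : Cn n) : ℂ :=
  ∑ j, v j * ev (pderiv (Sum.inl j) Q) z + ∑ j, starRingEnd ℂ (v j) * ev (pderiv (Sum.inr j) Q) z

theorem evDeriv_add (P Q : Pol n) (z v : Cn n) :
    evDeriv (P + Q) z v = evDeriv P z v + evDeriv Q z v := by
  simp only [evDeriv, map_add, ev_add, mul_add, Finset.sum_add_distrib]
  ring

theorem evDeriv_mul (P Q : Pol n) (z v : Cn n) :
    evDeriv (P * Q) z v = ev P z * evDeriv Q z v + ev Q z * evDeriv P z v := by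
  have e : ∀ (c : Fin n → ℂ) (i : Fin n → Fin n ⊕ Fin n),
      ∑ j, c j * ev (pderiv (i j) (P * Q)) z = ev P z * ∑ j, c j * ev (pderiv (i j) Q) z +
        ev Q z * ∑ j, c j * ev (pderiv (i j) P) z := by
    intro c i
    rw [Finset.mul_sum, Finset.mul_sum, ← Finset.sum_add_distrib]
    refine Finset.sum_congr rfl fun j _ => ?_
    rw [pderiv_mul, ev_add, ev_mul, ev_mul]
    ring
  rw [evDeriv, e (fun j => v j) Sum.inl, e (fun j => starRingEnd ℂ (v j)) Sum.inr, evDeriv, evDeriv]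
  ring

theorem evDeriv_X_inl (k : Fin n) (z v : Cn n) : evDeriv (X (Sum.inl k)) z v = v k := by
  classical
  have h1 : ∀ j : Fin n, ev (pderiv (Sum.inl j) (X (Sum.inl k) : Pol n)) z =
      if j = k then 1 else 0 := fun j => by
    by_cases h : j = k
    · subst h; simp [ev]
    · rw [pderiv_X_of_ne (by simpa using Ne.symm h), if_neg h]; simp [ev]
  have h2 : ∀ j : Fin n, ev (pderiv (Sum.inr j) (X (Sum.inl k) : Pol n)) z = 0 := fun j => by
    rw [pderiv_X_of_ne (by simp)]; simp [ev]
  simp only [evDeriv, h1, h2]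
  simp

theorem evDeriv_X_inr (k : Fin n) (z v : Cn n) :
    evDeriv (X (Sum.inr k)) z v = starRingEnd ℂ (v k) := by
  classical
  have h1 : ∀ j : Fin n, ev (pderiv (Sum.inr j) (X (Sum.inr k) : Pol n)) z =
      if j = k then 1 else 0 := fun j => by
    by_cases h : j = k
    · subst h; simp [ev]
    · rw [pderiv_X_of_ne (by simpa using Ne.symm h), if_neg h]; simp [ev]
  have h2 : ∀ j : Fin n, ev (pderiv (Sum.inl j) (X (Sum.inr k) : Pol n)) z = 0 := fun j => by
    rw [pderiv_X_of_ne (by simp)]; simp [ev]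
  simp only [evDeriv, h1, h2]
  simp

theorem fderiv_ev_eq_evDeriv (Q : Pol n) (z v : Cn n) : fderiv ℝ (ev Q) z v = evDeriv Q z v := by
  induction Q using MvPolynomial.induction_on with
  | C a =>
    rw [ev_C_fun]
    simp [evDeriv, ev_zero]
  | add P Q hP hQ =>
    rw [ev_add_fun,
      fderiv_fun_add (differentiableAt_ev P z) (differentiableAt_ev Q z), evDeriv_add, ← hP, ← hQ]
    rfl
  | mul_X P i hP =>
    rw [ev_mul_fun,
      fderiv_fun_mul (differentiableAt_ev P z) (differentiableAt_ev _ z), evDeriv_mul, ← hP]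
    have h : fderiv ℝ (ev (X i : Pol n)) z v = evDeriv (X i) z v := by
      cases i with
      | inl k =>
        rw [ev_X_inl_fun, fderiv_coord, evDeriv_X_inl]
      | inr k =>
        rw [ev_X_inr_fun, fderiv_conj
          (F := fun z : Cn n => z k) ((contDiff_coord k (k := 1)).differentiable one_ne_zero z),
          fderiv_coord, evDeriv_X_inr]
    rw [← h]
    rfl

theorem fderiv_ev (Q : Pol n) (z v : Cn n) :
    fderiv ℝ (ev Q) z v = ∑ j, v j * ev (pderiv (Sum.inl j) Q) z +
      ∑ j, starRingEnd ℂ (v j) * ev (pderiv (Sum.inr j) Q) z := fderiv_ev_eq_evDeriv Q z v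

/-- The complex linear part of the real differential. -/
def del (F : Cn n → ℂ) (z v : Cn n) : ℂ :=
  (fderiv ℝ F z v - Complex.I * fderiv ℝ F z (Complex.I • v)) / 2

theorem dbar_ev (Q : Pol n) (z v : Cn n) :
    dbar (ev Q) z v = ∑ j, starRingEnd ℂ (v j) * ev (pderiv (Sum.inr j) Q) z := by
  rw [dbar, fderiv_ev, fderiv_ev]
  have h1 : ∀ j, (Complex.I • v) j = Complex.I * v j := fun j => rfl
  simp only [h1, map_mul, Complex.conj_I, mul_assoc, ← Finset.mul_sum]
  linear_combination ((∑ j, v j * ev (pderiv (Sum.inl j) Q) z) -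
    ∑ j, starRingEnd ℂ (v j) * ev (pderiv (Sum.inr j) Q) z) / 2 * Complex.I_mul_I

theorem del_ev (Q : Pol n) (z v : Cn n) :
    del (ev Q) z v = ∑ j, v j * ev (pderiv (Sum.inl j) Q) z := by
  rw [del, fderiv_ev, fderiv_ev]
  have h1 : ∀ j, (Complex.I • v) j = Complex.I * v j := fun j => rfl
  simp only [h1, map_mul, Complex.conj_I, mul_assoc, ← Finset.mul_sum]
  linear_combination (-(∑ j, v j * ev (pderiv (Sum.inl j) Q) z) +
    ∑ j, starRingEnd ℂ (v j) * ev (pderiv (Sum.inr j) Q) z) / 2 * Complex.I_mul_I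

theorem conj_dbar {F : Cn n → ℂ} {z : Cn n} (hF : DifferentiableAt ℝ F z) (v : Cn n) :
    conj (dbar F z v) = del (fun z => conj (F z)) z v := by
  rw [dbar, del, fderiv_conj hF, fderiv_conj hF]
  simp [sub_eq_add_neg, Complex.conj_ofNat]

theorem del_mul {E F : Cn n → ℂ} {z : Cn n} (hE : DifferentiableAt ℝ E z)
    (hF : DifferentiableAt ℝ F z) (v : Cn n) :
    del (fun z => E z * F z) z v = E z * del F z v + del E z v * F z := by
  rw [del, del, del, fderiv_fun_mul hE hF]
  simp only [add_apply, smul_apply, smul_eq_mul]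
  ring

theorem dbar_smul (F : Cn n → ℂ) (z : Cn n) (c : ℂ) (v : Cn n) :
    dbar F z (c • v) = conj c * dbar F z v := by
  have h1 : c • v = (c.re : ℝ) • v + (c.im : ℝ) • (Complex.I • v) := by
    ext j
    simp only [PiLp.smul_apply, PiLp.add_apply, smul_eq_mul, Complex.real_smul]
    linear_combination (-(v j)) * (Complex.re_add_im c)
  have h2 : Complex.I • c • v = (c.re : ℝ) • (Complex.I • v) - (c.im : ℝ) • v := by
    ext j
    simp only [PiLp.smul_apply, PiLp.sub_apply, smul_eq_mul, Complex.real_smul]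
    linear_combination (-(Complex.I * v j)) * (Complex.re_add_im c) +
      c.im * v j * Complex.I_mul_I
  have h3 : conj c = c.re - c.im * Complex.I := by
    apply Complex.ext <;> simp
  have h4 : fderiv ℝ F z (c • v) =
      c.re * fderiv ℝ F z v + c.im * fderiv ℝ F z (Complex.I • v) := by
    rw [h1, map_add, (fderiv ℝ F z).map_smul c.re v,
      (fderiv ℝ F z).map_smul c.im (Complex.I • v)]
    simp only [Complex.real_smul]
  have h5 : fderiv ℝ F z (Complex.I • c • v) =
      c.re * fderiv ℝ F z (Complex.I • v) - c.im * fderiv ℝ F z v := by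
    rw [h2, map_sub, (fderiv ℝ F z).map_smul c.im v,
      (fderiv ℝ F z).map_smul c.re (Complex.I • v)]
    simp only [Complex.real_smul]
  rw [dbar, dbar, h4, h5, h3]
  linear_combination (c.im : ℂ) * fderiv ℝ F z (Complex.I • v) / 2 * Complex.I_mul_I

theorem dbar_sub (F : Cn n → ℂ) (z v w : Cn n) : dbar F z (v - w) = dbar F z v - dbar F z w := by
  rw [dbar, dbar, dbar, smul_sub, map_sub, map_sub]
  ring

theorem dbar_sum {ι : Type*} (F : Cn n → ℂ) (z : Cn n) (s : Finset ι) (v : ι → Cn n) :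
    dbar F z (∑ i ∈ s, v i) = ∑ i ∈ s, dbar F z (v i) := by
  simp only [dbar, Finset.smul_sum, map_sum, Finset.mul_sum, ← Finset.sum_add_distrib,
    Finset.sum_div]

/-- The coefficient of `dz̄_k`. -/
def dbarCoeff (F : Cn n → ℂ) (z : Cn n) (k : Fin n) : ℂ := dbar F z (EuclideanSpace.single k 1)

theorem dbar_eq_sum (F : Cn n → ℂ) (z v : Cn n) :
    dbar F z v = ∑ k, conj (v k) * dbarCoeff F z k := by
  have h : v = ∑ k, v k • EuclideanSpace.single k (1 : ℂ) := by
    ext j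
    simp [Finset.sum_apply, Pi.single_apply]
  conv_lhs => rw [h]
  simp only [dbar_sum, dbar_smul, dbarCoeff]

theorem sum_mul_conj_sph (x : Sph n) : ∑ j, x.1 j * conj (x.1 j) = 1 := by
  have h : ‖x.1‖ ^ 2 = 1 := by rw [mem_sphere_zero_iff_norm.1 x.2, one_pow]
  rw [EuclideanSpace.norm_sq_eq] at h
  simp only [Complex.mul_conj, Complex.normSq_eq_norm_sq]
  exact_mod_cast h

/-- The projected frame drops the component of the form along the complex normal x; |x| = 1
collapses the cross terms. -/
theorem formInner_eq (u w : Sph n → ℂ) (x : Sph n) :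
    formInner u w x = 2 * (∑ j, dbarCoeff (radialExt u) x.1 j * conj (dbarCoeff (radialExt w) x.1 j)
      - dbar (radialExt u) x.1 x.1 * conj (dbar (radialExt w) x.1 x.1)) := by
  have h1 : ∀ (u : Sph n → ℂ) (j : Fin n), dbarb u x j =
      dbarCoeff (radialExt u) x.1 j - x.1 j * dbar (radialExt u) x.1 x.1 := fun u j => by
    rw [dbarb, tangentFrame, dbar_sub, dbar_smul, Complex.conj_conj]
    rfl
  rw [formInner]
  simp only [h1, map_sub, map_mul]
  congr 1
  set A := dbar (radialExt u) x.1 x.1 with hA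
  set B := dbar (radialExt w) x.1 x.1 with hB
  have hA' : A = ∑ k, conj (x.1 k) * dbarCoeff (radialExt u) x.1 k := dbar_eq_sum _ _ _
  have hB' : conj B = ∑ k, x.1 k * conj (dbarCoeff (radialExt w) x.1 k) := by
    rw [hB, dbar_eq_sum, map_sum]
    simp
  have e : ∀ j, (dbarCoeff (radialExt u) x.1 j - x.1 j * A) *
      (conj (dbarCoeff (radialExt w) x.1 j) - conj (x.1 j) * conj B) =
      dbarCoeff (radialExt u) x.1 j * conj (dbarCoeff (radialExt w) x.1 j) -
        conj (x.1 j) * dbarCoeff (radialExt u) x.1 j * conj B -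
        A * (x.1 j * conj (dbarCoeff (radialExt w) x.1 j)) +
        x.1 j * conj (x.1 j) * (A * conj B) := fun j => by ring
  simp only [e, Finset.sum_add_distrib, Finset.sum_sub_distrib, ← Finset.mul_sum, ← Finset.sum_mul,
    sum_mul_conj_sph, ← hA', ← hB']
  ring

/-- The vector field `z̄_j e_k - z̄_k e_j`. -/
def rotField (j k : Fin n) : Cn n →L[ℝ] Cn n :=
  LinearMap.toContinuousLinearMap
    { toFun := fun z => conj (z j) • EuclideanSpace.single k (1 : ℂ) -
        conj (z k) • EuclideanSpace.single j (1 : ℂ)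
      map_add' := fun z w => by
        simp only [PiLp.add_apply, map_add, add_smul]
        abel
      map_smul' := fun c z => by
        simp only [PiLp.smul_apply, Complex.real_smul, map_mul, Complex.conj_ofReal, mul_smul,
          smul_sub, RingHom.id_apply]
        rfl }

theorem rotField_apply (j k : Fin n) (z : Cn n) :
    rotField j k z = conj (z j) • EuclideanSpace.single k (1 : ℂ) -
        conj (z k) • EuclideanSpace.single j (1 : ℂ) := rfl

theorem inner_single_right (z : Cn n) (j : Fin n) (c : ℂ) :
    inner ℝ z (c • EuclideanSpace.single j (1 : ℂ)) = (conj (z j) * c).re := by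
  simp [PiLp.inner_apply, Complex.inner, apply_ite, mul_comm]

theorem inner_rotField (j k : Fin n) (z : Cn n) : inner ℝ z (rotField j k z) = 0 := by
  rw [rotField_apply, inner_sub_right, inner_single_right, inner_single_right, mul_comm, sub_self]

theorem inner_I_smul_rotField (j k : Fin n) (z : Cn n) :
    inner ℝ z (Complex.I • rotField j k z) = 0 := by
  rw [rotField_apply, smul_sub, smul_smul, smul_smul, inner_sub_right, inner_single_right,
    inner_single_right, sub_eq_zero]
  congr 1
  ring

theorem dbar_rotField (F : Cn n → ℂ) (z : Cn n) (j k : Fin n) :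
    dbar F z (rotField j k z) = z j * dbarCoeff F z k - z k * dbarCoeff F z j := by
  rw [rotField_apply, dbar_sub, dbar_smul, dbar_smul, Complex.conj_conj, Complex.conj_conj]
  rfl

/-- Lagrange's identity, with the factor 2 in `formInner` absorbed by summing over ordered pairs (j,
k). It replaces the projected frame, which depends quadratically on x, by real-linear skew-symmetric
fields, along which integration by parts is rotation invariance. -/
theorem formInner_eq_sum (u w : Sph n → ℂ) (x : Sph n) :
    formInner u w x = ∑ j, ∑ k, dbar (radialExt u) x.1 (rotField j k x.1) *
      conj (dbar (radialExt w) x.1 (rotField j k x.1)) := by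
  rw [formInner_eq]
  set a := dbarCoeff (radialExt u) x.1
  set b := dbarCoeff (radialExt w) x.1
  have hA : dbar (radialExt u) x.1 x.1 = ∑ k, conj (x.1 k) * a k := dbar_eq_sum _ _ _
  have hB : conj (dbar (radialExt w) x.1 x.1) = ∑ k, x.1 k * conj (b k) := by
    rw [dbar_eq_sum, map_sum]
    simp [b]
  have e : ∀ j k, (x.1 j * a k - x.1 k * a j) * (conj (x.1 j) * conj (b k) -
      conj (x.1 k) * conj (b j)) = (x.1 j * conj (x.1 j)) * (a k * conj (b k)) +
      (a j * conj (b j)) * (x.1 k * conj (x.1 k)) -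
      (x.1 j * conj (b j)) * (conj (x.1 k) * a k) -
      (conj (x.1 j) * a j) * (x.1 k * conj (b k)) := fun j k => by ring
  simp only [dbar_rotField, map_sub, map_mul]
  simp only [show ∀ j, dbarCoeff (radialExt u) x.1 j = a j from fun _ => rfl,
    show ∀ j, dbarCoeff (radialExt w) x.1 j = b j from fun _ => rfl, e, Finset.sum_add_distrib,
    Finset.sum_sub_distrib, ← Finset.mul_sum, ← Finset.sum_mul, sum_mul_conj_sph, ← hA, ← hB]
  ring

end KohnWeyl
end

/-! ### Integration by parts and the eigenvalues on harmonic polynomials -/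

noncomputable section
namespace KohnWeyl

open MeasureTheory MvPolynomial Filter Topology

variable {n : ℕ}

theorem radialExt_sph (u : Sph n → ℂ) (x : Sph n) : radialExt u x.1 = u x := by
  rw [radialExt, dif_neg (sph_ne_zero x)]
  congr 1
  ext1
  simp [mem_sphere_zero_iff_norm.1 x.2]

theorem radialExt_eq_of_ne_zero {F : Cn n → ℂ} {z : Cn n} (hz : z ≠ 0) :
    radialExt (fun x : Sph n => F x.1) z = F ((‖z‖⁻¹ : ℝ) • z) := by
  rw [radialExt, dif_neg hz]

theorem smoothSph_of_contDiff {F : Cn n → ℂ} (hF : ContDiff ℝ ∞ F) :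
    SmoothSph fun x : Sph n => F x.1 := by
  have h : ContDiffOn ℝ ∞ (fun z : Cn n => F ((‖z‖⁻¹ : ℝ) • z)) {0}ᶜ := by
    refine hF.comp_contDiffOn fun z hz => ContDiffAt.contDiffWithinAt ?_
    have hz' : z ≠ 0 := hz
    exact ((contDiffAt_norm ℝ hz').inv (norm_ne_zero_iff.2 hz')).smul contDiffAt_id
  exact h.congr fun z hz => radialExt_eq_of_ne_zero hz

theorem SmoothSph.contDiffOn_one {u : Sph n → ℂ} (hu : SmoothSph u) :
    ContDiffOn ℝ 1 (radialExt u) {0}ᶜ :=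
  ContDiffOn.of_le hu (by exact_mod_cast le_top)

theorem SmoothSph.continuous {u : Sph n → ℂ} (hu : SmoothSph u) : Continuous u := by
  have h : Continuous fun x : Sph n => radialExt u x.1 :=
    (ContDiffOn.continuousOn hu).comp_continuous continuous_subtype_val sph_mem_compl
  exact h.congr fun x => radialExt_sph u x

theorem SmoothSph.differentiableAt {u : Sph n → ℂ} (hu : SmoothSph u) (x : Sph n) :
    DifferentiableAt ℝ (radialExt u) x.1 :=
  (hasFDerivAt_sph hu.contDiffOn_one x).differentiableAt

/-- Along tangential directions the derivative of the radial extension is that of any other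
extension. -/
theorem fderiv_radialExt {F : Cn n → ℂ} (hF : ContDiff ℝ ∞ F) (x : Sph n) {v : Cn n}
    (hv : inner ℝ x.1 v = 0) :
    fderiv ℝ (radialExt fun x : Sph n => F x.1) x.1 v = fderiv ℝ F x.1 v := by
  have hx : ‖x.1‖ = 1 := mem_sphere_zero_iff_norm.1 x.2
  have hl : HasDerivAt (fun t : ℝ => x.1 + t • v) v 0 := by
    have := ((hasDerivAt_id (0 : ℝ)).smul_const v).const_add x.1
    simpa using this
  have hl0 : x.1 + (0 : ℝ) • v = x.1 := by rw [zero_smul, add_zero]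
  -- For tangential v the norm is stationary along x + tv, so the normalization does not change the
  -- velocity of the curve at t = 0.
  have hn : HasDerivAt (fun t : ℝ => ‖x.1 + t • v‖) 0 0 := by
    have h1 := hl.norm_sq
    rw [hl0, hv, mul_zero] at h1
    have h2 := h1.sqrt (by rw [hl0, hx]; norm_num)
    rw [zero_div] at h2
    refine h2.congr_of_eventuallyEq (Eventually.of_forall fun t => ?_)
    exact (Real.sqrt_sq (norm_nonneg _)).symm
  have hc : HasDerivAt (fun t : ℝ => (‖x.1 + t • v‖⁻¹ : ℝ) • (x.1 + t • v)) v 0 := by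
    have h := (hn.fun_inv (by rw [hl0, hx]; norm_num)).smul hl
    refine h.congr_deriv ?_
    rw [hl0, hx]
    simp
  have hF' : HasFDerivAt F (fderiv ℝ F x.1)
      ((‖x.1 + (0 : ℝ) • v‖⁻¹ : ℝ) • (x.1 + (0 : ℝ) • v)) := by
    rw [hl0, hx, inv_one, one_smul]
    exact ((hF.differentiable (by simp)) x.1).hasFDerivAt
  have h1 := hF'.comp_hasDerivAt (0 : ℝ) hc
  have hR : HasFDerivAt (radialExt fun x : Sph n => F x.1)
      (fderiv ℝ (radialExt fun x : Sph n => F x.1) x.1) (x.1 + (0 : ℝ) • v) := by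
    rw [hl0]
    exact ((smoothSph_of_contDiff hF).differentiableAt x).hasFDerivAt
  have h2 := hR.comp_hasDerivAt (0 : ℝ) hl
  refine h2.unique (h1.congr_of_eventuallyEq ?_)
  have hne : ∀ᶠ t : ℝ in 𝓝 0, x.1 + t • v ≠ 0 := by
    refine hl.continuousAt.eventually_ne ?_
    rw [hl0]
    exact sph_ne_zero x
  filter_upwards [hne] with t ht
  exact radialExt_eq_of_ne_zero ht

theorem dbar_radialExt_rotField {F : Cn n → ℂ} (hF : ContDiff ℝ ∞ F) (x : Sph n) (j k : Fin n) :
    dbar (radialExt fun x : Sph n => F x.1) x.1 (rotField j k x.1) =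
      dbar F x.1 (rotField j k x.1) := by
  rw [dbar, dbar, fderiv_radialExt hF x (inner_rotField j k x.1),
    fderiv_radialExt hF x (inner_I_smul_rotField j k x.1)]

theorem continuous_del_rotField {W : Cn n → ℂ} (hW : ContDiffOn ℝ 1 W {0}ᶜ) (j k : Fin n) :
    Continuous fun x : Sph n => del W x.1 (rotField j k x.1) := by
  have h1 := continuous_fderiv_sph hW
  have h2 : Continuous fun x : Sph n => rotField j k x.1 :=
    (rotField j k).continuous.comp continuous_subtype_val
  have h3 : Continuous fun x : Sph n => Complex.I • rotField j k x.1 :=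
    (continuous_const_smul Complex.I).comp h2
  exact ((h1.clm_apply h2).sub (continuous_const.mul (h1.clm_apply h3))).div_const _

/-- Both the field and its multiple by i are skew-symmetric, so both real derivatives that make up
`del` integrate to zero. -/
theorem integral_del_rotField {W : Cn n → ℂ} (hW : ContDiffOn ℝ 1 W {0}ᶜ) (j k : Fin n) :
    ∫ x : Sph n, del W x.1 (rotField j k x.1) ∂(sphMeasure n) = 0 := by
  let B : Cn n →L[ℝ] Cn n :=
    ((Complex.I • ContinuousLinearMap.id ℂ (Cn n)).restrictScalars ℝ).comp (rotField j k)
  have hB : ∀ x, B x = Complex.I • rotField j k x := fun x => rfl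
  have h1 := integral_fderiv_skew hW (inner_rotField j k)
  have h2 := integral_fderiv_skew hW (A := B)
    (fun x => by rw [hB]; exact inner_I_smul_rotField j k x)
  have hc := continuous_fderiv_sph hW
  have i1 : Integrable (fun x : Sph n => fderiv ℝ W x.1 (rotField j k x.1)) (sphMeasure n) :=
    integrable_sph (hc.clm_apply ((rotField j k).continuous.comp continuous_subtype_val))
  have i2 : Integrable (fun x : Sph n => fderiv ℝ W x.1 (B x.1)) (sphMeasure n) :=
    integrable_sph (hc.clm_apply (B.continuous.comp continuous_subtype_val))
  have e : ∀ x : Sph n, del W x.1 (rotField j k x.1) =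
      (fderiv ℝ W x.1 (rotField j k x.1) - Complex.I * fderiv ℝ W x.1 (B x.1)) / 2 := fun x => rfl
  simp only [e]
  rw [integral_div, integral_sub i1 (i2.const_mul _), integral_const_mul, h1, h2]
  simp

/-- The polynomial `z_j ∂Q/∂z̄_k - z_k ∂Q/∂z̄_j`. -/
def rotBar (j k : Fin n) (Q : Pol n) : Pol n :=
  X (Sum.inl j) * pderiv (Sum.inr k) Q - X (Sum.inl k) * pderiv (Sum.inr j) Q

/-- The polynomial `z̄_j ∂Q/∂z_k - z̄_k ∂Q/∂z_j`. -/
def rot (j k : Fin n) (Q : Pol n) : Pol n :=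
  X (Sum.inr j) * pderiv (Sum.inl k) Q - X (Sum.inr k) * pderiv (Sum.inl j) Q

theorem rotField_coord (j k i : Fin n) (z : Cn n) :
    rotField j k z i = (if i = k then starRingEnd ℂ (z j) else 0) -
      if i = j then starRingEnd ℂ (z k) else 0 := by
  rw [rotField_apply]
  simp

theorem dbar_ev_rotField (Q : Pol n) (z : Cn n) (j k : Fin n) :
    dbar (ev Q) z (rotField j k z) = ev (rotBar j k Q) z := by
  rw [dbar_ev, rotBar, ev_sub, ev_mul, ev_mul, ev_X_inl, ev_X_inl]
  simp only [rotField_coord, map_sub, sub_mul, Finset.sum_sub_distrib, apply_ite (starRingEnd ℂ),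
    Complex.conj_conj, map_zero, ite_mul, zero_mul, Finset.sum_ite_eq', Finset.mem_univ, if_true]

theorem del_ev_rotField (Q : Pol n) (z : Cn n) (j k : Fin n) :
    del (ev Q) z (rotField j k z) = ev (rot j k Q) z := by
  rw [del_ev, rot, ev_sub, ev_mul, ev_mul, ev_X_inr, ev_X_inr]
  simp only [rotField_coord, sub_mul, Finset.sum_sub_distrib,
    ite_mul, zero_mul, Finset.sum_ite_eq', Finset.mem_univ, if_true]

theorem sum_sum_add_swap {M : Type*} [AddCommMonoid M] (f : Fin n → Fin n → M) :
    ∑ j, ∑ k, (f j k + f k j) = (∑ j, ∑ k, f j k) + ∑ j, ∑ k, f j k := by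
  simp only [Finset.sum_add_distrib]
  rw [Finset.sum_comm (f := fun j k => f k j)]

/-- `rotBar` is antisymmetric in (j, k); hence each term splits into an expression plus its
transpose, and the double sum needs only one of them. -/
theorem rot_rotBar (Q : Pol n) (j k : Fin n) : rot j k (rotBar j k Q) =
    X (Sum.inr j) * pderiv (Sum.inl k) (rotBar j k Q) +
      X (Sum.inr k) * pderiv (Sum.inl j) (rotBar k j Q) := by
  have : rotBar k j Q = - rotBar j k Q := by rw [rotBar, rotBar]; ring
  rw [this, map_neg, rot]
  ring

theorem pderiv_inl_rotBar (Q : Pol n) (j k : Fin n) : pderiv (Sum.inl k) (rotBar j k Q) =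
    (if j = k then pderiv (Sum.inr k) Q else 0) +
      X (Sum.inl j) * pderiv (Sum.inl k) (pderiv (Sum.inr k) Q) - pderiv (Sum.inr j) Q -
      X (Sum.inl k) * pderiv (Sum.inl k) (pderiv (Sum.inr j) Q) := by
  rw [rotBar, map_sub, pderiv_mul, pderiv_mul, pderiv_X_self]
  by_cases h : j = k
  · subst h
    rw [pderiv_X_self, if_pos rfl]
    ring
  · rw [pderiv_X_of_ne (by simpa using h), if_neg h]
    ring

theorem sum_pderiv_inl_rotBar {p q : ℕ} {Q : Pol n} (hQ : Q ∈ Bi n p q) (j : Fin n) :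
    ∑ k, pderiv (Sum.inl k) (rotBar j k Q) =
      pderiv (Sum.inr j) Q + X (Sum.inl j) * lap n Q - (n : ℂ) • pderiv (Sum.inr j) Q -
        (p : ℂ) • pderiv (Sum.inr j) Q := by
  have h3 : ∑ k, X (Sum.inl k) * pderiv (Sum.inl k) (pderiv (Sum.inr j) Q) =
      (p : ℂ) • pderiv (Sum.inr j) Q := by
    cases q with
    | zero => rw [pderiv_inr_eq_zero hQ]; simp
    | succ q => exact euler_left (pderiv_inr_mem hQ j)
  have h4 : ∑ _k : Fin n, pderiv (Sum.inr j) Q = (n : ℂ) • pderiv (Sum.inr j) Q := by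
    rw [Finset.sum_const, Finset.card_univ, Fintype.card_fin, Nat.cast_smul_eq_nsmul]
  simp only [pderiv_inl_rotBar]
  rw [Finset.sum_sub_distrib, Finset.sum_sub_distrib, Finset.sum_add_distrib, h3, h4,
    ← Finset.mul_sum, ← lap_apply]
  simp only [Finset.sum_ite_eq, Finset.mem_univ, if_true]

/-- This is the source of the eigenvalue. The Euler identity in z̄ gives q, the one in z applied to
∂Q/∂z̄_j gives p, and the remaining terms give n − 1. The Laplacian term drops for harmonic Q. -/
theorem sum_rot_rotBar {p q : ℕ} {Q : Pol n} (hQ : Q ∈ Bi n p q) :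
    ∑ j, ∑ k, rot j k (rotBar j k Q) =
      (2 : ℂ) • (rad n * lap n Q) - (2 * (q : ℂ) * (p + n - 1)) • Q := by
  have h5 : ∑ j, X (Sum.inr j) * (pderiv (Sum.inr j) Q + X (Sum.inl j) * lap n Q -
      (n : ℂ) • pderiv (Sum.inr j) Q - (p : ℂ) • pderiv (Sum.inr j) Q) =
      (1 - (n : ℂ) - p) • ((q : ℂ) • Q) + rad n * lap n Q := by
    rw [← euler_right hQ, rad, Finset.smul_sum, Finset.sum_mul, ← Finset.sum_add_distrib]
    refine Finset.sum_congr rfl fun j _ => ?_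
    simp only [smul_eq_C_mul, map_sub, map_one]
    ring
  have h6 : ∑ j, ∑ k, X (Sum.inr j) * pderiv (Sum.inl k) (rotBar j k Q) =
      (1 - (n : ℂ) - p) • ((q : ℂ) • Q) + rad n * lap n Q := by
    rw [← h5]
    refine Finset.sum_congr rfl fun j _ => ?_
    rw [← Finset.mul_sum, sum_pderiv_inl_rotBar hQ]
  simp only [rot_rotBar]
  rw [sum_sum_add_swap fun j k => X (Sum.inr j) * pderiv (Sum.inl k) (rotBar j k Q), h6, smul_smul]
  module

theorem ev_rad (x : Sph n) : ev (rad n) x.1 = 1 := by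
  rw [rad, ev_sum]
  simp only [ev_mul, ev_X_inl, ev_X_inr]
  exact sum_mul_conj_sph x

theorem contDiffOn_conj {W : Cn n → ℂ} {k : WithTop ℕ∞} (hW : ContDiffOn ℝ k W {0}ᶜ) :
    ContDiffOn ℝ k (fun z => conj (W z)) {0}ᶜ :=
  Complex.conjCLE.contDiff.comp_contDiffOn hW

/-- Integration by parts on the sphere. -/
theorem integral_formInner_ev {p q : ℕ} {Q : Pol n} (hQ : Q ∈ Bi n p q) (hlap : lap n Q = 0)
    {w : Sph n → ℂ} (hw : SmoothSph w) :
    ∫ x, formInner (fun x : Sph n => ev Q x.1) w x ∂(sphMeasure n) =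
      (2 * (q : ℂ) * (p + n - 1)) * ∫ x : Sph n, ev Q x.1 * conj (w x) ∂(sphMeasure n) := by
  set W' : Cn n → ℂ := fun z => conj (radialExt w z) with hW'
  have hW1 : ContDiffOn ℝ 1 W' {0}ᶜ := contDiffOn_conj hw.contDiffOn_one
  have hWd : ∀ x : Sph n, DifferentiableAt ℝ W' x.1 := fun x =>
    (hasFDerivAt_sph hW1 x).differentiableAt
  have hWx : ∀ x : Sph n, W' x.1 = conj (w x) := fun x => by rw [hW']; simp only [radialExt_sph]
  have hWc : Continuous fun x : Sph n => W' x.1 :=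
    hW1.continuousOn.comp_continuous continuous_subtype_val sph_mem_compl
  have hec : ∀ P : Pol n, Continuous fun x : Sph n => ev P x.1 := fun P =>
    (contDiff_ev P (k := 1)).continuous.comp continuous_subtype_val
  have hVW : ∀ P : Pol n, ContDiffOn ℝ 1 (fun z => ev P z * W' z) {0}ᶜ := fun P =>
    (contDiff_ev P).contDiffOn.mul hW1
  -- Conjugation turns ∂̄w into ∂w̄; the product rule then moves the derivative onto the polynomial,
  -- up to a derivative along the field whose integral is zero.
  have h1 : ∀ x : Sph n, formInner (fun x : Sph n => ev Q x.1) w x =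
      ∑ j, ∑ k, (del (fun z => ev (rotBar j k Q) z * W' z) x.1 (rotField j k x.1) -
        ev (rot j k (rotBar j k Q)) x.1 * W' x.1) := by
    intro x
    rw [formInner_eq_sum]
    refine Finset.sum_congr rfl fun j _ => Finset.sum_congr rfl fun k _ => ?_
    rw [dbar_radialExt_rotField (contDiff_ev Q), dbar_ev_rotField,
      conj_dbar (hw.differentiableAt x), del_mul (differentiableAt_ev _ _) (hWd x),
      del_ev_rotField, add_sub_cancel_right]
  have i1 : ∀ j k, Integrable (fun x : Sph n =>
      del (fun z => ev (rotBar j k Q) z * W' z) x.1 (rotField j k x.1)) (sphMeasure n) :=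
    fun j k => integrable_sph (continuous_del_rotField (hVW _) j k)
  have i2 : ∀ P : Pol n, Integrable (fun x : Sph n => ev P x.1 * W' x.1) (sphMeasure n) :=
    fun P => integrable_sph ((hec P).mul hWc)
  have i3 : ∀ j k, Integrable (fun x : Sph n =>
      del (fun z => ev (rotBar j k Q) z * W' z) x.1 (rotField j k x.1) -
        ev (rot j k (rotBar j k Q)) x.1 * W' x.1) (sphMeasure n) :=
    fun j k => (i1 j k).sub (i2 _)
  simp only [h1]
  rw [integral_finsetSum _ fun j _ => integrable_finsetSum _ fun k _ => i3 j k]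
  have h2 : ∀ j, ∫ x : Sph n, ∑ k, (del (fun z => ev (rotBar j k Q) z * W' z) x.1
      (rotField j k x.1) - ev (rot j k (rotBar j k Q)) x.1 * W' x.1) ∂(sphMeasure n) =
      ∑ k, -∫ x : Sph n, ev (rot j k (rotBar j k Q)) x.1 * W' x.1 ∂(sphMeasure n) := by
    intro j
    rw [integral_finsetSum _ fun k _ => i3 j k]
    refine Finset.sum_congr rfl fun k _ => ?_
    rw [integral_sub (i1 j k) (i2 _), integral_del_rotField (hVW _), zero_sub]
  simp only [h2]
  have h3 : ∑ j, ∑ k, -∫ x : Sph n, ev (rot j k (rotBar j k Q)) x.1 * W' x.1 ∂(sphMeasure n) =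
      -∫ x : Sph n, ev (∑ j, ∑ k, rot j k (rotBar j k Q)) x.1 * W' x.1 ∂(sphMeasure n) := by
    simp only [ev_sum, Finset.sum_mul, Finset.sum_neg_distrib]
    rw [integral_finsetSum _ fun j _ => integrable_finsetSum _ fun k _ => i2 _]
    congr 1
    exact Finset.sum_congr rfl fun j _ => (integral_finsetSum _ fun k _ => i2 _).symm
  rw [h3, sum_rot_rotBar hQ, hlap, mul_zero, smul_zero, zero_sub, ← integral_const_mul,
    ← integral_neg]
  refine integral_congr_ae (Eventually.of_forall fun x => ?_)
  simp only [← hWx]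
  rw [← neg_smul, ev_smul]
  ring

section invariance

theorem radialExt_smul {u : Sph n → ℂ} {g : Un n} (hu : ∀ x : Sph n, u (g • x) = u x) (z : Cn n) :
    radialExt u (unIso g z) = radialExt u z := by
  by_cases hz : z = 0
  · subst hz; simp
  · have hz' : unIso g z ≠ 0 := by
      rw [← norm_ne_zero_iff, (unIso g).norm_map]
      exact norm_ne_zero_iff.2 hz
    rw [radialExt, radialExt, dif_neg hz, dif_neg hz']
    refine Eq.trans ?_ (hu _)
    congr 1
    ext1
    change (‖unIso g z‖⁻¹ : ℝ) • unIso g z = unIso g ((‖z‖⁻¹ : ℝ) • z)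
    rw [map_smul, (unIso g).norm_map]

theorem dbar_smul_point {u : Sph n → ℂ} {g : Un n} (hu : ∀ x : Sph n, u (g • x) = u x)
    (z v : Cn n) : dbar (radialExt u) (unIso g z) (unIso g v) = dbar (radialExt u) z v := by
  have hcomp : radialExt u ∘ unIso g = radialExt u := funext fun z => radialExt_smul hu z
  have h1 : ∀ v, fderiv ℝ (radialExt u) z v = fderiv ℝ (radialExt u) (unIso g z) (unIso g v) := by
    intro v
    have := (unIso g).toContinuousLinearEquiv.comp_right_fderiv (f := radialExt u) (x := z)
    have e : radialExt u ∘ (unIso g).toContinuousLinearEquiv = radialExt u := hcomp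
    rw [e] at this
    rw [this]
    rfl
  have hI : unIso g (Complex.I • v) = Complex.I • unIso g v := by
    rw [unIso_apply, unIso_apply, map_smul]
  rw [dbar, dbar, h1, h1, hI]

theorem unIso_unIso_inv (g : Un n) (z : Cn n) : unIso g (unIso g⁻¹ z) = z := by
  have hg : (g.1 : Matrix (Fin n) (Fin n) ℂ) * (g⁻¹ : Un n).1 = 1 :=
    congrArg Subtype.val (mul_inv_cancel g)
  rw [unIso_apply, unIso_apply]
  ext i
  rw [Matrix.toLpLin_apply, Matrix.toLpLin_apply, Matrix.mulVec_mulVec, hg, Matrix.one_mulVec]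

theorem dbarCoeff_smul {u : Sph n → ℂ} {g : Un n} (hu : ∀ x : Sph n, u (g • x) = u x)
    (z : Cn n) (j : Fin n) :
    dbarCoeff (radialExt u) (unIso g z) j = ∑ k, g.1 j k * dbarCoeff (radialExt u) z k := by
  rw [dbarCoeff, ← unIso_unIso_inv g (EuclideanSpace.single j (1 : ℂ)), dbar_smul_point hu,
    dbar_eq_sum]
  refine Finset.sum_congr rfl fun k _ => ?_
  congr 1
  rw [unIso_apply]
  have : (g⁻¹ : Un n).1 = star g.1 := rfl
  simp [Matrix.toLpLin_apply, this]

/-- Needed because `dbarInner` evaluates at an arbitrary representative of the orbit. The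
coefficients of the form transform by the unitary matrix g, and the normal component is unchanged.
-/
theorem formInner_smul {u w : Sph n → ℂ} {g : Un n} (hu : ∀ x : Sph n, u (g • x) = u x)
    (hw : ∀ x : Sph n, w (g • x) = w x) (x : Sph n) :
    formInner u w (g • x) = formInner u w x := by
  have hx : (g • x : Sph n).1 = unIso g x.1 := rfl
  rw [formInner_eq, formInner_eq, hx, dbar_smul_point hu, dbar_smul_point hw]
  congr 2
  simp only [dbarCoeff_smul hu, dbarCoeff_smul hw, map_sum, map_mul, Finset.sum_mul_sum]
  set a := dbarCoeff (radialExt u) x.1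
  set b := dbarCoeff (radialExt w) x.1
  have hg : ∀ k l, ∑ j, g.1 j k * conj (g.1 j l) = if l = k then 1 else 0 := fun k l => by
    have := congrFun (congrFun (Matrix.mem_unitaryGroup_iff'.1 g.2) l) k
    rw [Matrix.mul_apply, Matrix.one_apply] at this
    rw [← this]
    refine Finset.sum_congr rfl fun j _ => ?_
    rw [Matrix.star_apply, mul_comm]
    rfl
  rw [Finset.sum_comm]
  refine Finset.sum_congr rfl fun k _ => ?_
  rw [Finset.sum_comm]
  have e : ∀ l, ∑ j, g.1 j k * a k * (conj (g.1 j l) * conj (b l)) =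
      (if l = k then 1 else 0) * (a k * conj (b l)) := fun l => by
    rw [← hg, Finset.sum_mul]
    exact Finset.sum_congr rfl fun j _ => by ring
  simp [e]

end invariance

section quotient

variable {G : Subgroup (Un n)}

theorem exists_out_eq_smul (x : Sph n) : ∃ g ∈ G, (proj G x).out = g • x := by
  have h : proj G (proj G x).out = proj G x := Quotient.out_eq _
  obtain ⟨g, hg, h⟩ := proj_eq_iff.1 h
  exact ⟨g, hg, h.symm⟩

theorem continuous_dbarb {u : Sph n → ℂ} (hu : SmoothSph u) (j : Fin n) :
    Continuous fun x => dbarb u x j := by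
  have h1 := continuous_fderiv_sph hu.contDiffOn_one
  have hc : Continuous fun x : Sph n => starRingEnd ℂ (x.1 j) :=
    (contDiff_conj_coord j (k := 1)).continuous.comp continuous_subtype_val
  have h2 : Continuous fun x : Sph n => tangentFrame x j :=
    Continuous.sub continuous_const (Continuous.smul (f := fun x : Sph n => starRingEnd ℂ (x.1 j))
      (g := fun x : Sph n => x.1) hc continuous_subtype_val)
  have h3 : Continuous fun x : Sph n => Complex.I • tangentFrame x j :=
    (continuous_const_smul Complex.I).comp h2
  exact ((h1.clm_apply h2).add (continuous_const.mul (h1.clm_apply h3))).div_const _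

theorem continuous_formInner {u w : Sph n → ℂ} (hu : SmoothSph u) (hw : SmoothSph w) :
    Continuous (formInner u w) :=
  continuous_const.mul (continuous_finsetSum _ fun j _ =>
    (continuous_dbarb hu j).mul (Complex.continuous_conj.comp (continuous_dbarb hw j)))

theorem dbarbInner_eq [Finite G] (hG : ActsFreely G) {f h : SphQuot G → ℂ} (hf : SmoothQuot G f)
    (hh : SmoothQuot G h) :
    dbarbInner G f h = (Nat.card G : ℂ)⁻¹ *
      ∫ x, formInner (fun x => f (proj G x)) (fun x => h (proj G x)) x ∂(sphMeasure n) := by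
  have e : ∀ x, formInner (fun x => f (proj G x)) (fun x => h (proj G x)) (proj G x).out =
      formInner (fun x => f (proj G x)) (fun x => h (proj G x)) x := by
    intro x
    obtain ⟨g, hg, hx⟩ := exists_out_eq_smul (G := G) x
    rw [hx]
    exact formInner_smul (fun x => by rw [proj_smul hg]) (fun x => by rw [proj_smul hg]) x
  rw [dbarbInner, integral_quot hG]
  · simp only [e]
  · simp only [e]
    exact (continuous_formInner hf hh).measurable

theorem dbarbInner_conj_symm (f h : SphQuot G → ℂ) :
    conj (dbarbInner G f h) = dbarbInner G h f := by
  rw [dbarbInner, dbarbInner, ← integral_conj]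
  refine integral_congr_ae (Eventually.of_forall fun p => ?_)
  simp only [formInner, map_mul, map_sum, Complex.conj_conj, Complex.conj_ofNat]
  congr 1
  exact Finset.sum_congr rfl fun j _ => mul_comm _ _

theorem ev_act (g : Un n) (Q : Pol n) (z : Cn n) : ev (act g Q) z = ev Q (unIso g z) := by
  have h1 : ∀ j, (unIso g z) j = ∑ k, g.1 j k * z k := fun j => by
    rw [unIso_apply]; simp [Matrix.toLpLin_apply, Matrix.mulVec, dotProduct]
  induction Q using MvPolynomial.induction_on with
  | C a => simp [ev, act, linSubst]
  | add P Q hP hQ => rw [map_add, ev_add, ev_add, hP, hQ]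
  | mul_X P i hP =>
    rw [map_mul, ev_mul, ev_mul, hP]
    congr 1
    cases i with
    | inl j =>
      rw [act, linSubst_X_inl, ev_X_inl, ev_sum, h1]
      simp only [ev_smul, ev_X_inl]
    | inr j =>
      rw [act, linSubst_X_inr, ev_X_inr, ev_sum, h1, map_sum]
      simp only [ev_smul, ev_X_inr, map_mul, Matrix.map_apply]

/-- The function on the quotient defined by an invariant polynomial. -/
def polyQuot (G : Subgroup (Un n)) (Q : Pol n) (p : SphQuot G) : ℂ := ev Q p.out.1

theorem polyQuot_proj {Q : Pol n} (hQ : ∀ g ∈ G, act g Q = Q) (x : Sph n) :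
    polyQuot G Q (proj G x) = ev Q x.1 := by
  obtain ⟨g, hg, hx⟩ := exists_out_eq_smul (G := G) x
  rw [polyQuot, hx]
  change ev Q (unIso g x.1) = _
  rw [← ev_act, hQ g hg]

theorem smoothQuot_polyQuot {Q : Pol n} (hQ : ∀ g ∈ G, act g Q = Q) :
    SmoothQuot G (polyQuot G Q) := by
  rw [SmoothQuot]
  simp only [polyQuot_proj hQ]
  exact smoothSph_of_contDiff (contDiff_ev Q)

/-- The eigenvalue of the Kohn Laplacian on harmonic polynomials of bidegree `(p, q)`. -/
def kohnEig (n p q : ℕ) : ℝ := 2 * q * (p + n - 1)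

theorem measurable_mul_conj_smooth {f h : SphQuot G → ℂ} (hf : SmoothQuot G f)
    (hh : SmoothQuot G h) : Measurable fun x : Sph n => f (proj G x) * conj (h (proj G x)) :=
  (hf.continuous.mul (Complex.continuous_conj.comp hh.continuous)).measurable

/-- Invariant harmonic polynomials are eigenfunctions of the Kohn Laplacian. -/
theorem isKohnLaplacian_polyQuot [Finite G] (hG : ActsFreely G) {p q : ℕ} {Q : Pol n}
    (hQ : Q ∈ HarmBi G p q) :
    IsKohnLaplacian G (polyQuot G Q) fun y => (kohnEig n p q : ℂ) * polyQuot G Q y := by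
  rw [mem_HarmBi, mem_InvBi] at hQ
  obtain ⟨⟨hB, hinv⟩, hlap⟩ := hQ
  have hs := smoothQuot_polyQuot hinv
  have hs2 : SmoothQuot G fun y => (kohnEig n p q : ℂ) * polyQuot G Q y := by
    rw [SmoothQuot]
    simp only [polyQuot_proj hinv]
    exact smoothSph_of_contDiff (F := fun z => (kohnEig n p q : ℂ) * ev Q z)
      (contDiff_const.mul (contDiff_ev Q))
  refine ⟨hs, hs2, fun h hh => ?_⟩
  rw [dbarbInner_eq hG hs hh, integral_quot hG (measurable_mul_conj_smooth hs2 hh)]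
  simp only [polyQuot_proj hinv]
  have e : (kohnEig n p q : ℂ) = 2 * (q : ℂ) * (p + n - 1) := by
    rw [kohnEig]
    push_cast
    ring
  rw [integral_formInner_ev hB hlap hh, ← integral_const_mul, e]
  simp only [mul_assoc]

end quotient

end KohnWeyl
end

/-! ### Invariant polynomials as elements of L² -/

noncomputable section
namespace KohnWeyl

open MeasureTheory MvPolynomial Filter Topology

variable {n : ℕ} {G : Subgroup (Un n)}

theorem continuous_ev_sph (Q : Pol n) : Continuous fun x : Sph n => ev Q x.1 :=
  (contDiff_ev Q (k := 1)).continuous.comp continuous_subtype_val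

theorem measurable_polyQuot {Q : Pol n} (hQ : ∀ g ∈ G, act g Q = Q) :
    Measurable (polyQuot G Q) := by
  refine measurable_of_comp_proj ?_
  simp only [polyQuot_proj hQ]
  exact (continuous_ev_sph Q).measurable

theorem memLp_polyQuot [Finite G] (hG : ActsFreely G) {Q : Pol n} (hQ : ∀ g ∈ G, act g Q = Q) :
    MemLp (polyQuot G Q) 2 (quotMeasure G) := by
  have := isFiniteMeasure_quotMeasure hG
  obtain ⟨M, hM⟩ := isCompact_univ.exists_bound_of_continuousOn (continuous_ev_sph Q).continuousOn
  exact MemLp.of_bound (measurable_polyQuot hQ).aestronglyMeasurable M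
    (Eventually.of_forall fun p => hM p.out (Set.mem_univ _))

/-- The element of `L²` defined by an invariant polynomial of bidegree `(p, q)`. -/
def toL2 [Finite G] (hG : ActsFreely G) (p q : ℕ) : InvBi G p q →ₗ[ℂ] L2Quot G where
  toFun Q := (memLp_polyQuot hG (mem_InvBi.1 Q.2).2).toLp _
  map_add' P Q := by
    rw [← MemLp.toLp_add]
    congr 1
    ext p
    exact ev_add _ _ _
  map_smul' c Q := by
    rw [RingHom.id_apply, ← MemLp.toLp_const_smul]
    congr 1
    ext p
    exact ev_smul _ _ _

theorem coeFn_toL2 [Finite G] (hG : ActsFreely G) {p q : ℕ} (Q : InvBi G p q) :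
    toL2 hG p q Q =ᵐ[quotMeasure G] polyQuot G Q.1 :=
  MemLp.coeFn_toLp (memLp_polyQuot hG (mem_InvBi.1 Q.2).2)

theorem inner_toL2 [Finite G] (hG : ActsFreely G) {p q : ℕ} (Q : InvBi G p q) (u : L2Quot G) :
    inner ℂ (toL2 hG p q Q) u = ∫ y, u y * conj (polyQuot G Q.1 y) ∂(quotMeasure G) := by
  rw [L2.inner_def]
  refine integral_congr_ae ?_
  filter_upwards [coeFn_toL2 hG Q] with y hy
  rw [hy]
  rfl

theorem inner_toL2_toL2 [Finite G] (hG : ActsFreely G) {p q p' q' : ℕ} (Q : InvBi G p q)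
    (Q' : InvBi G p' q') : inner ℂ (toL2 hG p q Q) (toL2 hG p' q' Q') =
      (Nat.card G : ℂ)⁻¹ * ∫ x : Sph n, ev Q'.1 x.1 * conj (ev Q.1 x.1) ∂(sphMeasure n) := by
  have hQ := (mem_InvBi.1 Q.2).2
  have hQ' := (mem_InvBi.1 Q'.2).2
  rw [inner_toL2]
  have h1 : ∫ y, toL2 hG p' q' Q' y * conj (polyQuot G Q.1 y) ∂(quotMeasure G) =
      ∫ y, polyQuot G Q'.1 y * conj (polyQuot G Q.1 y) ∂(quotMeasure G) := by
    refine integral_congr_ae ?_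
    filter_upwards [coeFn_toL2 hG Q'] with y hy
    rw [hy]
  rw [h1, integral_quot hG
    (measurable_mul_conj_smooth (smoothQuot_polyQuot hQ') (smoothQuot_polyQuot hQ))]
  simp only [polyQuot_proj hQ, polyQuot_proj hQ']

theorem ev_smul_point {p q : ℕ} {Q : Pol n} (hQ : Q ∈ Bi n p q) (c : ℂ) (z : Cn n) :
    ev Q (c • z) = c ^ p * conj c ^ q * ev Q z := by
  have h : ∀ d ∈ Q.support, ev (monomial d (coeff d Q)) (c • z) =
      c ^ p * conj c ^ q * ev (monomial d (coeff d Q)) z := by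
    intro d hd
    have hw := hQ (mem_support_iff.1 hd)
    rw [weight_biWeight, Prod.mk.injEq] at hw
    have hc : ∀ j, (c • z) j = c * z j := fun j => rfl
    rw [ev, ev, eval_monomial, eval_monomial, Finsupp.prod_fintype _ _ (by simp),
      Finsupp.prod_fintype _ _ (by simp), Fintype.prod_sum_type, Fintype.prod_sum_type]
    simp only [Sum.elim_inl, Sum.elim_inr, hc, map_mul, mul_pow, Finset.prod_mul_distrib,
      Finset.prod_pow_eq_pow_sum, hw.1, hw.2]
    ring
  rw [Q.as_sum, ev_sum, ev_sum, Finset.mul_sum]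
  exact Finset.sum_congr rfl h

/-- Polynomials in `z` and `z̄` are determined by their values. -/
theorem eq_zero_of_ev_eq_zero {Q : Pol n} (h : ∀ z, ev Q z = 0) : Q = 0 := by
  -- The substitution z = x + iy, z̄ = x − iy, with inverse `ψ`. In the variables x and y the
  -- polynomial vanishes at all real points, hence identically.
  let φ : Pol n →ₐ[ℂ] Pol n := aeval (Sum.elim
    (fun j => X (Sum.inl j) + C Complex.I * X (Sum.inr j))
    (fun j => X (Sum.inl j) - C Complex.I * X (Sum.inr j)))
  let ψ : Pol n →ₐ[ℂ] Pol n := aeval (Sum.elim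
    (fun j => C (1 / 2) * (X (Sum.inl j) + X (Sum.inr j)))
    (fun j => C (-Complex.I / 2) * (X (Sum.inl j) - X (Sum.inr j))))
  have hφψ : ψ.comp φ = AlgHom.id ℂ (Pol n) := by
    refine MvPolynomial.algHom_ext fun i => ?_
    have hI : (C Complex.I * C (-Complex.I / 2) : Pol n) = C (1 / 2) := by
      rw [← C_mul]
      congr 1
      linear_combination (-1 / 2 : ℂ) * Complex.I_mul_I
    have h2 : (C (1 / 2) + C (1 / 2) : Pol n) = 1 := by
      rw [← C_add, ← C_1]
      congr 1
      norm_num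
    cases i with
    | inl j =>
      simp only [AlgHom.comp_apply, φ, ψ, aeval_X, Sum.elim_inl, Sum.elim_inr, map_add, map_mul,
        AlgHom.id_apply, algHom_C, algebraMap_eq]
      linear_combination (X (Sum.inl j) - X (Sum.inr j)) * hI + X (Sum.inl j) * h2
    | inr j =>
      simp only [AlgHom.comp_apply, φ, ψ, aeval_X, Sum.elim_inl, Sum.elim_inr, map_sub, map_mul,
        AlgHom.id_apply, algHom_C, algebraMap_eq]
      linear_combination -(X (Sum.inl j) - X (Sum.inr j)) * hI + X (Sum.inr j) * h2
  have h1 : φ Q = 0 := by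
    refine MvPolynomial.funext_set (fun _ => Set.range ((↑) : ℝ → ℂ))
      (fun _ => Set.infinite_range_of_injective Complex.ofReal_injective) fun x hx => ?_
    rw [map_zero]
    choose r hr using fun i => hx i (Set.mem_univ i)
    have hv := h (WithLp.toLp 2 fun j => x (Sum.inl j) + Complex.I * x (Sum.inr j))
    rw [ev] at hv
    rw [← hv]
    change eval x (aeval _ Q) = _
    rw [aeval_def, eval_eval₂, ← eval₂_id, eval₂_eq', eval₂_eq']
    refine Finset.sum_congr rfl fun d _ => ?_
    congr 1
    · simp
    · refine Finset.prod_congr rfl fun i _ => ?_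
      congr 1
      cases i with
      | inl j => simp
      | inr j => simp [← hr, sub_eq_add_neg]
  calc Q = (ψ.comp φ) Q := by rw [hφψ]; rfl
    _ = ψ (φ Q) := rfl
    _ = 0 := by rw [h1, map_zero]

/-- Bihomogeneity is essential, since |z|² − 1 vanishes on the sphere. It determines the values on
each complex line from those at unit vectors. -/
theorem eq_zero_of_ev_sph_eq_zero (hn : n ≠ 0) {p q : ℕ} {Q : Pol n} (hQ : Q ∈ Bi n p q)
    (h : ∀ x : Sph n, ev Q x.1 = 0) : Q = 0 := by
  refine eq_zero_of_ev_eq_zero fun z => ?_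
  have key : ∃ (c : ℂ) (x : Sph n), z = c • x.1 := by
    by_cases hz : z = 0
    · refine ⟨0, ⟨EuclideanSpace.single ⟨0, Nat.pos_of_ne_zero hn⟩ 1, ?_⟩, by simp [hz]⟩
      simp
    · refine ⟨(‖z‖ : ℝ), ⟨((‖z‖⁻¹ : ℝ) : ℂ) • z, ?_⟩, ?_⟩
      · rw [mem_sphere_zero_iff_norm, norm_smul, Complex.norm_real, norm_inv, norm_norm,
          inv_mul_cancel₀ (norm_ne_zero_iff.2 hz)]
      · rw [smul_smul, ← Complex.ofReal_mul, mul_inv_cancel₀ (norm_ne_zero_iff.2 hz)]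
        simp
  obtain ⟨c, x, rfl⟩ := key
  rw [ev_smul_point hQ, h x, mul_zero]

/-- A continuous function vanishing almost everywhere on the sphere vanishes identically, as
nonempty open sets have positive measure. -/
theorem toL2_injective [Finite G] (hG : ActsFreely G) (hn : n ≠ 0) (p q : ℕ) :
    Function.Injective (toL2 hG p q) := by
  rw [injective_iff_map_eq_zero]
  intro Q hQ
  have hinv := (mem_InvBi.1 Q.2).2
  have h1 : polyQuot G Q.1 =ᵐ[quotMeasure G] 0 := by
    have h2 := coeFn_toL2 hG Q
    rw [hQ] at h2
    exact h2.symm.trans (Lp.coeFn_zero _ _ _)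
  rw [quotMeasure_eq hG] at h1
  have hc0 : (Nat.card G : ℝ≥0∞)⁻¹ ≠ 0 := ENNReal.inv_ne_zero.2 (ENNReal.natCast_ne_top _)
  have h2 : polyQuot G Q.1 =ᵐ[(sphMeasure n).map (proj G)] 0 :=
    (Measure.ae_ennreal_smul_measure_iff hc0).1 h1
  have h3 := ae_of_ae_map measurable_proj.aemeasurable h2
  have h4 : (fun x : Sph n => ev Q.1 x.1) =ᵐ[sphMeasure n] fun _ => 0 := by
    filter_upwards [h3] with x hx
    rw [← polyQuot_proj hinv x]
    exact hx
  have h5 := Continuous.ae_eq_iff_eq (sphMeasure n) (continuous_ev_sph Q.1) continuous_const |>.1 h4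
  exact Subtype.ext (eq_zero_of_ev_sph_eq_zero hn (mem_InvBi.1 Q.2).1 fun x => congrFun h5 x)

/-- The subspace of `L²` of invariant harmonic polynomials of bidegree `(p, q)`. -/
def harmL2 [Finite G] (hG : ActsFreely G) (p q : ℕ) : Submodule ℂ (L2Quot G) :=
  ((HarmBi G p q).submoduleOf (InvBi G p q)).map (toL2 hG p q)

theorem HarmBi_le_InvBi (p q : ℕ) : HarmBi G p q ≤ InvBi G p q := inf_le_left

theorem finrank_harmL2 [Finite G] (hG : ActsFreely G) (hn : n ≠ 0) (p q : ℕ) :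
    Module.finrank ℂ (harmL2 hG p q) = Module.finrank ℂ (HarmBi G p q) :=
  (LinearEquiv.finrank_eq (Submodule.equivMapOfInjective _ (toL2_injective hG hn p q) _)).symm.trans
    (LinearEquiv.finrank_eq (Submodule.submoduleOfEquivOfLe (HarmBi_le_InvBi p q)))

end KohnWeyl
end

/-! ### Symmetry, orthogonality and density -/

noncomputable section
namespace KohnWeyl

open MeasureTheory MvPolynomial Filter Topology

variable {n : ℕ} {G : Subgroup (Un n)}

/-- The Kohn Laplacian is symmetric when tested against invariant harmonic polynomials. -/
theorem inner_toL2_of_mem_kohnGraph [Finite G] (hG : ActsFreely G) {p q : ℕ} {Q : InvBi G p q}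
    (hQ : Q.1 ∈ HarmBi G p q) {w : L2Quot G × L2Quot G} (hw : w ∈ kohnGraph G) :
    inner ℂ (toL2 hG p q Q) w.2 = (kohnEig n p q : ℂ) * inner ℂ (toL2 hG p q Q) w.1 := by
  set T := toL2 hG p q Q
  let φ : L2Quot G × L2Quot G →L[ℂ] ℂ :=
    (innerSL ℂ T).comp (ContinuousLinearMap.snd ℂ _ _) -
      (kohnEig n p q : ℂ) • (innerSL ℂ T).comp (ContinuousLinearMap.fst ℂ _ _)
  have hφ : ∀ w, φ w = inner ℂ T w.2 - (kohnEig n p q : ℂ) * inner ℂ T w.1 := fun w => rfl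
  -- The defect of symmetry is a continuous functional on L² × L², so it suffices that it vanishes
  -- on smooth pairs. This avoids any description of the domain of the closure.
  have hle : kohnGraph G ≤ LinearMap.ker (φ : L2Quot G × L2Quot G →ₗ[ℂ] ℂ) := by
    refine Submodule.topologicalClosure_minimal _ (Submodule.span_le.2 ?_) φ.isClosed_ker
    rintro w ⟨f, g, hfg, hwf, hwg⟩
    change φ w = 0
    have hK := isKohnLaplacian_polyQuot hG hQ
    rw [hφ, inner_toL2, inner_toL2,
      integral_congr_ae (g := fun y => g y * conj (polyQuot G Q.1 y))
        (by filter_upwards [hwg] with y hy; rw [hy]),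
      integral_congr_ae (f := fun y => w.1 y * conj (polyQuot G Q.1 y))
        (g := fun y => f y * conj (polyQuot G Q.1 y))
        (by filter_upwards [hwf] with y hy; rw [hy]), ← hfg.2.2 _ hK.1, ← dbarbInner_conj_symm,
      hK.2.2 _ hfg.1, ← integral_conj, ← integral_const_mul, sub_eq_zero]
    refine integral_congr_ae (Eventually.of_forall fun y => ?_)
    simp only [map_mul, Complex.conj_conj, Complex.conj_ofReal]
    ring
  have := hle hw
  exact sub_eq_zero.1 ((hφ w).symm.trans this)

theorem harmL2_le_kohnEigenspace [Finite G] (hG : ActsFreely G) (p q : ℕ) :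
    harmL2 hG p q ≤ kohnEigenspace G (kohnEig n p q) := by
  rintro _ ⟨Q, hQ, rfl⟩
  refine Submodule.le_topologicalClosure _ (Submodule.subset_span
    ⟨_, _, isKohnLaplacian_polyQuot hG hQ, coeFn_toL2 hG Q, ?_⟩)
  change ((kohnEig n p q : ℂ) • toL2 hG p q Q : L2Quot G) =ᵐ[quotMeasure G] _
  filter_upwards [Lp.coeFn_smul (kohnEig n p q : ℂ) (toL2 hG p q Q), coeFn_toL2 hG Q] with y hy hy'
  rw [hy, Pi.smul_apply, hy', smul_eq_mul]
  rfl

theorem mem_kohnEigenspace {μ : ℝ} {u : L2Quot G} :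
    u ∈ kohnEigenspace G μ ↔ (u, (μ : ℂ) • u) ∈ kohnGraph G := Iff.rfl

/-- Eigenvectors for different eigenvalues are orthogonal. -/
theorem inner_eq_zero_of_mem_kohnEigenspace [Finite G] (hG : ActsFreely G) {p q : ℕ} {μ : ℝ}
    (hμ : kohnEig n p q ≠ μ) {u v : L2Quot G} (hv : v ∈ harmL2 hG p q)
    (hu : u ∈ kohnEigenspace G μ) : inner ℂ v u = 0 := by
  obtain ⟨Q, hQ, rfl⟩ := hv
  have h := inner_toL2_of_mem_kohnGraph hG hQ (mem_kohnEigenspace.1 hu)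
  simp only [inner_smul_right] at h
  have h2 : ((kohnEig n p q : ℂ) - μ) * inner ℂ (toL2 hG p q Q) u = 0 := by
    rw [sub_mul, ← h, sub_self]
  refine (mul_eq_zero.1 h2).resolve_left (sub_ne_zero.2 ?_)
  exact_mod_cast hμ

/-- The rotation `z ↦ c z` of `ℂⁿ`. -/
def circleIso (n : ℕ) (c : Circle) : Cn n ≃ₗᵢ[ℝ] Cn n :=
  LinearIsometry.toLinearIsometryEquiv
    { toLinearMap := (LinearMap.lsmul ℂ (Cn n) (c : ℂ)).restrictScalars ℝ
      norm_map' := fun z => by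
        change ‖(c : ℂ) • z‖ = ‖z‖
        rw [norm_smul, Circle.norm_coe, one_mul] } rfl

/-- Polynomials of bidegrees `(p, q)` with different `p - q` are orthogonal. -/
theorem integral_ev_mul_conj_ev_eq_zero {p q p' q' : ℕ} (h : p + q' ≠ p' + q) {Q Q' : Pol n}
    (hQ : Q ∈ Bi n p q) (hQ' : Q' ∈ Bi n p' q') :
    ∫ x : Sph n, ev Q' x.1 * conj (ev Q x.1) ∂(sphMeasure n) = 0 := by
  obtain ⟨c, hc⟩ : ∃ c : Circle, (c : ℂ) ^ (p' + q) ≠ (c : ℂ) ^ (p + q') := by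
    set N : ℝ := p + q + p' + q' + 1
    have hN : 0 < N := by positivity
    -- Both exponents are at most N, so the arguments of the two powers lie in [0, 1], on which the
    -- exponential to the circle is injective.
    refine ⟨Circle.exp N⁻¹, fun hc => h ?_⟩
    have hc' : Circle.exp ((p' + q : ℕ) * N⁻¹) = Circle.exp ((p + q' : ℕ) * N⁻¹) := by
      rw [← nsmul_eq_mul, ← nsmul_eq_mul, Circle.exp_nsmul, Circle.exp_nsmul]
      exact Circle.coe_injective (by rw [Circle.coe_pow, Circle.coe_pow, hc])
    have hmem : ∀ k : ℕ, (k : ℝ) ≤ N → (k : ℝ) * N⁻¹ ∈ Set.Icc (0 : ℝ) 1 := fun k hk =>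
      ⟨by positivity, by rw [← div_eq_mul_inv]; exact (div_le_one hN).2 hk⟩
    have hinj := Circle.exp_injOn_Icc (a := 0) (b := 1) (by linarith [Real.pi_gt_three])
      (hmem _ (by
        push_cast
        linarith [p.cast_nonneg (α := ℝ), q'.cast_nonneg (α := ℝ)]))
      (hmem _ (by
        push_cast
        linarith [p'.cast_nonneg (α := ℝ), q.cast_nonneg (α := ℝ)]))
      hc'
    have := mul_right_cancel₀ (inv_ne_zero hN.ne') hinj
    exact_mod_cast this.symm
  have hcc : (c : ℂ) * conj (c : ℂ) = 1 := by
    rw [Complex.mul_conj, Circle.normSq_coe, Complex.ofReal_one]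
  -- The rotation by c preserves the integral but multiplies it by c^(p′ + q − p − q′) ≠ 1.
  have hI := integral_sphMap (circleIso n c) fun x => ev Q' x.1 * conj (ev Q x.1)
  have hpt : ∀ x : Sph n, ev Q' (sphMap (circleIso n c) x).1 *
      conj (ev Q (sphMap (circleIso n c) x).1) =
      ((c : ℂ) ^ p' * conj (c : ℂ) ^ q' * (conj (c : ℂ) ^ p * (c : ℂ) ^ q)) *
        (ev Q' x.1 * conj (ev Q x.1)) := fun x => by
    change ev Q' ((c : ℂ) • x.1) * conj (ev Q ((c : ℂ) • x.1)) = _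
    rw [ev_smul_point hQ, ev_smul_point hQ']
    simp only [map_mul, map_pow, Complex.conj_conj]
    ring
  simp only [hpt] at hI
  rw [integral_const_mul] at hI
  by_contra hne
  have h1 := mul_right_cancel₀ hne (hI.trans (one_mul _).symm)
  apply hc
  have h2 : (c : ℂ) ^ (p + q') * conj (c : ℂ) ^ (p + q') = 1 := by rw [← mul_pow, hcc, one_pow]
  calc (c : ℂ) ^ (p' + q)
    _ = (c : ℂ) ^ (p' + q) * ((c : ℂ) ^ (p + q') * conj (c : ℂ) ^ (p + q')) := by
        rw [h2, mul_one]
    _ = (c : ℂ) ^ (p + q') *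
        ((c : ℂ) ^ p' * conj (c : ℂ) ^ q' * (conj (c : ℂ) ^ p * (c : ℂ) ^ q)) := by
        ring
    _ = (c : ℂ) ^ (p + q') := by rw [h1, mul_one]

theorem inner_harmL2_eq_zero [Finite G] (hG : ActsFreely G) {p q p' q' : ℕ} (h : p + q' ≠ p' + q)
    {u v : L2Quot G} (hu : u ∈ harmL2 hG p q) (hv : v ∈ harmL2 hG p' q') : inner ℂ u v = 0 := by
  obtain ⟨Q, -, rfl⟩ := hu
  obtain ⟨Q', -, rfl⟩ := hv
  rw [inner_toL2_toL2, integral_ev_mul_conj_ev_eq_zero h (mem_InvBi.1 Q.2).1 (mem_InvBi.1 Q'.2).1,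
    mul_zero]

/-- Vectors orthogonal to the invariant harmonic polynomials are orthogonal to all invariant
polynomials. -/
theorem inner_toL2_eq_zero_of_harmonic [Finite G] (hG : ActsFreely G) {u : L2Quot G} (hn : n ≠ 0)
    (hu : ∀ p q, ∀ v ∈ harmL2 hG p q, inner ℂ v u = 0) (p q : ℕ) (Q : InvBi G p q) :
    inner ℂ (toL2 hG p q Q) u = 0 := by
  induction p generalizing q with
  | zero => exact hu 0 q _ ⟨Q, (HarmBi_zero_left (G := G) q).ge Q.2, rfl⟩
  | succ p ih =>
    cases q with
    | zero => exact hu _ 0 _ ⟨Q, (HarmBi_zero_right (G := G) (p + 1)).ge Q.2, rfl⟩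
    | succ q =>
      -- On the sphere |z|² = 1, so Q restricts to h + g with h harmonic and g of lower bidegree.
      obtain ⟨h, hh, g, hg, hQ⟩ := exists_harmonic_add hn Q.2
      have h1 := hu _ _ _ ⟨⟨h, HarmBi_le_InvBi _ _ hh⟩, hh, rfl⟩
      have h2 := ih q ⟨g, hg⟩
      have h3 : toL2 hG (p + 1) (q + 1) Q =
          toL2 hG (p + 1) (q + 1) ⟨h, HarmBi_le_InvBi _ _ hh⟩ + toL2 hG p q ⟨g, hg⟩ := by
        refine Lp.ext ?_
        filter_upwards [coeFn_toL2 hG Q, coeFn_toL2 hG ⟨h, HarmBi_le_InvBi _ _ hh⟩,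
          coeFn_toL2 hG ⟨g, hg⟩, Lp.coeFn_add (toL2 hG (p + 1) (q + 1) ⟨h, HarmBi_le_InvBi _ _ hh⟩)
            (toL2 hG p q ⟨g, hg⟩)] with y h4 h5 h6 h7
        rw [h4, h7, Pi.add_apply, h5, h6, polyQuot, polyQuot, polyQuot, hQ, ev_add, ev_mul, ev_rad,
          one_mul]
      rw [h3, inner_add_left, h1, h2, add_zero]

theorem sum_act_mem_InvBi [Fintype G] {p q : ℕ} {P : Pol n} (hP : P ∈ Bi n p q) :
    ∑ g : G, act g.1 P ∈ InvBi G p q := by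
  refine mem_InvBi.2 ⟨Submodule.sum_mem _ fun g _ => linSubst_mem _ _ hP, fun h hh => ?_⟩
  rw [map_sum]
  refine Fintype.sum_equiv (Equiv.mulRight ⟨h, hh⟩) _ _ fun g => ?_
  exact DFunLike.congr_fun (act_comp h g.1) P

theorem map_proj_le_smul_quotMeasure [Finite G] (hG : ActsFreely G) :
    (sphMeasure n).map (proj G) ≤ (Nat.card G : ℝ≥0∞) • quotMeasure G := by
  rw [quotMeasure_eq hG, smul_smul, ENNReal.mul_inv_cancel (by exact_mod_cast Nat.card_pos.ne')
    (ENNReal.natCast_ne_top _), one_smul]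

theorem quotMeasure_le_smul_map_proj [Finite G] (hG : ActsFreely G) :
    quotMeasure G ≤ (Nat.card G : ℝ≥0∞)⁻¹ • (sphMeasure n).map (proj G) := (quotMeasure_eq hG).le

theorem memLp_comp_proj [Finite G] (hG : ActsFreely G) (u : L2Quot G) :
    MemLp (fun x => u (proj G x)) 2 (sphMeasure n) :=
  ((Lp.memLp u).of_measure_le_smul (ENNReal.natCast_ne_top _)
    (map_proj_le_smul_quotMeasure hG)).comp_of_map measurable_proj.aemeasurable

theorem integrable_comp_proj_mul_conj_ev [Finite G] (hG : ActsFreely G) (u : L2Quot G) (Q : Pol n) :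
    Integrable (fun x : Sph n => u (proj G x) * conj (ev Q x.1)) (sphMeasure n) := by
  obtain ⟨M, hM⟩ := isCompact_univ.exists_bound_of_continuousOn (continuous_ev_sph Q).continuousOn
  refine ((memLp_comp_proj hG u).integrable (by norm_num)).mul_bdd (c := M)
    (Complex.continuous_conj.comp (continuous_ev_sph _)).aestronglyMeasurable
    (Eventually.of_forall fun x => ?_)
  rw [RCLike.norm_conj]
  exact hM x (Set.mem_univ _)

/-- The pullback to the sphere of a function that is orthogonal to all invariant polynomials is
orthogonal to all polynomials of bidegree `(p, q)`. -/
theorem integral_mul_conj_ev_of_mem_Bi [Finite G] (hG : ActsFreely G) {u : L2Quot G}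
    (hu : ∀ p q (Q : InvBi G p q), inner ℂ (toL2 hG p q Q) u = 0) {p q : ℕ} {P : Pol n}
    (hP : P ∈ Bi n p q) :
    ∫ x : Sph n, u (proj G x) * conj (ev P x.1) ∂(sphMeasure n) = 0 := by
  have := Fintype.ofFinite G
  -- The pullback of `u` is G-invariant, so pairing it with P is, up to the factor |G|, pairing it
  -- with the sum of the translates of P, which is invariant.
  have hS := sum_act_mem_InvBi (G := G) hP
  have hc : (Nat.card G : ℂ) ≠ 0 := by exact_mod_cast Nat.card_pos.ne'
  have h1 := hu p q ⟨_, hS⟩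
  rw [inner_toL2, integral_quot hG (by
    simp only [polyQuot_proj (mem_InvBi.1 hS).2]
    exact ((Lp.stronglyMeasurable u).measurable.comp measurable_proj).mul
      (Complex.continuous_conj.comp (continuous_ev_sph _)).measurable)] at h1
  simp only [polyQuot_proj (mem_InvBi.1 hS).2] at h1
  have h2 := (mul_eq_zero.1 h1).resolve_left (inv_ne_zero hc)
  simp only [ev_sum, map_sum, Finset.mul_sum] at h2
  rw [integral_finsetSum _ fun g _ => integrable_comp_proj_mul_conj_ev hG u _] at h2
  have h3 : ∀ g : G, ∫ x : Sph n, u (proj G x) * conj (ev (act g.1 P) x.1) ∂(sphMeasure n) =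
      ∫ x : Sph n, u (proj G x) * conj (ev P x.1) ∂(sphMeasure n) := fun g => by
    rw [← integral_sphMap (unIso g.1) fun x => u (proj G x) * conj (ev P x.1)]
    refine integral_congr_ae (Eventually.of_forall fun x => ?_)
    simp only [← smul_eq_sphMap, proj_smul g.2, ev_act]
    rfl
  simp only [h3, Finset.sum_const, Finset.card_univ, nsmul_eq_mul] at h2
  rw [← Nat.card_eq_fintype_card] at h2
  exact (mul_eq_zero.1 h2).resolve_left hc

/-- The polynomials in `z` and `z̄` as continuous functions on the sphere. -/
def polyAlgebra (n : ℕ) : StarSubalgebra ℂ C(Sph n, ℂ) where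
  carrier := {f | ∃ Q : Pol n, ∀ x : Sph n, f x = ev Q x.1}
  mul_mem' := by
    rintro f g ⟨P, hP⟩ ⟨Q, hQ⟩
    exact ⟨P * Q, fun x => by rw [ev_mul, ContinuousMap.mul_apply, hP, hQ]⟩
  add_mem' := by
    rintro f g ⟨P, hP⟩ ⟨Q, hQ⟩
    exact ⟨P + Q, fun x => by rw [ev_add, ContinuousMap.add_apply, hP, hQ]⟩
  algebraMap_mem' c := ⟨C c, fun x => by simp [ev]⟩
  star_mem' := by
    rintro f ⟨Q, hQ⟩
    -- Complex conjugation conjugates the coefficients and exchanges z and z̄.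
    refine ⟨rename Sum.swap (MvPolynomial.map (starRingEnd ℂ) Q), fun x => ?_⟩
    rw [ContinuousMap.star_apply, hQ, ev, ev, eval_rename, eval_map]
    change starRingEnd ℂ _ = _
    rw [← eval₂_id, hom_eval₂]
    congr 1
    funext i
    cases i <;> simp

theorem polyAlgebra_separatesPoints (n : ℕ) :
    (polyAlgebra n).toSubalgebra.SeparatesPoints := by
  intro x y hxy
  have : ∃ j, x.1 j ≠ y.1 j := by
    by_contra! h
    exact hxy (Subtype.ext (PiLp.ext h))
  obtain ⟨j, hj⟩ := this
  refine ⟨_, ⟨⟨fun x => ev (X (Sum.inl j)) x.1, continuous_ev_sph _⟩, ⟨X (Sum.inl j), fun x => rfl⟩,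
    rfl⟩, ?_⟩
  simpa [ev] using hj

/-- A square-integrable function on the sphere that is orthogonal to all polynomials vanishes. -/
theorem ae_eq_zero_of_integral_mul_conj_ev {u : Sph n → ℂ} (hu : MemLp u 2 (sphMeasure n))
    (h : ∀ P : Pol n, ∫ x : Sph n, u x * conj (ev P x.1) ∂(sphMeasure n) = 0) :
    u =ᵐ[sphMeasure n] 0 := by
  let U : Lp ℂ 2 (sphMeasure n) := hu.toLp u
  have hclosed : IsClosed
      {f : C(Sph n, ℂ) | inner ℂ (ContinuousMap.toLp 2 (sphMeasure n) ℂ f) U = 0} :=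
    isClosed_eq (by fun_prop) continuous_const
  have hsub : (polyAlgebra n : Set C(Sph n, ℂ)) ⊆
      {f | inner ℂ (ContinuousMap.toLp 2 (sphMeasure n) ℂ f) U = 0} := by
    rintro f ⟨P, hP⟩
    rw [Set.mem_ofPred_eq, L2.inner_def, ← h P]
    refine integral_congr_ae ?_
    filter_upwards [ContinuousMap.coeFn_toLp (p := 2) (𝕜 := ℂ) (sphMeasure n) f,
      hu.coeFn_toLp] with x h1 h2
    rw [h1, h2, hP]
    rfl
  have hall : ∀ f : C(Sph n, ℂ), inner ℂ (ContinuousMap.toLp 2 (sphMeasure n) ℂ f) U = 0 := by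
    intro f
    -- Stone–Weierstrass; continuous functions are in turn dense in L².
    have htop := ContinuousMap.starSubalgebra_topologicalClosure_eq_top_of_separatesPoints
      (polyAlgebra n) (polyAlgebra_separatesPoints n)
    have hf : f ∈ (polyAlgebra n).topologicalClosure := htop ▸ StarSubalgebra.mem_top
    exact closure_minimal hsub hclosed hf
  have hU : U = 0 := by
    have hd := ContinuousMap.toLp_denseRange ℂ (sphMeasure n) ℂ (p := 2) (by norm_num)
    have hUall : ∀ V : Lp ℂ 2 (sphMeasure n), inner ℂ V U = 0 := fun V =>
      hd.induction_on (p := fun V => inner ℂ V U = 0) V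
        (isClosed_eq (by fun_prop) continuous_const) hall
    exact inner_self_eq_zero.1 (hUall U)
  have h1 := hu.coeFn_toLp
  change (U : Sph n → ℂ) =ᵐ[_] u at h1
  rw [hU] at h1
  exact h1.symm.trans (Lp.coeFn_zero _ _ _)

/-- The invariant harmonic polynomials span a dense subspace of `L²`. -/
theorem eq_zero_of_orthogonal_harmL2 [Finite G] (hG : ActsFreely G) (hn : n ≠ 0) {u : L2Quot G}
    (hu : ∀ p q, ∀ v ∈ harmL2 hG p q, inner ℂ v u = 0) : u = 0 := by
  have h1 := inner_toL2_eq_zero_of_harmonic hG hn hu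
  have h2 : (fun x => u (proj G x)) =ᵐ[sphMeasure n] 0 := by
    refine ae_eq_zero_of_integral_mul_conj_ev (memLp_comp_proj hG u) fun P => ?_
    rw [P.as_sum]
    simp only [ev_sum, map_sum, Finset.mul_sum]
    rw [integral_finsetSum _ fun d _ => integrable_comp_proj_mul_conj_ev hG u _]
    exact Finset.sum_eq_zero fun d _ => integral_mul_conj_ev_of_mem_Bi hG h1 (monomial_mem_Bi d _)
  refine (Lp.eq_zero_iff_ae_eq_zero).2 ?_
  refine Measure.absolutelyContinuous_of_le_smul (quotMeasure_le_smul_map_proj hG) |>.ae_eq ?_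
  refine (ae_map_iff measurable_proj.aemeasurable ?_).2 h2
  exact (Lp.stronglyMeasurable u).measurable (measurableSet_singleton 0)

end KohnWeyl
end

/-! ### The positive eigenspaces and the counting function -/

noncomputable section
namespace KohnWeyl

open Filter Topology

theorem finrank_finset_sup_of_isOrtho {𝕜 E ι : Type*} [RCLike 𝕜] [NormedAddCommGroup E]
    [InnerProductSpace 𝕜 E] (V : ι → Submodule 𝕜 E) [∀ i, FiniteDimensional 𝕜 (V i)]
    (s : Finset ι) (h : (s : Set ι).Pairwise fun i j => V i ⟂ V j) :
    Module.finrank 𝕜 ↥(s.sup V) = ∑ i ∈ s, Module.finrank 𝕜 (V i) := by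
  classical
  induction s using Finset.induction_on with
  | empty => simp
  | insert a s ha ih =>
    rw [Finset.coe_insert, Set.pairwise_insert_of_notMem (by simpa using ha)] at h
    have hortho : V a ⟂ s.sup V := by
      rw [Submodule.isOrtho_iff_le, Submodule.le_orthogonal_iff_le_orthogonal, Finset.sup_le_iff]
      exact fun i hi => Submodule.isOrtho_iff_le.1 ((h.2 i hi).2)
    have hsum := Submodule.finrank_sup_add_finrank_inf_eq (V a) (s.sup V)
    rw [hortho.disjoint.eq_bot, finrank_bot, add_zero, ih h.1] at hsum
    rw [Finset.sup_insert, hsum, Finset.sum_insert ha]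

variable {n : ℕ} {G : Subgroup (Un n)}

instance [Finite G] (hG : ActsFreely G) (p q : ℕ) : FiniteDimensional ℂ (harmL2 hG p q) := by
  unfold harmL2
  infer_instance

/-- Only finitely many bidegrees have a positive eigenvalue up to Λ. Positivity is needed: all
bidegrees (p, 0) have eigenvalue 0. -/
theorem kohnEig_bounds (hn : n ≠ 0) {p q : ℕ} (h : 0 < kohnEig n p q) :
    (p : ℝ) ≤ kohnEig n p q ∧ (q : ℝ) ≤ kohnEig n p q := by
  obtain ⟨m, rfl⟩ := Nat.exists_eq_succ_of_ne_zero hn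
  have he : kohnEig (m + 1) p q = ((2 * q * (p + m) : ℕ) : ℝ) := by
    rw [kohnEig]; push_cast; ring
  simp only [Nat.succ_eq_add_one, he] at *
  have hpos : 0 < 2 * q * (p + m) := by exact_mod_cast h
  have hq : 0 < q := Nat.pos_of_ne_zero (by rintro rfl; simp at hpos)
  have hp : 0 < p + m := Nat.pos_of_ne_zero (by intro h0; simp [h0] at hpos)
  constructor
  · exact_mod_cast (by nlinarith : p ≤ 2 * q * (p + m))
  · exact_mod_cast (by nlinarith : q ≤ 2 * q * (p + m))

/-- A box that contains all `(p, q)` with `0 < kohnEig n p q ≤ Λ`. -/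
def box (Λ : ℝ) : Finset (ℕ × ℕ) := Finset.range (⌊Λ⌋₊ + 1) ×ˢ Finset.range (⌊Λ⌋₊ + 1)

theorem mem_box (hn : n ≠ 0) {Λ : ℝ} {x : ℕ × ℕ} (h0 : 0 < kohnEig n x.1 x.2)
    (h : kohnEig n x.1 x.2 ≤ Λ) : x ∈ box Λ := by
  obtain ⟨h1, h2⟩ := kohnEig_bounds hn h0
  rw [box, Finset.mem_product, Finset.mem_range, Finset.mem_range]
  exact ⟨Nat.lt_succ_of_le (Nat.le_floor (h1.trans h)),
    Nat.lt_succ_of_le (Nat.le_floor (h2.trans h))⟩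

/-- For the same positive eigenvalue, `p - q` determines `(p, q)`. -/
theorem eq_of_kohnEig_eq (hn : n ≠ 0) {x y : ℕ × ℕ} (h0 : 0 < kohnEig n x.1 x.2)
    (h : kohnEig n x.1 x.2 = kohnEig n y.1 y.2) (hxy : x.1 + y.2 = y.1 + x.2) : x = y := by
  obtain ⟨p, q⟩ := x
  obtain ⟨p', q'⟩ := y
  obtain ⟨m, rfl⟩ := Nat.exists_eq_succ_of_ne_zero hn
  have he : ∀ p q, kohnEig (m + 1) p q = ((2 * q * (p + m) : ℕ) : ℝ) := fun p q => by
    rw [kohnEig]; push_cast; ring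
  simp only [Nat.succ_eq_add_one, he] at *
  have hpos : 0 < 2 * q * (p + m) := by exact_mod_cast h0
  have heq : 2 * q * (p + m) = 2 * q' * (p' + m) := by exact_mod_cast h
  -- Increasing p and q by the same amount strictly increases the eigenvalue, once it is positive.
  have hq : q = q' := by
    rcases lt_trichotomy q q' with hlt | heq' | hlt
    · have : p < p' := by omega
      nlinarith
    · exact heq'
    · have : p' < p := by omega
      nlinarith
  subst hq
  rw [Nat.add_right_cancel hxy]

/-- Within one eigenspace, symmetry of □_b does not separate bidegrees; the circle action does,
since there p − q determines (p, q). -/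
theorem isOrtho_harmL2 [Finite G] (hG : ActsFreely G) (hn : n ≠ 0) {x y : ℕ × ℕ} (hxy : x ≠ y)
    (h0 : 0 < kohnEig n x.1 x.2) (h : kohnEig n x.1 x.2 = kohnEig n y.1 y.2) :
    harmL2 hG x.1 x.2 ⟂ harmL2 hG y.1 y.2 :=
  Submodule.isOrtho_iff_inner_eq.2 fun _ hu _ hv =>
    inner_harmL2_eq_zero hG (fun h' => hxy (eq_of_kohnEig_eq hn h0 h h')) hu hv

/-- No spectral theorem is needed. Subtract from an eigenvector its projection to the known
finite-dimensional part. The rest is still an eigenvector, orthogonal to bidegrees with eigenvalue ν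
by construction and to the others by symmetry, so it vanishes by density. -/
theorem kohnEigenspace_eq [Finite G] (hG : ActsFreely G) (hn : n ≠ 0) {ν : ℝ} (hν : 0 < ν) :
    kohnEigenspace G ν = ((box ν).filter fun x => kohnEig n x.1 x.2 = ν).sup
      fun x => harmL2 hG x.1 x.2 := by
  set W := ((box ν).filter fun x => kohnEig n x.1 x.2 = ν).sup fun x => harmL2 hG x.1 x.2 with hW
  have hle : W ≤ kohnEigenspace G ν := Finset.sup_le fun x hx => by
    rw [← (Finset.mem_filter.1 hx).2]
    exact harmL2_le_kohnEigenspace hG _ _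
  have : FiniteDimensional ℂ W := Submodule.finiteDimensional_finset_sup _ _
  refine le_antisymm (fun u hu => ?_) hle
  have hr : u - W.starProjection u ∈ kohnEigenspace G ν :=
    Submodule.sub_mem _ hu (hle (W.starProjection_apply_mem u))
  have hz : u - W.starProjection u = 0 := by
    refine eq_zero_of_orthogonal_harmL2 hG hn fun p q v hv => ?_
    by_cases h : kohnEig n p q = ν
    · have hvW : v ∈ W := by
        refine (Finset.le_sup (f := fun x : ℕ × ℕ => harmL2 hG x.1 x.2) (b := (p, q)) ?_) hv
        exact Finset.mem_filter.2 ⟨mem_box hn (by rw [h]; exact hν) h.le, h⟩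
      exact W.sub_starProjection_mem_orthogonal u v hvW
    · exact inner_eq_zero_of_mem_kohnEigenspace hG h hv hr
  rw [sub_eq_zero.1 hz]
  exact W.starProjection_apply_mem u

theorem kohnMultiplicity_eq [Finite G] (hG : ActsFreely G) (hn : n ≠ 0) {ν : ℝ} (hν : 0 < ν) :
    (kohnMultiplicity G ν : ℝ≥0∞) = ∑' x : ℕ × ℕ,
      if kohnEig n x.1 x.2 = ν then (Module.finrank ℂ (HarmBi G x.1 x.2) : ℝ≥0∞) else 0 := by
  have hE := kohnEigenspace_eq hG hn hν
  have : FiniteDimensional ℂ (kohnEigenspace G ν) := by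
    rw [hE]; exact Submodule.finiteDimensional_finset_sup _ _
  rw [kohnMultiplicity, ← Module.finrank_eq_rank, Cardinal.toENat_nat, hE,
    finrank_finset_sup_of_isOrtho _ _ ?_, tsum_eq_sum (s := box ν) ?_, ← Finset.sum_filter]
  · simp only [finrank_harmL2 hG hn]
    rw [ENat.toENNReal_coe, Nat.cast_sum]
  · intro x hx
    exact if_neg fun h => hx (mem_box hn (by rw [h]; exact hν) h.le)
  · intro x hx y hy hxy
    have h1 := (Finset.mem_filter.1 hx).2
    have h2 := (Finset.mem_filter.1 hy).2
    exact isOrtho_harmL2 hG hn hxy (by rw [h1]; exact hν) (h1.trans h2.symm)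

/-- Exchanging the two sums, each bidegree contributes to exactly one ν in (0, Λ] or to none. -/
theorem kohnCount_eq [Finite G] (hG : ActsFreely G) (hn : n ≠ 0) (Λ : ℝ) :
    kohnCount G Λ = ((∑ x ∈ (box Λ).filter fun x => 0 < kohnEig n x.1 x.2 ∧ kohnEig n x.1 x.2 ≤ Λ,
      Module.finrank ℂ (HarmBi G x.1 x.2) : ℕ) : ℝ≥0∞) := by
  classical
  have h1 : kohnCount G Λ = ∑' ν : Set.Ioc 0 Λ, ∑' x : ℕ × ℕ, if kohnEig n x.1 x.2 = ν then
      (Module.finrank ℂ (HarmBi G x.1 x.2) : ℝ≥0∞) else 0 :=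
    tsum_congr fun ν => kohnMultiplicity_eq hG hn ν.2.1
  have h2 : ∀ x : ℕ × ℕ, (∑' ν : Set.Ioc 0 Λ, if kohnEig n x.1 x.2 = ν then
      (Module.finrank ℂ (HarmBi G x.1 x.2) : ℝ≥0∞) else 0) =
      if 0 < kohnEig n x.1 x.2 ∧ kohnEig n x.1 x.2 ≤ Λ then
        (Module.finrank ℂ (HarmBi G x.1 x.2) : ℝ≥0∞) else 0 := by
    intro x
    split_ifs with h
    · rw [tsum_eq_single ⟨kohnEig n x.1 x.2, h⟩ fun ν hν =>
        if_neg fun h' => hν (Subtype.ext h'.symm),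
        if_pos rfl]
    · rw [ENNReal.tsum_eq_zero]
      exact fun ν => if_neg fun h' : kohnEig n x.1 x.2 = ν.1 => h (by rw [h']; exact ν.2)
  rw [h1, ENNReal.tsum_comm, tsum_congr h2, tsum_eq_sum (s := box Λ), ← Finset.sum_filter]
  · push_cast
    rfl
  · intro x hx
    exact if_neg fun h => hx (mem_box hn h.1 h.2)

theorem toReal_kohnCount {m : ℕ} {G : Subgroup (Un (m + 2))} [Finite G] (hG : ActsFreely G)
    (Λ : ℝ) : (kohnCount G Λ).toReal =
      hyperbolaSum m (fun p q => (Module.finrank ℂ (HarmBi G p q) : ℝ)) Λ := by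
  have he : ∀ p q, kohnEig (m + 2) p q = 2 * (q : ℝ) * (p + m + 1) := fun p q => by
    rw [kohnEig]; push_cast; ring
  have hiff : ∀ x : ℕ × ℕ, (0 < kohnEig (m + 2) x.1 x.2 ∧ kohnEig (m + 2) x.1 x.2 ≤ Λ) ↔
      (1 ≤ x.2 ∧ 2 * (x.2 : ℝ) * (x.1 + m + 1) ≤ Λ) := fun x => by
    rw [he, mul_pos_iff_of_pos_right (by positivity), mul_pos_iff_of_pos_left two_pos, Nat.cast_pos,
      Nat.succ_le_iff]
  rw [kohnCount_eq hG (Nat.succ_ne_zero _), ENNReal.toReal_natCast, hyperbolaSum,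
    tsum_eq_sum (s := box Λ), ← Finset.sum_filter]
  · simp only [hiff]
    push_cast
    rfl
  · intro x hx
    refine if_neg fun h => hx ?_
    have h' := (hiff x).2 h
    exact mem_box (Nat.succ_ne_zero _) h'.1 h'.2

/-- For n = 1 the eigenvalue is 2pq, positive only if p, q ≥ 1, and in those bidegrees there are no
nonzero harmonic polynomials. -/
theorem kohnCount_dim_one {G : Subgroup (Un 1)} [Finite G] (hG : ActsFreely G) (Λ : ℝ) :
    kohnCount G Λ = 0 := by
  rw [kohnCount_eq hG one_ne_zero, Nat.cast_eq_zero]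
  refine Finset.sum_eq_zero fun x hx => ?_
  obtain ⟨p, q⟩ := x
  have h := (Finset.mem_filter.1 hx).2.1
  cases p with
  | zero => simp [kohnEig] at h
  | succ p =>
    cases q with
    | zero => simp [kohnEig] at h
    | succ q => exact finrank_HarmBi_dim_one G p q

theorem kohnCount_dim_zero (G : Subgroup (Un 0)) (Λ : ℝ) : kohnCount G Λ = 0 := by
  have h0 : IsEmpty (Sph 0) := ⟨fun x => sph_ne_zero x (Subsingleton.elim _ _)⟩
  have h1 : IsEmpty (SphQuot G) := ⟨fun y => h0.false y.out⟩
  have h2 : Subsingleton (L2Quot G) :=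
    ⟨fun u v => MeasureTheory.Lp.ext (Eventually.of_forall fun y => (h1.false y).elim)⟩
  rw [kohnCount, ENNReal.tsum_eq_zero]
  intro ν
  rw [kohnMultiplicity, rank_subsingleton', map_zero, ENat.toENNReal_zero]

theorem sphVol_pos (hn : n ≠ 0) : 0 < sphVol n := by
  have : Nonempty (Sph n) :=
    ⟨⟨EuclideanSpace.single ⟨0, Nat.pos_of_ne_zero hn⟩ 1, by simp⟩⟩
  rw [sphVol, MeasureTheory.measureReal_def]
  exact ENNReal.toReal_pos (isOpen_univ.measure_ne_zero _ Set.univ_nonempty)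
    (MeasureTheory.measure_ne_top _ _)

end KohnWeyl
end

/-! ### The theorem -/

theorem theorem1p1 (n : ℕ) :
    ∃ C : ℝ, ∀ G : Subgroup (Matrix.unitaryGroup (Fin n) ℂ), Finite G → KohnWeyl.ActsFreely G →
      (∀ Λ : ℝ, KohnWeyl.kohnCount G Λ ≠ ⊤) ∧
      Filter.Tendsto (fun Λ : ℝ => (KohnWeyl.kohnCount G Λ).toReal / Λ ^ n) Filter.atTop
        (nhds (C * (KohnWeyl.sphVol n / (Nat.card G : ℝ)))) ∧
      C * (KohnWeyl.sphVol n / (Nat.card G : ℝ)) = C * KohnWeyl.quotVol G := by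
  match n with
  | 0 =>
    refine ⟨0, fun G _ hG => ⟨fun Λ => ?_, ?_, ?_⟩⟩
    · rw [KohnWeyl.kohnCount_dim_zero]; exact ENNReal.zero_ne_top
    · simp [KohnWeyl.kohnCount_dim_zero]
    · rw [KohnWeyl.quotVol_eq hG]
  | 1 =>
    refine ⟨0, fun G _ hG => ⟨fun Λ => ?_, ?_, ?_⟩⟩
    · rw [KohnWeyl.kohnCount_dim_one hG]; exact ENNReal.zero_ne_top
    · simp [KohnWeyl.kohnCount_dim_one hG]
    · rw [KohnWeyl.quotVol_eq hG]
  | m + 2 =>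
    -- Dividing by the volume cancels the factor `sphVol` of the statement; the quotient depends on
    -- n only.
    refine ⟨KohnWeyl.weylLimit m / KohnWeyl.sphVol (m + 2), fun G _ hG => ⟨fun Λ => ?_, ?_, ?_⟩⟩
    · rw [KohnWeyl.kohnCount_eq hG (Nat.succ_ne_zero _)]; exact ENNReal.natCast_ne_top _
    · have hv := KohnWeyl.sphVol_pos (n := m + 2) (Nat.succ_ne_zero _)
      simp only [KohnWeyl.toReal_kohnCount hG]
      rw [← mul_div_assoc, div_mul_cancel₀ _ hv.ne']
      exact KohnWeyl.tendsto_hyperbolaSum_finrank hG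
    · rw [KohnWeyl.quotVol_eq hG]
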